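/- **Proposition (Standard gauge, even perturbations).** *Background.* Let $I\subset\mathbb R$ be an open interval and let $q_1,q_2,N>0$ and $\pi_1,\pi_2$ be smooth functions on $I$ with $$\dot q_1=-N\sqrt{q_2}\,\pi_2,\quad \dot\pi_1=\tfrac12N\pi_2^2q_2^{3/2}q_1^{-2},\quad \dot q_2=-N\sqrt{q_2}\,(\pi_1-\pi_2q_1^{-1}q_2),\quad \dot\pi_2=\tfrac14Nq_2^{-1/2}\big(2(\pi_1\pi_2-2)-3\pi_2^2q_1^{-1}q_2\big)$$ and $-\pi_1\pi_2q_1^{-1}+\tfrac12\pi_2^2q_1^{-2}q_2+2q_1^{-1}=0$. Thus $g=-N^2dt^2+q_1h+q_2\,dz^2$ is a vacuum metric (Bianchi III, written on the universal cover $I\times H^2\times\mathbb R$), where $h=(dx^2+dy^2)/y^2$ is the hyperbolic metric with covariant derivative $\hat D$, and $\sigma^3=dz$. *Modes.* Let $\lambda>0$, $m\in\mathbb Z$. Let $\hat S$ be a nonzero smooth real function on $H^2$ with $\triangle_h\hat S=-\lambda^2\hat S$ (for instance the lift of an eigenfunction on a closed hyperbolic surface), and let $c_m,\bar c_m$ be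 real $2\pi$-periodic functions of $z$ with $c_m'=-m\bar c_m$, $\bar c_m'=mc_m$ and $\int_0^{2\pi}c_m^2=\int_0^{2\pi}\bar c_m^2=1$. Put $S=c_m\hat S$, $\bar S=\bar c_m\hat S$, $\hat S_a=\lambda^{-1}\hat D_a\hat S$, $S_a=c_m\hat S_a$, $\bar S_a=\bar c_m\hat S_a$, $S_{ab}=c_m\frac1\lambda\sqrt{\frac2{\lambda^2+2}}\,(\hat D_a\hat D_b\hat S+\frac{\lambda^2}2\hat Sh_{ab})$, and $$(E_1)_{ab}=Sh_{ab},\quad (E_2)_{ab}=S_{ab},\quad (E_3)_{ab}=S\sigma^3_a\sigma^3_b,\quad (E_4)_{ab}=2\bar S_{(a}\sigma^3_{b)}.$$ An *even perturbation* for this mode is a tensor $$\delta g_{ab}=-2N s_0S\,(dt)_a(dt)_b+2\big(s_1S_{(a}+s_3\bar S\sigma^3_{(a}\big)(dt)_{b)}+\sum_{i=1}^4\gamma^i(E_i)_{ab}$$ with $C^2$ functions $s_0,s_1,s_3,\gamma^1,\dots,\gamma^4$ of $t\in I$. Put $$\Delta_1=\frac{\pi_1}{\pi_2}-\frac{q_2}{q_1},\quad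 \Sigma=\Delta_1+\frac{2m^2}{\lambda^2},\quad \Delta_2=\frac{\lambda\,\Sigma}{\sqrt{2(\lambda^2+2)}},\quad \Omega=q_2^2+2q_1q_2\Sigma+\frac{\lambda^2}{\lambda^2+2}q_1^2\Sigma^2 .$$ The gauge-invariant variable of the perturbation is $Q[\delta g]=-\Delta_1\gamma^1-\Delta_2\gamma^2+\gamma^3-\frac{2m}\lambda\gamma^4$. *Evolution of the gauge-invariant variable.* Put $$\alpha_{33}=-\frac{q_1}{2\Omega}\Big\{\frac{2(\lambda^2-1)}{\pi_2}-\pi_1+\frac{5\pi_2q_2}{2q_1}+\Big(\big(\tfrac{7\lambda^2}2+4\big)\pi_2+\frac{2\lambda^2(\lambda^2-1)q_1}{\pi_2q_2}\Big)\frac{\Sigma}{\lambda^2+2}+\frac{\lambda^2\pi_2q_1\Sigma^2}{(\lambda^2+2)q_2}\Big\},$$ $$V=\Big(\frac{(11\lambda^2+4)\pi_2^2q_2}{16q_1}+\frac{\lambda^2+2}4\pi_1\pi_2+\frac{\lambda^2(\lambda^2-1)^2q_1}{\pi_2^2q_2}+\frac{5\lambda^4}2-\lambda^2-3\Big)\frac1{(\lambda^2+2)q_2}+\Big(\big(\tfrac{5\lambda^2}4+1\big)\pi_2^2+\frac{\lambda^2(\lambda^2-1)q_1}{q_2}\Big)\frac{\Sigma}{(\lambda^2+2)q_2}+\frac{\lambda^2\pi_2^2q_1}{4q_2^2}\,\frac{\Sigma^2}{\lambda^2+2}.$$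 The gauge-invariant Hamilton equations for $(Q,P)$ on $I$ are $$\dot Q=\frac{N\Omega P}{q_1\sqrt{q_2}},\qquad \dot P=-\Big(V-\frac{\Omega\,\alpha_{33}^2}{q_1}\Big)\frac{NQ}{\sqrt{q_2}}-\dot\alpha_{33}Q. \tag{1}$$ *Claim.* Let $G_{ab}$ be a covariant 2-tensor field on the spacetime. The following are equivalent. (a) For every solution $(Q,P)$ of (1) on $I$, the tensor $\delta g_{ab}=Q\,G_{ab}$ (with the same $G$ for all $Q$) is an even perturbation for the given mode, it solves the linearized vacuum Einstein equations on the background $g$, and its gauge-invariant variable is $Q$. (b) $G_{ab}=G^{(\mathrm{even})}_{ab}$, where $$\begin{aligned}G^{(\mathrm{even})}_{ab}={}&-\frac1\Omega\Big[q_1q_2(E_1)_{ab}+2q_1^2\Delta_2(E_2)_{ab}-q_2(q_1\Delta_1+q_2)(E_3)_{ab}+\frac{2m}\lambda q_1q_2(E_4)_{ab}\\&\qquad+\frac{N^2}{\lambda^2+2}\Big(\frac{4(\lambda^2-1)q_1}{\pi_2^2}+3q_2\Big)S(dt)_a(dt)_b\Big]+\frac{2N^2}{\dot q_1}\Big(\Upsilon_1+\frac{\lambda^2}{\lambda^2+2}\Upsilon_2\Big)S(dt)_a(dt)_b\\&-\frac2{\lambda^2+2}(\Upsilon_2+\Upsilon_3)\big(\lambda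 S_{(a}(dt)_{b)}+m\bar S\sigma^3_{(a}(dt)_{b)}\big)-\frac{4m}{\lambda^2}\Upsilon_1\bar S\sigma^3_{(a}(dt)_{b)},\end{aligned}$$ with $\Upsilon_1=\frac{d}{dt}\big(\frac{q_1q_2}\Omega\big)$, $\Upsilon_2=\frac{d}{dt}\big(\frac{q_1^2\Sigma}\Omega\big)$, $\Upsilon_3=\frac{q_1^2\dot\Sigma}\Omega$. -/

import Mathlib

noncomputable section

namespace BianchiIII

open scoped ContDiff

/-! ### The universal cover `I × H² × ℝ`, its invariant frame, and tensor calculus -/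

/-- Points `(t, x, y, z)` of the universal cover; the spacetime is the part where `y > 0` and
`t` lies in the time interval. -/
abbrev Pt := Fin 4 → ℝ

/-- The region `{t ∈ I, y > 0}`. -/
def domain (I : Set ℝ) : Set Pt := {p | p 0 ∈ I ∧ 0 < p 2}

/-- Fields of covectors, given by their components in the coframe
`dt, σ¹ = dx / y, σ² = dy / y, σ³ = dz`. -/
abbrev Covector := Fin 4 → Pt → ℝ

/-- Fields of covariant 2-tensors, given by their components in the same coframe. -/
abbrev Tensor2 := Fin 4 → Fin 4 → Pt → ℝ

/-- Fields of covariant 3-tensors, given by their components in the same coframe. -/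
abbrev Tensor3 := Fin 4 → Fin 4 → Fin 4 → Pt → ℝ

/-- The derivative `e_a f` of a function along the dual frame
`e₀ = ∂_t, e₁ = y ∂_x, e₂ = y ∂_y, e₃ = ∂_z`. -/
def frameD (a : Fin 4) (f : Pt → ℝ) (p : Pt) : ℝ :=
  (![1, p 2, p 2, 1] a) * fderiv ℝ f p (Pi.single a 1)

/-- Structure constants of the frame, `[e_a, e_b] = ∑ d, frameC a b d • e_d`; the only nonzero
bracket is `[e₁, e₂] = - e₁`. -/
def frameC (a b d : Fin 4) : ℝ :=
  if a = 1 ∧ b = 2 ∧ d = 1 then -1 else if a = 2 ∧ b = 1 ∧ d = 1 then 1 else 0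

/-- Components of the inverse metric. -/
def invMetric (g : Tensor2) (a b : Fin 4) (p : Pt) : ℝ :=
  (Matrix.of fun i j => g i j p)⁻¹ a b

/-- `g (∇_{e_a} e_b, e_c)` for the Levi-Civita connection of `g`, by the Koszul formula. -/
def connLow (g : Tensor2) (a b c : Fin 4) (p : Pt) : ℝ :=
  (1 / 2) * (frameD a (g b c) p + frameD b (g a c) p - frameD c (g a b) p
    + ∑ d, (frameC a b d * g d c p - frameC a c d * g d b p - frameC b c d * g d a p))

/-- The connection coefficients, `∇_{e_a} e_b = ∑ d, conn g a b d • e_d`. -/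
def conn (g : Tensor2) (a b d : Fin 4) (p : Pt) : ℝ :=
  ∑ c, invMetric g d c p * connLow g a b c p

/-- `∇_a V_b`. -/
def covD1 (g : Tensor2) (V : Covector) : Tensor2 := fun a b p =>
  frameD a (V b) p - ∑ d, conn g a b d p * V d p

/-- `∇_c h_{ab}`, with indices in the order `c, a, b`. -/
def covD2 (g : Tensor2) (h : Tensor2) : Tensor3 := fun c a b p =>
  frameD c (h a b) p - ∑ d, (conn g c a d p * h d b p + conn g c b d p * h a d p)

/-- `∇_e T_{cab}`, with indices in the order `e, c, a, b`. -/
def covD3 (g : Tensor2) (T : Tensor3) (e c a b : Fin 4) (p : Pt) : ℝ :=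
  frameD e (T c a b) p
    - ∑ d, (conn g e c d p * T d a b p + conn g e a d p * T c d b p + conn g e b d p * T c a d p)

/-- `∇_c ∇_d h_{ab}`, with indices in the order `c, d, a, b`. -/
def covDD (g : Tensor2) (h : Tensor2) : Fin 4 → Fin 4 → Fin 4 → Fin 4 → Pt → ℝ :=
  covD3 g (covD2 g h)

/-- The first variation of the Ricci tensor of the metric `g` in the direction `h`:
`½ g^{cd} (∇_c ∇_a h_{bd} + ∇_c ∇_b h_{ad} - ∇_c ∇_d h_{ab} - ∇_a ∇_b h_{cd})`. -/
def linRicci (g h : Tensor2) (a b : Fin 4) (p : Pt) : ℝ :=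
  (1 / 2) * ∑ c, ∑ d, invMetric g c d p *
    (covDD g h c a b d p + covDD g h c b a d p - covDD g h c d a b p - covDD g h a b c d p)

/-- The covector `dt`. -/
def dt : Covector := fun a _ => if a = 0 then 1 else 0

/-- The covector `σ³ = dz`. -/
def sigma3 : Covector := fun a _ => if a = 3 then 1 else 0

/-- `u_{(a} v_{b)} = (u_a v_b + u_b v_a) / 2`. -/
def symProd (u v : Covector) : Tensor2 := fun a b p => (u a p * v b p + u b p * v a p) / 2

/-- The standard metric `h = σ¹ σ¹ + σ² σ²` of the hyperbolic plane. -/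
def hypMetric : Tensor2 := fun a b _ => if a = b ∧ (a = 1 ∨ a = 2) then 1 else 0

/-- The time-independent metric `dt² + h + dz²`. On functions and tensors pulled back from the
hyperbolic plane its covariant derivative is the covariant derivative `D̂` of `h`. -/
def stdMetric : Tensor2 := fun a b _ => if a = b then 1 else 0

/-! ### The background -/

/-- The background variables `q₁, q₂, π₁, π₂, N`, functions of time. -/
structure Background where
  q₁ : ℝ → ℝ
  q₂ : ℝ → ℝ
  π₁ : ℝ → ℝ
  π₂ : ℝ → ℝ
  N : ℝ → ℝ

namespace Background

variable (B : Background)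

/-- The spacetime metric `- N² dt² + q₁ h + q₂ dz²`. -/
def metric : Tensor2 := fun a b p =>
  - B.N (p 0) ^ 2 * (dt a p * dt b p) + B.q₁ (p 0) * hypMetric a b p
    + B.q₂ (p 0) * (sigma3 a p * sigma3 b p)

/-- The background variables are smooth on `I`, the metric is nondegenerate of the right
signature, and the canonical evolution equations and the Hamiltonian constraint hold. -/
structure IsVacuum (I : Set ℝ) : Prop where
  smooth_q₁ : ContDiffOn ℝ ∞ B.q₁ I
  smooth_q₂ : ContDiffOn ℝ ∞ B.q₂ I
  smooth_π₁ : ContDiffOn ℝ ∞ B.π₁ I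
  smooth_π₂ : ContDiffOn ℝ ∞ B.π₂ I
  smooth_N : ContDiffOn ℝ ∞ B.N I
  q₁_pos : ∀ t ∈ I, 0 < B.q₁ t
  q₂_pos : ∀ t ∈ I, 0 < B.q₂ t
  N_pos : ∀ t ∈ I, 0 < B.N t
  evol_q₁ : ∀ t ∈ I, HasDerivAt B.q₁ (-(B.N t * √(B.q₂ t) * B.π₂ t)) t
  evol_π₁ : ∀ t ∈ I, HasDerivAt B.π₁
    ((1 / 2) * B.N t * B.π₂ t ^ 2 * (B.q₂ t * √(B.q₂ t)) / B.q₁ t ^ 2) t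
  evol_q₂ : ∀ t ∈ I, HasDerivAt B.q₂
    (-(B.N t * √(B.q₂ t) * (B.π₁ t - B.π₂ t * B.q₂ t / B.q₁ t))) t
  evol_π₂ : ∀ t ∈ I, HasDerivAt B.π₂
    ((1 / 4) * B.N t / √(B.q₂ t) *
      (2 * (B.π₁ t * B.π₂ t - 2) - 3 * B.π₂ t ^ 2 * B.q₂ t / B.q₁ t)) t
  constraint : ∀ t ∈ I,
    -(B.π₁ t * B.π₂ t / B.q₁ t) + (1 / 2) * B.π₂ t ^ 2 * B.q₂ t / B.q₁ t ^ 2 + 2 / B.q₁ t = 0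

/-- `Σ = π₁ / π₂ - q₂ / q₁ + 2 m² / λ²`. -/
def Sig (lam : ℝ) (m : ℤ) (t : ℝ) : ℝ :=
  B.π₁ t / B.π₂ t - B.q₂ t / B.q₁ t + 2 * (m : ℝ) ^ 2 / lam ^ 2

/-- `Δ₁ = π₁ / π₂ - q₂ / q₁`. -/
def Delta₁ (t : ℝ) : ℝ := B.π₁ t / B.π₂ t - B.q₂ t / B.q₁ t

/-- `Δ₂ = λ Σ / √(2 (λ² + 2))`. -/
def Delta₂ (lam : ℝ) (m : ℤ) (t : ℝ) : ℝ := lam / √(2 * (lam ^ 2 + 2)) * B.Sig lam m t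

/-- `Ω = q₂² + 2 q₁ q₂ Σ + λ² / (λ² + 2) q₁² Σ²`. -/
def Omega (lam : ℝ) (m : ℤ) (t : ℝ) : ℝ :=
  B.q₂ t ^ 2 + 2 * B.q₁ t * B.q₂ t * B.Sig lam m t
    + lam ^ 2 / (lam ^ 2 + 2) * B.q₁ t ^ 2 * B.Sig lam m t ^ 2

/-- `Υ₁ = d/dt (q₁ q₂ / Ω)`. -/
def Ups₁ (lam : ℝ) (m : ℤ) (t : ℝ) : ℝ :=
  deriv (fun s => B.q₁ s * B.q₂ s / B.Omega lam m s) t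

/-- `Υ₂ = d/dt (q₁² Σ / Ω)`. -/
def Ups₂ (lam : ℝ) (m : ℤ) (t : ℝ) : ℝ :=
  deriv (fun s => B.q₁ s ^ 2 * B.Sig lam m s / B.Omega lam m s) t

/-- `Υ₃ = (q₁² / Ω) dΣ/dt`. -/
def Ups₃ (lam : ℝ) (m : ℤ) (t : ℝ) : ℝ :=
  B.q₁ t ^ 2 * deriv (B.Sig lam m) t / B.Omega lam m t

/-- The function `α₃₃` that makes the gauge-invariant Hamiltonian diagonal. -/
def alpha₃₃ (lam : ℝ) (m : ℤ) (t : ℝ) : ℝ :=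
  -(B.q₁ t / (2 * B.Omega lam m t)) *
    (2 * (lam ^ 2 - 1) / B.π₂ t - B.π₁ t + (5 / 2) * B.π₂ t * B.q₂ t / B.q₁ t
      + ((7 * lam ^ 2 / 2 + 4) * B.π₂ t
          + 2 * lam ^ 2 * (lam ^ 2 - 1) * B.q₁ t / (B.π₂ t * B.q₂ t))
        * (B.Sig lam m t / (lam ^ 2 + 2))
      + lam ^ 2 * B.π₂ t * B.q₁ t * B.Sig lam m t ^ 2 / ((lam ^ 2 + 2) * B.q₂ t))

/-- The coefficient of `N Q² / (2 √q₂)` in the gauge-invariant Hamiltonian that does not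
involve `α₃₃`. -/
def potential (lam : ℝ) (m : ℤ) (t : ℝ) : ℝ :=
  ((11 * lam ^ 2 + 4) * B.π₂ t ^ 2 * B.q₂ t / (16 * B.q₁ t)
      + (lam ^ 2 + 2) / 4 * B.π₁ t * B.π₂ t
      + lam ^ 2 * (lam ^ 2 - 1) ^ 2 * B.q₁ t / (B.π₂ t ^ 2 * B.q₂ t)
      + 5 * lam ^ 4 / 2 - lam ^ 2 - 3) * (1 / ((lam ^ 2 + 2) * B.q₂ t))
    + ((5 * lam ^ 2 / 4 + 1) * B.π₂ t ^ 2 + lam ^ 2 * (lam ^ 2 - 1) * B.q₁ t / B.q₂ t)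
      * (B.Sig lam m t / ((lam ^ 2 + 2) * B.q₂ t))
    + lam ^ 2 * B.π₂ t ^ 2 * B.q₁ t / (4 * B.q₂ t ^ 2) * (B.Sig lam m t ^ 2 / (lam ^ 2 + 2))

/-- The Hamilton equations on `I` of the gauge-invariant canonical pair `(Q, P)`. -/
def GaugeInvariantEvolution (lam : ℝ) (m : ℤ) (I : Set ℝ) (Q P : ℝ → ℝ) : Prop :=
  ∀ t ∈ I,
    HasDerivAt Q (B.N t * B.Omega lam m t * P t / (B.q₁ t * √(B.q₂ t))) t ∧
    HasDerivAt P
      (-((B.potential lam m t - B.Omega lam m t * B.alpha₃₃ lam m t ^ 2 / B.q₁ t)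
          * (B.N t * Q t / √(B.q₂ t)))
        - deriv (B.alpha₃₃ lam m) t * Q t) t

end Background

/-! ### The even mode tensors -/

/-- The mode functions: `S` (the function `Ŝ` of `(x, y)`) on the base, `c` and `cbar` on the
fiber. -/
structure ModeFunctions where
  S : ℝ × ℝ → ℝ
  c : ℝ → ℝ
  cbar : ℝ → ℝ

namespace ModeFunctions

variable (M : ModeFunctions)

/-- `Ŝ` as a function on the universal cover. -/
def hatS (p : Pt) : ℝ := M.S (p 1, p 2)

/-- `D̂_a D̂_b Ŝ`. -/
def hessS : Tensor2 := covD1 stdMetric (fun a => frameD a M.hatS)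

/-- `Ŝ` is a nonzero smooth real eigenfunction of the hyperbolic Laplacian with eigenvalue
`- λ²`, and `c, cbar` are normalized `2π`-periodic functions with `c' = - m cbar`,
`cbar' = m c`. -/
structure IsMode (lam : ℝ) (m : ℤ) : Prop where
  smooth : ContDiffOn ℝ ∞ M.S {w | 0 < w.2}
  nonzero : ∃ w : ℝ × ℝ, 0 < w.2 ∧ M.S w ≠ 0
  eigen : ∀ p : Pt, 0 < p 2 → ∑ a, M.hessS a a p = - lam ^ 2 * M.hatS p
  deriv_c : ∀ z, HasDerivAt M.c (-(m : ℝ) * M.cbar z) z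
  deriv_cbar : ∀ z, HasDerivAt M.cbar ((m : ℝ) * M.c z) z
  periodic_c : Function.Periodic M.c (2 * Real.pi)
  periodic_cbar : Function.Periodic M.cbar (2 * Real.pi)
  norm_c : ∫ z in (0 : ℝ)..(2 * Real.pi), M.c z ^ 2 = 1
  norm_cbar : ∫ z in (0 : ℝ)..(2 * Real.pi), M.cbar z ^ 2 = 1

/-- `S = c_m Ŝ`. -/
def modeS (p : Pt) : ℝ := M.c (p 3) * M.hatS p

/-- `S̄ = c̄_m Ŝ`. -/
def modeSbar (p : Pt) : ℝ := M.cbar (p 3) * M.hatS p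

/-- `Ŝ_a = λ⁻¹ D̂_a Ŝ`. -/
def hatSvec (lam : ℝ) : Covector := fun a p => frameD a M.hatS p / lam

/-- `S_a = c_m Ŝ_a`. -/
def modeSvec (lam : ℝ) : Covector := fun a p => M.c (p 3) * M.hatSvec lam a p

/-- `S̄_a = c̄_m Ŝ_a`. -/
def modeSbarVec (lam : ℝ) : Covector := fun a p => M.cbar (p 3) * M.hatSvec lam a p

/-- `S̄ σ³_a`. -/
def modeSbarSigma : Covector := fun a p => M.modeSbar p * sigma3 a p

/-- `Ŝ_{ab} = λ⁻¹ √(2 / (λ² + 2)) (D̂_a D̂_b Ŝ + (λ² / 2) Ŝ h_{ab})`. -/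
def hatSten (lam : ℝ) : Tensor2 := fun a b p =>
  1 / lam * √(2 / (lam ^ 2 + 2)) * (M.hessS a b p + lam ^ 2 / 2 * M.hatS p * hypMetric a b p)

/-- `E₁ = S h`. -/
def E₁ : Tensor2 := fun a b p => M.modeS p * hypMetric a b p

/-- `E₂ = c_m Ŝ_{ab}`. -/
def E₂ (lam : ℝ) : Tensor2 := fun a b p => M.c (p 3) * M.hatSten lam a b p

/-- `E₃ = S σ³ σ³`. -/
def E₃ : Tensor2 := fun a b p => M.modeS p * (sigma3 a p * sigma3 b p)

/-- `E₄ = 2 S̄_{(a} σ³_{b)}`. -/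
def E₄ (lam : ℝ) : Tensor2 := fun a b p => 2 * symProd (M.modeSbarVec lam) sigma3 a b p

end ModeFunctions

/-! ### Even perturbations -/

/-- The even metric variables `γ¹, …, γ⁴`, the even lapse function `s₀`, and the even base and
fiber shift functions `s₁, s₃`, all functions of time. -/
structure EvenVariables where
  γ₁ : ℝ → ℝ
  γ₂ : ℝ → ℝ
  γ₃ : ℝ → ℝ
  γ₄ : ℝ → ℝ
  s₀ : ℝ → ℝ
  s₁ : ℝ → ℝ
  s₃ : ℝ → ℝ

namespace EvenVariables

variable (v : EvenVariables)

/-- All the variables are twice continuously differentiable on `I`. -/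
def IsRegular (I : Set ℝ) : Prop :=
  ContDiffOn ℝ 2 v.γ₁ I ∧ ContDiffOn ℝ 2 v.γ₂ I ∧ ContDiffOn ℝ 2 v.γ₃ I ∧
  ContDiffOn ℝ 2 v.γ₄ I ∧ ContDiffOn ℝ 2 v.s₀ I ∧ ContDiffOn ℝ 2 v.s₁ I ∧
  ContDiffOn ℝ 2 v.s₃ I

/-- The perturbation of the spacetime metric,
`- 2 N δN dt dt + 2 δN_{(a} dt_{b)} + ∑ γⁱ E_i` with `δN = s₀ S`,
`δN_a = s₁ S_a + s₃ S̄ σ³_a`. -/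
def perturbation (B : Background) (M : ModeFunctions) (lam : ℝ) : Tensor2 := fun a b p =>
  - 2 * B.N (p 0) * (v.s₀ (p 0) * M.modeS p) * (dt a p * dt b p)
    + 2 * symProd (fun i r => v.s₁ (r 0) * M.modeSvec lam i r
        + v.s₃ (r 0) * M.modeSbarSigma i r) dt a b p
    + (v.γ₁ (p 0) * M.E₁ a b p + v.γ₂ (p 0) * M.E₂ lam a b p
      + v.γ₃ (p 0) * M.E₃ a b p + v.γ₄ (p 0) * M.E₄ lam a b p)

/-- The gauge-invariant configuration variable
`- Δ₁ γ¹ - Δ₂ γ² + γ³ - (2 m / λ) γ⁴`. -/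
def gaugeInvariant (B : Background) (lam : ℝ) (m : ℤ) (t : ℝ) : ℝ :=
  - B.Delta₁ t * v.γ₁ t - B.Delta₂ lam m t * v.γ₂ t + v.γ₃ t - 2 * (m : ℝ) / lam * v.γ₄ t

end EvenVariables

/-- `h` is an even perturbation, for the given mode, of the spacetime metric of `B` over the time
interval `I`; it solves the linearized vacuum Einstein equations; and `Q` is its gauge-invariant
configuration variable. -/
def IsEvenVacuumPerturbation (B : Background) (M : ModeFunctions) (lam : ℝ) (m : ℤ)
    (I : Set ℝ) (Q : ℝ → ℝ) (h : Tensor2) : Prop :=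
  (∃ v : EvenVariables, v.IsRegular I ∧
    (∀ p ∈ domain I, ∀ a b, h a b p = v.perturbation B M lam a b p) ∧
    (∀ t ∈ I, Q t = v.gaugeInvariant B lam m t)) ∧
  ∀ p ∈ domain I, ∀ a b, linRicci B.metric h a b p = 0

/-- The tensor `G^(even)`. -/
def Geven (B : Background) (M : ModeFunctions) (lam : ℝ) (m : ℤ) : Tensor2 := fun a b p =>
  let t := p 0
  (-1) / B.Omega lam m t *
      (B.q₁ t * B.q₂ t * M.E₁ a b p
        + 2 * B.q₁ t ^ 2 * B.Delta₂ lam m t * M.E₂ lam a b p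
        - B.q₂ t * (B.q₁ t * B.Delta₁ t + B.q₂ t) * M.E₃ a b p
        + 2 * ((m : ℝ) / lam) * B.q₁ t * B.q₂ t * M.E₄ lam a b p
        + B.N t ^ 2 / (lam ^ 2 + 2)
          * (4 * (lam ^ 2 - 1) * B.q₁ t / B.π₂ t ^ 2 + 3 * B.q₂ t)
          * M.modeS p * (dt a p * dt b p))
    + 2 * B.N t ^ 2 / deriv B.q₁ t
        * (B.Ups₁ lam m t + lam ^ 2 / (lam ^ 2 + 2) * B.Ups₂ lam m t)
        * M.modeS p * (dt a p * dt b p)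
    - 2 / (lam ^ 2 + 2) * (B.Ups₂ lam m t + B.Ups₃ lam m t)
        * (lam * symProd (M.modeSvec lam) dt a b p
          + (m : ℝ) * symProd M.modeSbarSigma dt a b p)
    - 4 * (m : ℝ) / lam ^ 2 * B.Ups₁ lam m t * symProd M.modeSbarSigma dt a b p

end BianchiIII

end

noncomputable section

namespace BianchiIII

open scoped ContDiff Topology
open Filter

/-! ### Frame derivatives -/

/-! In proper time, d/dτ = N⁻¹ d/dt, the background is governed by the expansion rates H₁, H₂ (half
the logarithmic derivatives of q₁, q₂): the constraint becomes q₁H₁(H₁ + 2H₂) = 1, and H₁' = H₁(H₂ -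
H₁), H₂' = -H₂(2H₁ + H₂).

A tensor of the given mode is, at each time, a vector of seven amplitudes: time-time, base shift,
fiber shift, base trace, base trace-free part, fiber-fiber, base-fiber. The eigenvalue equation and
[e₁, e₂] = -e₁ reduce the derivatives of Ŝ to a finite jet, so covariant differentiation acts on
amplitudes by explicit formulas, and the linearized Ricci tensor becomes seven expressions
`ricciAmp` in the amplitudes and their first two proper time derivatives
(`linRicci_of_hasAmplitudes`).

Every amplitude vector is uniquely the sum of an infinitesimal diffeomorphism (α, β, ζ), which is
read off algebraically from γ¹, γ², γ⁴, and of a remainder (A, F, S, Z) with Q = q₂Z. Since the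
background is vacuum, `ricciAmp` sees only the remainder (`ricciAmp_gaugeAmp`).

(b) implies (a). For Q G^(even) the decomposition is explicit
(`Background.IsVacuum.amp_standardVariables`). Measuring rates in units of H₁ leaves a problem in h
= H₂/H₁, u = q₁Σ/q₂, k = Qq₂/Ω and a rescaled momentum p. There A and F are linear in (k, p) and
satisfy the two constraints identically; Hamilton's equations give their first order evolution
equations (`lapse_shift_evolution`). The remaining field equations follow from these and from
differentiated constraints (`einsteinAmp_eq_zero`), as the Bianchi identities predict.

(a) implies (b). For a solution Q put D_Q = Q(G - G^(even)). It solves the linearized equations and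
has vanishing gauge-invariant variable, and with Z = 0 the constraints force A = F = S = 0
(`eq_zero_of_constraints`); so D_Q is pure gauge, with a vector X_Q. All D_Q are multiples of one
tensor, hence T X_Q = Q X_T for any two solutions. At a given time choose T with T = 0 and T' ≠ 0.
Then D_T vanishes there, so X_T vanishes there, and because lapse and shift contain X_T', so does
X_T'. Differentiating T X_Q = Q X_T gives T' X_Q = 0, so X_Q vanishes everywhere and D_Q = 0
(`eq_zero_of_isGaugeDefect`). In other words, a nonzero gauge vector proportional to Q would put the
derivative of Q into the metric. This needs solutions on all of I with prescribed data at any time,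
which the Picard series of a linear system provides (`exists_solution_linear_ode`). -/

theorem isOpen_domain {I : Set ℝ} (hI : IsOpen I) : IsOpen (domain I) :=
  (hI.preimage (continuous_apply 0)).inter (isOpen_lt continuous_const (continuous_apply 2))

theorem frameD_congr {f g : Pt → ℝ} {p : Pt} (h : f =ᶠ[𝓝 p] g) (a : Fin 4) :
    frameD a f p = frameD a g p := by
  simp only [frameD, h.fderiv_eq]

/-- The frame derivatives of `f` at `p` are the numbers `d a`. -/
def HasFrameD (f : Pt → ℝ) (d : Fin 4 → ℝ) (p : Pt) : Prop :=
  DifferentiableAt ℝ f p ∧ ∀ a, frameD a f p = d a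

theorem HasFrameD.mul {f g : Pt → ℝ} {d e : Fin 4 → ℝ} {p : Pt} (hf : HasFrameD f d p)
    (hg : HasFrameD g e p) :
    HasFrameD (fun r => f r * g r) (fun a => d a * g p + f p * e a) p := by
  refine ⟨hf.1.mul hg.1, fun a => ?_⟩
  simp only [← hf.2 a, ← hg.2 a, frameD]
  rw [fderiv_fun_mul hf.1 hg.1]
  simp only [add_apply, smul_apply, smul_eq_mul]
  ring

theorem HasFrameD.const (c : ℝ) (p : Pt) : HasFrameD (fun _ => c) (fun _ => 0) p := by
  refine ⟨differentiableAt_const c, fun a => ?_⟩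
  simp [frameD]

theorem HasFrameD.congr_deriv {f : Pt → ℝ} {d e : Fin 4 → ℝ} {p : Pt} (hf : HasFrameD f d p)
    (h : ∀ a, d a = e a) : HasFrameD f e p :=
  ⟨hf.1, fun a => (hf.2 a).trans (h a)⟩

theorem hasFrameD_coord (i : Fin 4) {φ : ℝ → ℝ} {φ' : ℝ} {p : Pt}
    (h : HasDerivAt φ φ' (p i)) :
    HasFrameD (fun r => φ (r i)) (fun a => if a = i then ![1, p 2, p 2, 1] a * φ' else 0) p := by
  have h1 : HasFDerivAt (fun r : Pt => φ (r i))
      (φ' • (ContinuousLinearMap.proj i : Pt →L[ℝ] ℝ)) p :=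
    h.comp_hasFDerivAt p (hasFDerivAt_apply i p)
  refine ⟨h1.differentiableAt, fun a => ?_⟩
  simp only [frameD, h1.fderiv]
  by_cases hai : a = i
  · subst hai; simp
  · simp [hai, Ne.symm hai]

theorem hasFrameD_time {φ : ℝ → ℝ} {φ' : ℝ} {p : Pt} (h : HasDerivAt φ φ' (p 0)) :
    HasFrameD (fun r => φ (r 0)) ![φ', 0, 0, 0] p :=
  (hasFrameD_coord 0 h).congr_deriv fun a => by fin_cases a <;> simp

theorem hasFrameD_fiber {φ : ℝ → ℝ} {φ' : ℝ} {p : Pt} (h : HasDerivAt φ φ' (p 3)) :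
    HasFrameD (fun r => φ (r 3)) ![0, 0, 0, φ'] p :=
  (hasFrameD_coord 3 h).congr_deriv fun a => by fin_cases a <;> simp

/-! ### Frame derivatives on the half plane -/

/-- The vector field `y ∂_x` of the half plane. -/
def hypD₁ (f : ℝ × ℝ → ℝ) (w : ℝ × ℝ) : ℝ := w.2 * fderiv ℝ f w (1, 0)

/-- The vector field `y ∂_y` of the half plane. -/
def hypD₂ (f : ℝ × ℝ → ℝ) (w : ℝ × ℝ) : ℝ := w.2 * fderiv ℝ f w (0, 1)

theorem hasFrameD_base {φ : ℝ × ℝ → ℝ} {p : Pt} (h : DifferentiableAt ℝ φ (p 1, p 2)) :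
    HasFrameD (fun r => φ (r 1, r 2)) ![0, hypD₁ φ (p 1, p 2), hypD₂ φ (p 1, p 2), 0] p := by
  have h1 : HasFDerivAt (fun r : Pt => (r 1, r 2))
      ((ContinuousLinearMap.proj 1 : Pt →L[ℝ] ℝ).prod (ContinuousLinearMap.proj 2)) p :=
    (hasFDerivAt_apply 1 p).prodMk (hasFDerivAt_apply 2 p)
  have h2 : HasFDerivAt (fun r : Pt => φ (r 1, r 2)) _ p :=
    HasFDerivAt.comp p (g := φ) h.hasFDerivAt h1
  refine ⟨h2.differentiableAt, fun a => ?_⟩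
  simp only [frameD, h2.fderiv]
  fin_cases a <;> simp [hypD₁, hypD₂, Prod.mk_zero_zero]

/-- The half plane. -/
def halfPlane : Set (ℝ × ℝ) := {w | 0 < w.2}

theorem isOpen_halfPlane : IsOpen halfPlane := isOpen_lt continuous_const continuous_snd

theorem contDiffOn_fderiv_halfPlane {f : ℝ × ℝ → ℝ} (hf : ContDiffOn ℝ ∞ f halfPlane)
    (v : ℝ × ℝ) : ContDiffOn ℝ ∞ (fun w => fderiv ℝ f w v) halfPlane :=
  (hf.fderiv_of_isOpen isOpen_halfPlane (by simp)).clm_apply contDiffOn_const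

theorem contDiffOn_hypD₁ {f : ℝ × ℝ → ℝ} (hf : ContDiffOn ℝ ∞ f halfPlane) :
    ContDiffOn ℝ ∞ (hypD₁ f) halfPlane :=
  contDiff_snd.contDiffOn.mul (contDiffOn_fderiv_halfPlane hf _)

theorem contDiffOn_hypD₂ {f : ℝ × ℝ → ℝ} (hf : ContDiffOn ℝ ∞ f halfPlane) :
    ContDiffOn ℝ ∞ (hypD₂ f) halfPlane :=
  contDiff_snd.contDiffOn.mul (contDiffOn_fderiv_halfPlane hf _)

theorem differentiableAt_of_halfPlane {f : ℝ × ℝ → ℝ} (hf : ContDiffOn ℝ ∞ f halfPlane)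
    {w : ℝ × ℝ} (hw : w ∈ halfPlane) : DifferentiableAt ℝ f w :=
  (hf.contDiffAt (isOpen_halfPlane.mem_nhds hw)).differentiableAt (by simp)

/-- `[e₁, e₂] = - e₁` on smooth functions. -/
theorem hypD₁_hypD₂ {f : ℝ × ℝ → ℝ} (hf : ContDiffOn ℝ ∞ f halfPlane) {w : ℝ × ℝ}
    (hw : w ∈ halfPlane) : hypD₁ (hypD₂ f) w = hypD₂ (hypD₁ f) w - hypD₁ f w := by
  have key : ∀ v u : ℝ × ℝ, fderiv ℝ (fun w : ℝ × ℝ => w.2 * fderiv ℝ f w v) w u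
      = u.2 * fderiv ℝ f w v + w.2 * fderiv ℝ (fderiv ℝ f) w u v := by
    intro v u
    have hd : DifferentiableAt ℝ (fderiv ℝ f) w :=
      ((hf.fderiv_of_isOpen isOpen_halfPlane (m := ∞) (by simp)).contDiffAt
        (isOpen_halfPlane.mem_nhds hw)).differentiableAt (by simp)
    have h1 : HasFDerivAt (fun w : ℝ × ℝ => fderiv ℝ f w v)
        ((fderiv ℝ (fderiv ℝ f) w).flip v) w := by
      simpa using hd.hasFDerivAt.clm_apply (hasFDerivAt_const v w)
    rw [(hasFDerivAt_snd.fun_mul h1).fderiv]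
    simp
    ring
  -- By symmetry of second derivatives only the derivative of the coefficient y survives in the
  -- commutator.
  have hs : fderiv ℝ (fderiv ℝ f) w (1, 0) (0, 1) = fderiv ℝ (fderiv ℝ f) w (0, 1) (1, 0) :=
    ((hf.contDiffAt (isOpen_halfPlane.mem_nhds hw)).isSymmSndFDerivAt
      (by simp only [minSmoothness_of_isRCLikeNormedField]; exact ENat.LEInfty.out)) _ _
  have e1 : hypD₁ (hypD₂ f) w =
      w.2 * fderiv ℝ (fun w : ℝ × ℝ => w.2 * fderiv ℝ f w (0, 1)) w (1, 0) :=
    rfl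
  have e2 : hypD₂ (hypD₁ f) w =
      w.2 * fderiv ℝ (fun w : ℝ × ℝ => w.2 * fderiv ℝ f w (1, 0)) w (0, 1) :=
    rfl
  rw [e1, e2, key, key, hs]
  simp only [hypD₁]
  ring

end BianchiIII

end

noncomputable section

namespace BianchiIII

open scoped ContDiff Topology
open Filter

/-! ### Jets of an eigenfunction of the hyperbolic Laplacian -/

theorem hypD₁_congr {f g : ℝ × ℝ → ℝ} (h : Set.EqOn f g halfPlane) {w : ℝ × ℝ}
    (hw : w ∈ halfPlane) : hypD₁ f w = hypD₁ g w := by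
  simp only [hypD₁, (h.eventuallyEq_of_mem (isOpen_halfPlane.mem_nhds hw)).fderiv_eq]

theorem hypD₂_congr {f g : ℝ × ℝ → ℝ} (h : Set.EqOn f g halfPlane) {w : ℝ × ℝ}
    (hw : w ∈ halfPlane) : hypD₂ f w = hypD₂ g w := by
  simp only [hypD₂, (h.eventuallyEq_of_mem (isOpen_halfPlane.mem_nhds hw)).fderiv_eq]

theorem fderiv_linear_combination {f g k : ℝ × ℝ → ℝ} (hf : ContDiffOn ℝ ∞ f halfPlane)
    (hg : ContDiffOn ℝ ∞ g halfPlane) (hk : ContDiffOn ℝ ∞ k halfPlane) (a b c : ℝ)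
    {w : ℝ × ℝ} (hw : w ∈ halfPlane) (v : ℝ × ℝ) :
    fderiv ℝ (fun r => a * f r + b * g r + c * k r) w v
      = a * fderiv ℝ f w v + b * fderiv ℝ g w v + c * fderiv ℝ k w v := by
  have h1 := (differentiableAt_of_halfPlane hf hw).hasFDerivAt.const_mul a
  have h2 := (differentiableAt_of_halfPlane hg hw).hasFDerivAt.const_mul b
  have h3 := (differentiableAt_of_halfPlane hk hw).hasFDerivAt.const_mul c
  rw [((h1.fun_add h2).fun_add h3).fderiv]
  simp

theorem hypD₁_linear {f g k : ℝ × ℝ → ℝ} (hf : ContDiffOn ℝ ∞ f halfPlane)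
    (hg : ContDiffOn ℝ ∞ g halfPlane) (hk : ContDiffOn ℝ ∞ k halfPlane) (a b c : ℝ)
    {w : ℝ × ℝ} (hw : w ∈ halfPlane) :
    hypD₁ (fun r => a * f r + b * g r + c * k r) w
      = a * hypD₁ f w + b * hypD₁ g w + c * hypD₁ k w := by
  simp only [hypD₁, fderiv_linear_combination hf hg hk a b c hw]
  ring

theorem hypD₂_linear {f g k : ℝ × ℝ → ℝ} (hf : ContDiffOn ℝ ∞ f halfPlane)
    (hg : ContDiffOn ℝ ∞ g halfPlane) (hk : ContDiffOn ℝ ∞ k halfPlane) (a b c : ℝ)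
    {w : ℝ × ℝ} (hw : w ∈ halfPlane) :
    hypD₂ (fun r => a * f r + b * g r + c * k r) w
      = a * hypD₂ f w + b * hypD₂ g w + c * hypD₂ k w := by
  simp only [hypD₂, fderiv_linear_combination hf hg hk a b c hw]
  ring

/-- A smooth eigenfunction of the hyperbolic Laplacian `e₁ e₁ + e₂ e₂ - e₂` on the half plane. -/
structure IsHypEigen (lam : ℝ) (S : ℝ × ℝ → ℝ) : Prop where
  smooth : ContDiffOn ℝ ∞ S halfPlane
  eigen : ∀ w ∈ halfPlane, hypD₁ (hypD₁ S) w + hypD₂ (hypD₂ S) w - hypD₂ S w = -lam ^ 2 * S w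

/-- The component `(2, 2)` of the trace-free Hessian of `S`. -/
def hess₂₂ (lam : ℝ) (S : ℝ × ℝ → ℝ) (w : ℝ × ℝ) : ℝ :=
  hypD₂ (hypD₂ S) w + lam ^ 2 / 2 * S w

/-- The component `(1, 2)` of the trace-free Hessian of `S`. -/
def hess₁₂ (S : ℝ × ℝ → ℝ) : ℝ × ℝ → ℝ := hypD₂ (hypD₁ S)

/-- The derivatives of `S` up to order three that remain after use of the eigenvalue equation. -/
def jet (lam : ℝ) (S : ℝ × ℝ → ℝ) : Fin 7 → ℝ × ℝ → ℝ :=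
  ![S, hypD₁ S, hypD₂ S, hess₂₂ lam S, hess₁₂ S, hypD₂ (hess₂₂ lam S), hypD₂ (hess₁₂ S)]

/-- The derivatives along `e₁` of the seven jet functions with values `j` and with fourth
derivatives `x`, `y`. -/
def jetD₁ (lam : ℝ) (j : Fin 7 → ℝ) (x y : ℝ) : Fin 7 → ℝ :=
  ![j 1, -lam ^ 2 / 2 * j 0 - j 3 + j 2, j 4 - j 1, j 6 - 2 * j 4 + (1 + lam ^ 2 / 2) * j 1,
    -j 5 + 2 * j 3 - (1 + lam ^ 2 / 2) * j 2,
    y - 3 * j 6 + 2 * j 4 + (1 + lam ^ 2 / 2) * (j 4 - j 1),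
    -x + 3 * j 5 - 2 * j 3 - (1 + lam ^ 2 / 2) * (j 3 - lam ^ 2 / 2 * j 0 - j 2)]

/-- The derivatives along `e₂` of the seven jet functions with values `j` and with fourth
derivatives `x`, `y`. -/
def jetD₂ (lam : ℝ) (j : Fin 7 → ℝ) (x y : ℝ) : Fin 7 → ℝ :=
  ![j 2, j 4, j 3 - lam ^ 2 / 2 * j 0, j 5, j 6, x, y]

theorem hypD₂_jet (lam : ℝ) (S : ℝ × ℝ → ℝ) (w : ℝ × ℝ) (k : Fin 7) :
    hypD₂ (jet lam S k) w = jetD₂ lam (fun k => jet lam S k w)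
      (hypD₂ (hypD₂ (hess₂₂ lam S)) w) (hypD₂ (hypD₂ (hess₁₂ S)) w) k := by
  fin_cases k <;> simp [jet, jetD₂, hess₂₂, hess₁₂]

namespace IsHypEigen

variable {lam : ℝ} {S : ℝ × ℝ → ℝ} (hS : IsHypEigen lam S)
include hS

theorem smooth_hess₂₂ : ContDiffOn ℝ ∞ (hess₂₂ lam S) halfPlane :=
  (contDiffOn_hypD₂ (contDiffOn_hypD₂ hS.smooth)).add (contDiffOn_const.mul hS.smooth)

theorem smooth_hess₁₂ : ContDiffOn ℝ ∞ (hess₁₂ S) halfPlane :=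
  contDiffOn_hypD₂ (contDiffOn_hypD₁ hS.smooth)

theorem smooth_jet (k : Fin 7) : ContDiffOn ℝ ∞ (jet lam S k) halfPlane := by
  fin_cases k
  · exact hS.smooth
  · exact contDiffOn_hypD₁ hS.smooth
  · exact contDiffOn_hypD₂ hS.smooth
  · exact hS.smooth_hess₂₂
  · exact hS.smooth_hess₁₂
  · exact contDiffOn_hypD₂ hS.smooth_hess₂₂
  · exact contDiffOn_hypD₂ hS.smooth_hess₁₂

theorem hypD₁_hypD₁ : Set.EqOn (hypD₁ (hypD₁ S))
    (fun w => (-lam ^ 2 / 2) * S w + (-1) * hess₂₂ lam S w + 1 * hypD₂ S w) halfPlane := by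
  intro w hw
  have := hS.eigen w hw
  simp only [hess₂₂]
  linarith

theorem hypD₁_hypD₂_base : Set.EqOn (hypD₁ (hypD₂ S))
    (fun w => 1 * hess₁₂ S w + (-1) * hypD₁ S w + 0 * S w) halfPlane := by
  intro w hw
  simp only [hypD₁_hypD₂ hS.smooth hw, hess₁₂]
  ring

/-- This and `hypD₁_hess₁₂` are the two components of the identity div(trace-free Hessian) = -(1 +
λ²/2) dS. The constant is -λ² from the Laplacian, -1 from the Gauss curvature and +λ²/2 from
removing the trace. -/
theorem hypD₁_hess₂₂ : Set.EqOn (hypD₁ (hess₂₂ lam S))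
    (fun w => 1 * hypD₂ (hess₁₂ S) w + (-2) * hess₁₂ S w + (1 + lam ^ 2 / 2) * hypD₁ S w)
    halfPlane := by
  intro w hw
  have h1 : hypD₁ (hess₂₂ lam S) w
      = 1 * hypD₁ (hypD₂ (hypD₂ S)) w + (lam ^ 2 / 2) * hypD₁ S w + 0 * hypD₁ S w := by
    rw [← hypD₁_linear (contDiffOn_hypD₂ (contDiffOn_hypD₂ hS.smooth)) hS.smooth hS.smooth _ _ _ hw]
    exact hypD₁_congr (fun r _ => by simp [hess₂₂]) hw
  have h2 : hypD₁ (hypD₂ (hypD₂ S)) w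
      = hypD₂ (hypD₁ (hypD₂ S)) w - hypD₁ (hypD₂ S) w :=
    hypD₁_hypD₂ (contDiffOn_hypD₂ hS.smooth) hw
  rw [hypD₂_congr hS.hypD₁_hypD₂_base hw, hypD₂_linear hS.smooth_hess₁₂ (contDiffOn_hypD₁ hS.smooth)
    hS.smooth _ _ _ hw, hS.hypD₁_hypD₂_base hw] at h2
  rw [h1, h2]
  simp only [hess₁₂]
  ring

theorem hypD₁_hess₁₂ : Set.EqOn (hypD₁ (hess₁₂ S))
    (fun w => (-1) * hypD₂ (hess₂₂ lam S) w + 2 * hess₂₂ lam S w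
      + (-(1 + lam ^ 2 / 2)) * hypD₂ S w) halfPlane := by
  intro w hw
  have h2 : hypD₁ (hess₁₂ S) w = hypD₂ (hypD₁ (hypD₁ S)) w - hypD₁ (hypD₁ S) w :=
    BianchiIII.hypD₁_hypD₂ (contDiffOn_hypD₁ hS.smooth) hw
  rw [hypD₂_congr hS.hypD₁_hypD₁ hw, hypD₂_linear hS.smooth hS.smooth_hess₂₂
    (contDiffOn_hypD₂ hS.smooth) _ _ _ hw, hS.hypD₁_hypD₁ hw] at h2
  have h3 : hypD₂ (hypD₂ S) w = hess₂₂ lam S w - lam ^ 2 / 2 * S w := by simp [hess₂₂]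
  rw [h2, h3]
  ring

/-- The divergence identity trades every e₁-derivative of the Hessian for e₂-derivatives, which is
why seven functions suffice through order three. For the two third order entries, e₁ is moved past
e₂ and the identity is differentiated along e₂. -/
theorem hypD₁_jet {w : ℝ × ℝ} (hw : w ∈ halfPlane) (k : Fin 7) :
    hypD₁ (jet lam S k) w = jetD₁ lam (fun k => jet lam S k w)
      (hypD₂ (hypD₂ (hess₂₂ lam S)) w) (hypD₂ (hypD₂ (hess₁₂ S)) w) k := by
  have h3 : hypD₂ (hypD₂ S) w = hess₂₂ lam S w - lam ^ 2 / 2 * S w := by simp [hess₂₂]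
  have h4 : hypD₂ (hypD₁ S) w = hess₁₂ S w := rfl
  fin_cases k
  · rfl
  · simpa [jet, jetD₁, ← sub_eq_add_neg] using hS.hypD₁_hypD₁ hw
  · simpa [jet, jetD₁, ← sub_eq_add_neg] using hS.hypD₁_hypD₂_base hw
  · simpa [jet, jetD₁, ← sub_eq_add_neg] using hS.hypD₁_hess₂₂ hw
  · simp only [jet, jetD₁]
    refine (hS.hypD₁_hess₁₂ hw).trans ?_
    simp; ring
  · have h2 := BianchiIII.hypD₁_hypD₂ hS.smooth_hess₂₂ hw
    rw [hypD₂_congr hS.hypD₁_hess₂₂ hw, hypD₂_linear (contDiffOn_hypD₂ hS.smooth_hess₁₂)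
      hS.smooth_hess₁₂ (contDiffOn_hypD₁ hS.smooth) _ _ _ hw, hS.hypD₁_hess₂₂ hw, h4] at h2
    refine h2.trans ?_
    simp [jet, jetD₁]; ring
  · have h2 := BianchiIII.hypD₁_hypD₂ hS.smooth_hess₁₂ hw
    rw [hypD₂_congr hS.hypD₁_hess₁₂ hw, hypD₂_linear (contDiffOn_hypD₂ hS.smooth_hess₂₂)
      hS.smooth_hess₂₂ (contDiffOn_hypD₂ hS.smooth) _ _ _ hw, hS.hypD₁_hess₁₂ hw, h3] at h2
    refine h2.trans ?_
    simp [jet, jetD₁]; ring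

/-- The gradient of a nonzero eigenfunction is not identically zero. -/
theorem exists_gradient_ne_zero (hlam : 0 < lam) (hne : ∃ w ∈ halfPlane, S w ≠ 0) :
    ∃ w ∈ halfPlane, hypD₁ S w ≠ 0 ∨ hypD₂ S w ≠ 0 := by
  by_contra! h
  obtain ⟨w, hw, hSw⟩ := hne
  have h1 : hypD₁ (hypD₁ S) w = 0 := by
    rw [hypD₁_congr (g := fun _ => 0) (fun r hr => (h r hr).1) hw]; simp [hypD₁]
  have h2 : hypD₂ (hypD₂ S) w = 0 := by
    rw [hypD₂_congr (g := fun _ => 0) (fun r hr => (h r hr).2) hw]; simp [hypD₂]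
  have := hS.eigen w hw
  rw [h1, h2, (h w hw).2] at this
  have : lam ^ 2 * S w = 0 := by linarith
  simp [hlam.ne', hSw] at this

/-- The trace-free Hessian of a nonzero eigenfunction is not identically zero. -/
theorem exists_hessian_ne_zero (hlam : 0 < lam) (hne : ∃ w ∈ halfPlane, S w ≠ 0) :
    ∃ w ∈ halfPlane, hess₂₂ lam S w ≠ 0 ∨ hess₁₂ S w ≠ 0 := by
  by_contra! h
  have h0 : ∀ {f : ℝ × ℝ → ℝ}, Set.EqOn f (fun _ => 0) halfPlane → ∀ w ∈ halfPlane,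
      hypD₁ f w = 0 ∧ hypD₂ f w = 0 := fun hf w hw => by
    rw [hypD₁_congr hf hw, hypD₂_congr hf hw]; simp [hypD₁, hypD₂]
  have hU := h0 (f := hess₂₂ lam S) fun w hw => (h w hw).1
  have hV := h0 (f := hess₁₂ S) fun w hw => (h w hw).2
  obtain ⟨w, hw, hgrad⟩ := hS.exists_gradient_ne_zero hlam hne
  have e1 := hS.hypD₁_hess₂₂ hw
  have e2 := hS.hypD₁_hess₁₂ hw
  simp only [(hU w hw).1, (hV w hw).2, (h w hw).2] at e1
  simp only [(hV w hw).1, (hU w hw).2, (h w hw).1] at e2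
  have hpos : (1 + lam ^ 2 / 2) ≠ 0 := by positivity
  -- With a vanishing trace-free Hessian the divergence identity leaves (1 + λ²/2) dS = 0.
  rcases hgrad with hg | hg
  · exact hg ((mul_eq_zero.1 (by linarith : (1 + lam ^ 2 / 2) * hypD₁ S w = 0)).resolve_left hpos)
  · exact hg ((mul_eq_zero.1 (by linarith : (1 + lam ^ 2 / 2) * hypD₂ S w = 0)).resolve_left hpos)

end IsHypEigen

end BianchiIII

end

noncomputable section

namespace BianchiIII

open scoped ContDiff Topology
open Filter

/-! ### The background in terms of its Hubble rates -/

namespace Background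

variable (B : Background)

/-- The expansion rate of the base. -/
def H₁ (t : ℝ) : ℝ := -(√(B.q₂ t) * B.π₂ t) / (2 * B.q₁ t)

/-- The expansion rate of the fiber. -/
def H₂ (t : ℝ) : ℝ := -(B.π₁ t - B.π₂ t * B.q₂ t / B.q₁ t) / (2 * √(B.q₂ t))

variable {B} {I : Set ℝ} (hB : B.IsVacuum I) {t : ℝ}
include hB

theorem IsVacuum.constraint' (ht : t ∈ I) :
    2 * B.π₁ t * B.π₂ t * B.q₁ t = B.π₂ t ^ 2 * B.q₂ t + 4 * B.q₁ t := by
  have h := hB.constraint t ht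
  have hq := (hB.q₁_pos t ht).ne'
  field_simp at h
  linarith

/-- With π₂ = 0 the constraint would read 0 = 4q₁. Every quotient by π₂, H₁ or the derivative of q₁
rests on this. -/
theorem IsVacuum.π₂_ne_zero (ht : t ∈ I) : B.π₂ t ≠ 0 := by
  intro h
  have := hB.constraint' ht
  rw [h] at this
  have := hB.q₁_pos t ht
  simp at *
  linarith

theorem IsVacuum.π₂_eq (ht : t ∈ I) : B.π₂ t * √(B.q₂ t) = -2 * B.q₁ t * B.H₁ t := by
  have := (hB.q₁_pos t ht).ne'
  simp only [H₁]
  field_simp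

theorem IsVacuum.H₁_ne_zero (ht : t ∈ I) : B.H₁ t ≠ 0 := by
  have h1 := (hB.q₁_pos t ht).ne'
  have h2 := hB.π₂_ne_zero ht
  have h3 := (Real.sqrt_pos.2 (hB.q₂_pos t ht)).ne'
  simp [H₁, h1, h2, h3]

theorem IsVacuum.sqrt_mul_self (ht : t ∈ I) : √(B.q₂ t) * √(B.q₂ t) = B.q₂ t :=
  Real.mul_self_sqrt (hB.q₂_pos t ht).le

/-- The Hamiltonian constraint written in the rates; it later serves to eliminate q₁ from every
identity. -/
theorem IsVacuum.friedmann (ht : t ∈ I) :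
    B.q₁ t * (B.H₁ t * (B.H₁ t + 2 * B.H₂ t)) = 1 := by
  have h1 := (hB.q₁_pos t ht).ne'
  have h3 := (Real.sqrt_pos.2 (hB.q₂_pos t ht)).ne'
  have hs := hB.sqrt_mul_self ht
  have hc := hB.constraint' ht
  simp only [H₁, H₂]
  field_simp
  have hs' : √(B.q₂ t) ^ 2 = B.q₂ t := by rw [sq, hs]
  simp only [hs']
  linarith

theorem IsVacuum.hasDerivAt_q₁ (ht : t ∈ I) :
    HasDerivAt B.q₁ (B.N t * (2 * B.H₁ t * B.q₁ t)) t := by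
  have h1 := (hB.q₁_pos t ht).ne'
  convert hB.evol_q₁ t ht using 1
  simp only [H₁]
  field_simp

theorem IsVacuum.hasDerivAt_q₂ (ht : t ∈ I) :
    HasDerivAt B.q₂ (B.N t * (2 * B.H₂ t * B.q₂ t)) t := by
  have h1 := (hB.q₁_pos t ht).ne'
  have h3 := (Real.sqrt_pos.2 (hB.q₂_pos t ht)).ne'
  have hs := hB.sqrt_mul_self ht
  convert hB.evol_q₂ t ht using 1
  simp only [H₂]
  field_simp
  simp only [sq, hs]
  ring

theorem IsVacuum.hasDerivAt_sqrt (ht : t ∈ I) :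
    HasDerivAt (fun s => √(B.q₂ s)) (B.N t * (B.H₂ t * √(B.q₂ t))) t := by
  have h3 := (Real.sqrt_pos.2 (hB.q₂_pos t ht)).ne'
  have hs := hB.sqrt_mul_self ht
  convert (hB.hasDerivAt_q₂ ht).sqrt (hB.q₂_pos t ht).ne' using 1
  field_simp
  simp only [sq, hs]

/-- The evolution equation of π₂ leaves a curvature term; the constraint turns it into rates.
Together with `IsVacuum.hasDerivAt_H₂` this makes the rates a closed system. -/
theorem IsVacuum.hasDerivAt_H₁ (ht : t ∈ I) :
    HasDerivAt B.H₁ (B.N t * (B.H₁ t * (B.H₂ t - B.H₁ t))) t := by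
  have h1 := (hB.q₁_pos t ht).ne'
  have h3 := (Real.sqrt_pos.2 (hB.q₂_pos t ht)).ne'
  have hs := hB.sqrt_mul_self ht
  have hc := hB.constraint' ht
  have hs' : √(B.q₂ t) ^ 2 = B.q₂ t := by rw [sq, hs]
  have h := (((hB.hasDerivAt_sqrt ht).mul (hB.evol_π₂ t ht)).neg).div
    ((hB.hasDerivAt_q₁ ht).const_mul 2) (by simpa using h1)
  refine HasDerivAt.congr_deriv (f := B.H₁) h ?_
  simp only [H₁, H₂, Pi.neg_apply, Pi.mul_apply]
  field_simp
  simp only [hs']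
  linear_combination (-2 * B.N t) * hc

theorem IsVacuum.hasDerivAt_H₂ (ht : t ∈ I) :
    HasDerivAt B.H₂ (B.N t * (-B.H₂ t * (2 * B.H₁ t + B.H₂ t))) t := by
  have h1 := (hB.q₁_pos t ht).ne'
  have h3 := (Real.sqrt_pos.2 (hB.q₂_pos t ht)).ne'
  have hs := hB.sqrt_mul_self ht
  have hc := hB.constraint' ht
  have hs' : √(B.q₂ t) ^ 2 = B.q₂ t := by rw [sq, hs]
  have h := (((hB.evol_π₁ t ht).sub (((hB.evol_π₂ t ht).mul (hB.hasDerivAt_q₂ ht)).div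
    (hB.hasDerivAt_q₁ ht) h1)).neg).div
    ((hB.hasDerivAt_sqrt ht).const_mul 2) (by simpa using h3)
  refine HasDerivAt.congr_deriv (f := B.H₂) h ?_
  simp only [H₁, H₂, Pi.neg_apply, Pi.mul_apply, Pi.sub_apply, Pi.div_apply]
  field_simp
  simp only [hs']
  linear_combination (2 * B.N t * B.q₂ t) * hc

/-- Written so as to exhibit n = (dN/dt)/N², the only form in which the derivative of the lapse
enters the normalized connection. -/
theorem IsVacuum.hasDerivAt_N (hI : IsOpen I) (ht : t ∈ I) :
    HasDerivAt B.N (B.N t ^ 2 * (deriv B.N t / B.N t ^ 2)) t := by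
  have h1 := (hB.N_pos t ht).ne'
  have h2 : DifferentiableAt ℝ B.N t :=
    (hB.smooth_N.contDiffAt (hI.mem_nhds ht)).differentiableAt (by simp)
  rw [mul_div_cancel₀ _ (pow_ne_zero 2 h1)]
  exact h2.hasDerivAt

end Background

/-! ### The connection of the background -/

/-- The number of indices equal to `0`. -/
def timeWeight : Fin 4 → ℕ := ![1, 0, 0, 0]

/-- Connection coefficients of the background in the frame normalized by the lapse function, for
expansion rates `h₁, h₂`, with `n` the logarithmic derivative of the lapse function. -/
def rotCoeff (n h₁ h₂ q₁ q₂ : ℝ) : Fin 4 → Fin 4 → Fin 4 → ℝ :=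
  ![![![n, 0, 0, 0], ![0, h₁, 0, 0], ![0, 0, h₁, 0], ![0, 0, 0, h₂]],
    ![![0, h₁, 0, 0], ![q₁ * h₁, 0, 1, 0], ![0, -1, 0, 0], ![0, 0, 0, 0]],
    ![![0, 0, h₁, 0], ![0, 0, 0, 0], ![q₁ * h₁, 0, 0, 0], ![0, 0, 0, 0]],
    ![![0, 0, 0, h₂], ![0, 0, 0, 0], ![0, 0, 0, 0], ![q₂ * h₂, 0, 0, 0]]]

/-- The diagonal of the inverse metric in the normalized frame. -/
def invDiag (q₁ q₂ : ℝ) : Fin 4 → ℝ := ![-1, 1 / q₁, 1 / q₁, 1 / q₂]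

namespace Background

variable {B : Background} {I : Set ℝ} (hB : B.IsVacuum I) {p : Pt}
include hB

theorem IsVacuum.invMetric_eq (hp : p ∈ domain I) (a b : Fin 4) :
    invMetric B.metric a b p
      = if a = b then invDiag (B.q₁ (p 0)) (B.q₂ (p 0)) a / B.N (p 0) ^ (2 * timeWeight a)
        else 0 := by
  have h1 := (hB.q₁_pos _ hp.1).ne'
  have h2 := (hB.q₂_pos _ hp.1).ne'
  have h3 := (hB.N_pos _ hp.1).ne'
  have hm : (Matrix.of fun i j => B.metric i j p)⁻¹ = Matrix.diagonal fun a =>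
      invDiag (B.q₁ (p 0)) (B.q₂ (p 0)) a / B.N (p 0) ^ (2 * timeWeight a) := by
    apply Matrix.inv_eq_right_inv
    ext i j
    rw [Matrix.mul_diagonal]
    fin_cases i <;> fin_cases j <;>
      simp [metric, dt, sigma3, hypMetric, invDiag, timeWeight, h1, h2] <;>
      field_simp
  rw [invMetric, hm, Matrix.diagonal_apply]

theorem IsVacuum.frameD_metric (hI : IsOpen I) (hp : p ∈ domain I) (a b c : Fin 4) :
    frameD a (B.metric b c) p = if a = 0 then
      -(2 * B.N (p 0) * (B.N (p 0) ^ 2 * (deriv B.N (p 0) / B.N (p 0) ^ 2)))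
          * (dt b p * dt c p)
        + B.N (p 0) * (2 * B.H₁ (p 0) * B.q₁ (p 0)) * hypMetric b c p
        + B.N (p 0) * (2 * B.H₂ (p 0) * B.q₂ (p 0)) * (sigma3 b p * sigma3 c p) else 0 := by
  have h : HasDerivAt (fun t => -B.N t ^ 2 * (dt b p * dt c p) + B.q₁ t * hypMetric b c p
      + B.q₂ t * (sigma3 b p * sigma3 c p)) _ (p 0) :=
    ((((hB.hasDerivAt_N hI hp.1).pow 2).neg.mul_const _).add
      ((hB.hasDerivAt_q₁ hp.1).mul_const _)).add ((hB.hasDerivAt_q₂ hp.1).mul_const _)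
  refine ((hasFrameD_time h).2 a).trans ?_
  fin_cases a <;> simp

/-- Passing from ∂_t to the unit normal only inserts one power of N per time index; what remains
depends on the rates, on q₁, q₂ and on n. -/
theorem IsVacuum.conn_eq (hI : IsOpen I) (hp : p ∈ domain I) (a b d : Fin 4) :
    conn B.metric a b d p * B.N (p 0) ^ timeWeight d
      = rotCoeff (deriv B.N (p 0) / B.N (p 0) ^ 2) (B.H₁ (p 0)) (B.H₂ (p 0)) (B.q₁ (p 0))
          (B.q₂ (p 0)) a b d * B.N (p 0) ^ (timeWeight a + timeWeight b) := by
  have h1 := (hB.q₁_pos _ hp.1).ne'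
  have h2 := (hB.q₂_pos _ hp.1).ne'
  have h3 := (hB.N_pos _ hp.1).ne'
  have hc : conn B.metric a b d p
      = invDiag (B.q₁ (p 0)) (B.q₂ (p 0)) d / B.N (p 0) ^ (2 * timeWeight d)
        * connLow B.metric a b d p := by
    simp only [conn, hB.invMetric_eq hp]
    simp
  rw [hc]
  simp only [connLow, hB.frameD_metric hI hp, Fin.sum_univ_four]
  fin_cases a <;> fin_cases b <;> fin_cases d <;>
    simp [metric, dt, sigma3, hypMetric, invDiag, timeWeight, rotCoeff, frameC] <;>
    field_simp <;> ring

end Background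

end BianchiIII

end

noncomputable section

namespace BianchiIII

open scoped ContDiff Topology
open Filter

/-! ### Tensor fields built from a mode -/

/-- The number of indices equal to `3`. -/
def fiberWeight : Fin 4 → ℕ := ![0, 0, 0, 1]

namespace ModeFunctions

variable (M : ModeFunctions)

/-- The fiber function of a component with `k` fiber indices. -/
def fiberFn (k : ℕ) : ℝ → ℝ := if Even k then M.c else M.cbar

/-- The values of the jet functions of the mode. -/
def jetAt (lam : ℝ) (p : Pt) : Fin 7 → ℝ := fun k => jet lam M.S k (p 1, p 2)

/-- The derivatives of the jet functions of the mode along `e₁`. -/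
def jetAt₁ (lam : ℝ) (p : Pt) : Fin 7 → ℝ :=
  jetD₁ lam (M.jetAt lam p) (hypD₂ (hypD₂ (hess₂₂ lam M.S)) (p 1, p 2))
    (hypD₂ (hypD₂ (hess₁₂ M.S)) (p 1, p 2))

/-- The derivatives of the jet functions of the mode along `e₂`. -/
def jetAt₂ (lam : ℝ) (p : Pt) : Fin 7 → ℝ :=
  jetD₂ lam (M.jetAt lam p) (hypD₂ (hypD₂ (hess₂₂ lam M.S)) (p 1, p 2))
    (hypD₂ (hypD₂ (hess₁₂ M.S)) (p 1, p 2))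

end ModeFunctions

/-- The factor produced by differentiation along the fiber of a component with `k` fiber
indices. -/
def fiberSign (m : ℝ) (k : ℕ) : ℝ := if Even k then -m else m

/-- The four normalized frame derivatives of a component with values `f (τ, j)`, with time
weight `n` and fiber weight `k`. -/
def compD {ι : Type*} (f : (ι → ℝ) → (Fin 7 → ℝ) → ℝ) (n k : ℕ) (ν m : ℝ) (τ τ' : ι → ℝ)
    (j j₁ j₂ : Fin 7 → ℝ) : Fin 4 → ℝ :=
  ![f τ' j + n * ν * f τ j, f τ j₁, f τ j₂, fiberSign m k * f τ j]

theorem ModeFunctions.hasDerivAt_fiberFn {M : ModeFunctions} {lam : ℝ} {m : ℤ}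
    (hM : M.IsMode lam m) (k : ℕ) (z : ℝ) :
    HasDerivAt (M.fiberFn k) (fiberSign m k * M.fiberFn (1 + k) z) z := by
  by_cases h : Even k
  · simpa [fiberFn, fiberSign, h, Nat.even_add_one, add_comm 1 k] using hM.deriv_c z
  · simpa [fiberFn, fiberSign, h, Nat.even_add_one, add_comm 1 k] using hM.deriv_cbar z

/-- Each frame vector differentiates one kind of factor: e₀ the time-dependent ones, e₁ and e₂ the
jet, e₃ the fiber function, which it exchanges with its partner. The result has the same product
shape with weights raised by the new index, so the computation can be iterated for second
derivatives. -/
theorem hasFrameD_component {B : Background} {I : Set ℝ} (hB : B.IsVacuum I) (hI : IsOpen I)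
    {M : ModeFunctions} {lam : ℝ} {m : ℤ} (hM : M.IsMode lam m) (hS : IsHypEigen lam M.S)
    {ι : Type*} [Fintype ι] {f : (ι → ℝ) → (Fin 7 → ℝ) → ℝ} (hf : IsBilinearMap ℝ f) (n k : ℕ)
    {τ : ℝ → ι → ℝ} {τ' : ι → ℝ} {p : Pt} (hp : p ∈ domain I)
    (hτ : ∀ i, HasDerivAt (fun t => τ t i) (B.N (p 0) * τ' i) (p 0)) :
    HasFrameD (fun r => B.N (r 0) ^ n * M.fiberFn k (r 3) * f (τ (r 0)) (M.jetAt lam r))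
      (fun e => B.N (p 0) ^ (timeWeight e + n) * M.fiberFn (fiberWeight e + k) (p 3)
        * compD f n k (deriv B.N (p 0) / B.N (p 0) ^ 2) m (τ (p 0)) τ' (M.jetAt lam p)
            (M.jetAt₁ lam p) (M.jetAt₂ lam p) e) p := by
  have hw : (p 1, p 2) ∈ halfPlane := hp.2
  have hpos := (hB.N_pos _ hp.1).ne'
  have hN := hasFrameD_time ((hB.hasDerivAt_N hI hp.1).pow n)
  have hz := hasFrameD_fiber (p := p) (M.hasDerivAt_fiberFn hM k (p 3))
  let Φ := hf.toContinuousBilinearMap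
  have h1 : HasFDerivAt (fun r : Pt => τ (r 0))
      ((ContinuousLinearMap.proj 0 : Pt →L[ℝ] ℝ).smulRight (B.N (p 0) • τ')) p := by
    have h := HasFDerivAt.comp p (g := τ) (f := fun r : Pt => r 0)
      (hasDerivAt_pi.2 hτ).hasFDerivAt (hasFDerivAt_apply 0 p)
    refine h.congr_fderiv ?_
    ext v i
    simp
  have h2 : ∀ i, HasFrameD (fun r => jet lam M.S i (r 1, r 2))
      ![0, M.jetAt₁ lam p i, M.jetAt₂ lam p i, 0] p := fun i => by
    refine (hasFrameD_base (differentiableAt_of_halfPlane (hS.smooth_jet i) hw)).congr_deriv ?_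
    intro a
    rw [hS.hypD₁_jet hw, hypD₂_jet]
    rfl
  have h3 : HasFDerivAt (M.jetAt lam) _ p :=
    hasFDerivAt_pi.2 fun i => (h2 i).1.hasFDerivAt
  have h4 := Φ.hasFDerivAt_of_bilinear h1 h3
  have hΦ : HasFrameD (fun r => f (τ (r 0)) (M.jetAt lam r))
      ![B.N (p 0) * f τ' (M.jetAt lam p), f (τ (p 0)) (M.jetAt₁ lam p),
        f (τ (p 0)) (M.jetAt₂ lam p), 0] p := by
    refine ⟨h4.differentiableAt, fun a => ?_⟩
    -- The derivative of the whole jet along e_a, with the frame factor y absorbed.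
    have h5 : (![1, p 2, p 2, 1] a) • (ContinuousLinearMap.pi
        fun i => fderiv ℝ (fun r : Pt => jet lam M.S i (r 1, r 2)) p) (Pi.single a 1)
        = ![0, M.jetAt₁ lam p, M.jetAt₂ lam p, 0] a := by
      ext i
      refine ((h2 i).2 a).trans ?_
      fin_cases a <;> rfl
    have h6 : frameD a (fun r => f (τ (r 0)) (M.jetAt lam r)) p
        = (![1, p 2, p 2, 1] a) * (Φ (τ (p 0)) ((ContinuousLinearMap.pi
            fun i => fderiv ℝ (fun r : Pt => jet lam M.S i (r 1, r 2)) p) (Pi.single a 1))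
          + Φ (((ContinuousLinearMap.proj 0 : Pt →L[ℝ] ℝ).smulRight (B.N (p 0) • τ'))
            (Pi.single a 1)) (M.jetAt lam p)) := by
      rw [frameD]
      congr 1
      exact congrArg (fun L : Pt →L[ℝ] ℝ => L (Pi.single a 1)) h4.fderiv
    rw [h6, mul_add, ← smul_eq_mul, ← map_smul, h5]
    have h0 : f (τ (p 0)) 0 = 0 := map_zero (Φ (τ (p 0)))
    fin_cases a <;> simp [Φ, h0]
  refine ((hN.mul hz).mul hΦ).congr_deriv fun a => ?_
  -- The exponent n - 1 is truncated, so n = 0 is treated apart; there both sides vanish.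
  have hn : (n : ℝ) * B.N (p 0) ^ (n - 1) * (B.N (p 0) ^ 2 * (deriv B.N (p 0) / B.N (p 0) ^ 2))
      = B.N (p 0) ^ (1 + n) * n * (deriv B.N (p 0) / B.N (p 0) ^ 2) := by
    rcases n with _ | n
    · simp
    · field_simp
      simp
      ring
  fin_cases a
  · simp [timeWeight, fiberWeight, compD] at hn ⊢
    rw [hn]
    ring
  · simp [timeWeight, fiberWeight, compD]
  · simp [timeWeight, fiberWeight, compD]
  · simp [timeWeight, fiberWeight, compD]
    ring

/-- A connection coefficient is nonzero only if it preserves the parity of the number of fiber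
indices. Hence every connection term carries the same fiber function and the same power of N as the
derivative term it accompanies. -/
theorem conn_mul_component {B : Background} {I : Set ℝ} (hB : B.IsVacuum I) (hI : IsOpen I)
    (M : ModeFunctions) {p : Pt} (hp : p ∈ domain I) (a b d : Fin 4) (n k : ℕ) (x : ℝ) :
    conn B.metric a b d p * (B.N (p 0) ^ (timeWeight d + n)
        * M.fiberFn (fiberWeight d + k) (p 3) * x)
      = B.N (p 0) ^ (timeWeight a + timeWeight b + n)
        * M.fiberFn (fiberWeight a + fiberWeight b + k) (p 3)
        * (rotCoeff (deriv B.N (p 0) / B.N (p 0) ^ 2) (B.H₁ (p 0)) (B.H₂ (p 0)) (B.q₁ (p 0))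
          (B.q₂ (p 0)) a b d * x) := by
  have h1 := hB.conn_eq hI hp a b d
  have h2 : rotCoeff (deriv B.N (p 0) / B.N (p 0) ^ 2) (B.H₁ (p 0)) (B.H₂ (p 0)) (B.q₁ (p 0))
      (B.q₂ (p 0)) a b d * M.fiberFn (fiberWeight d + k) (p 3)
      = rotCoeff (deriv B.N (p 0) / B.N (p 0) ^ 2) (B.H₁ (p 0)) (B.H₂ (p 0)) (B.q₁ (p 0))
      (B.q₂ (p 0)) a b d * M.fiberFn (fiberWeight a + fiberWeight b + k) (p 3) := by
    have h3 : M.fiberFn (2 + k) = M.fiberFn k := by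
      simp [ModeFunctions.fiberFn, Nat.even_add]
    fin_cases a <;> fin_cases b <;> fin_cases d <;> simp [rotCoeff, fiberWeight, h3]
  rw [pow_add, pow_add]
  linear_combination (B.N (p 0) ^ n * M.fiberFn (fiberWeight d + k) (p 3) * x) * h1
    + (B.N (p 0) ^ (timeWeight a + timeWeight b) * B.N (p 0) ^ n * x) * h2

/-- The components of the symmetric 2-tensor of a mode with amplitudes `v`. -/
def comp₂ (v j : Fin 7 → ℝ) : Fin 4 → Fin 4 → ℝ :=
  ![![v 0 * j 0, v 1 * j 1, v 1 * j 2, v 2 * j 0],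
    ![v 1 * j 1, v 3 * j 0 - v 4 * j 3, v 4 * j 4, v 6 * j 1],
    ![v 1 * j 2, v 4 * j 4, v 3 * j 0 + v 4 * j 3, v 6 * j 2],
    ![v 2 * j 0, v 6 * j 1, v 6 * j 2, v 5 * j 0]]

/-- The components of the 3-tensor of a mode, symmetric in the last two indices, with
amplitudes `τ`. -/
def comp₃ (lam : ℝ) (τ : Fin 24 → ℝ) (j : Fin 7 → ℝ) : Fin 4 → Fin 4 → Fin 4 → ℝ :=
  ![![![τ 0 * j 0,
        τ 1 * j 1,
        τ 1 * j 2,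
        τ 2 * j 0],
      ![τ 1 * j 1,
        τ 3 * j 0 - τ 4 * j 3,
        τ 4 * j 4,
        τ 5 * j 1],
      ![τ 1 * j 2,
        τ 4 * j 4,
        τ 3 * j 0 + τ 4 * j 3,
        τ 5 * j 2],
      ![τ 2 * j 0,
        τ 5 * j 1,
        τ 5 * j 2,
        τ 6 * j 0]],
    ![![τ 7 * j 1,
        τ 8 * j 0 - τ 9 * j 3,
        τ 9 * j 4,
        τ 10 * j 1],
      ![τ 8 * j 0 - τ 9 * j 3,
        τ 11 * j 1 + 2 * τ 12 * j 1 - (1 + lam ^ 2 / 2) * (τ 13 * j 1) - τ 13 * j 6,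
        τ 12 * j 2 - (1 + lam ^ 2 / 2) * (τ 13 * j 2) - τ 13 * j 5,
        τ 14 * j 0 - τ 15 * j 3],
      ![τ 9 * j 4,
        τ 12 * j 2 - (1 + lam ^ 2 / 2) * (τ 13 * j 2) - τ 13 * j 5,
        τ 11 * j 1 + (1 + lam ^ 2 / 2) * (τ 13 * j 1) + τ 13 * j 6,
        τ 15 * j 4],
      ![τ 10 * j 1,
        τ 14 * j 0 - τ 15 * j 3,
        τ 15 * j 4,
        τ 16 * j 1]],
    ![![τ 7 * j 2,
        τ 9 * j 4,
        τ 8 * j 0 + τ 9 * j 3,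
        τ 10 * j 2],
      ![τ 9 * j 4,
        τ 11 * j 2 - τ 13 * j 5,
        τ 12 * j 1 + τ 13 * j 6,
        τ 15 * j 4],
      ![τ 8 * j 0 + τ 9 * j 3,
        τ 12 * j 1 + τ 13 * j 6,
        τ 11 * j 2 + 2 * τ 12 * j 2 + τ 13 * j 5,
        τ 14 * j 0 + τ 15 * j 3],
      ![τ 10 * j 2,
        τ 15 * j 4,
        τ 14 * j 0 + τ 15 * j 3,
        τ 16 * j 2]],
    ![![τ 17 * j 0,
        τ 18 * j 1,
        τ 18 * j 2,
        τ 19 * j 0],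
      ![τ 18 * j 1,
        τ 20 * j 0 - τ 21 * j 3,
        τ 21 * j 4,
        τ 22 * j 1],
      ![τ 18 * j 2,
        τ 21 * j 4,
        τ 20 * j 0 + τ 21 * j 3,
        τ 22 * j 2],
      ![τ 19 * j 0,
        τ 22 * j 1,
        τ 22 * j 2,
        τ 23 * j 0]]]

theorem isBilinearMap_comp₂ (a b : Fin 4) : IsBilinearMap ℝ fun v j => comp₂ v j a b := by
  constructor <;> intros <;> fin_cases a <;> fin_cases b <;> simp [comp₂] <;> ring

set_option maxHeartbeats 2000000 in
theorem isBilinearMap_comp₃ (lam : ℝ) (c a b : Fin 4) :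
    IsBilinearMap ℝ fun τ j => comp₃ lam τ j c a b := by
  constructor <;> intros <;> fin_cases c <;> fin_cases a <;> fin_cases b <;> simp [comp₃] <;> ring

end BianchiIII

end

/-! ### The first covariant derivative on amplitudes. -/

noncomputable section

namespace BianchiIII

open scoped ContDiff Topology
open Filter

/-- The amplitudes of the covariant derivative of the 2-tensor with amplitudes `v`, whose
normalized time derivatives are `v'`. -/
def covAmp (h₁ h₂ q₁ q₂ lam m : ℝ) (v v' : Fin 7 → ℝ) : Fin 24 → ℝ :=
  ![v' 0, v' 1 - h₁ * v 1, v' 2 - h₂ * v 2, v' 3 - 2 * h₁ * v 3, v' 4 - 2 * h₁ * v 4,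
    v' 6 - (h₁ + h₂) * v 6, v' 5 - 2 * h₂ * v 5, v 0 - 2 * h₁ * v 1,
    -h₁ * q₁ * v 0 - lam ^ 2 / 2 * v 1 - h₁ * v 3, v 1 - h₁ * v 4, v 2 - h₁ * v 6, v 3,
    -h₁ * q₁ * v 1, v 4, -h₁ * q₁ * v 2 - lam ^ 2 / 2 * v 6, v 6, v 5,
    -m * v 0 - 2 * h₂ * v 2, -m * v 1 - h₂ * v 6, -h₂ * q₂ * v 0 + m * v 2 - h₂ * v 5, -m * v 3,
    -m * v 4, -h₂ * q₂ * v 1 + m * v 6, -2 * h₂ * q₂ * v 2 - m * v 5]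

/-- The normalized time derivatives of `covAmp`. -/
def covAmp' (h₁ h₂ q₁ q₂ lam m : ℝ) (v v' v'' : Fin 7 → ℝ) : Fin 24 → ℝ :=
  let k₁ := h₁ * (h₂ - h₁)
  let k₂ := -h₂ * (2 * h₁ + h₂)
  let r₁ := k₁ * q₁ + h₁ * (2 * h₁ * q₁)
  let r₂ := k₂ * q₂ + h₂ * (2 * h₂ * q₂)
  ![v'' 0, v'' 1 - (k₁ * v 1 + h₁ * v' 1), v'' 2 - (k₂ * v 2 + h₂ * v' 2),
    v'' 3 - 2 * (k₁ * v 3 + h₁ * v' 3), v'' 4 - 2 * (k₁ * v 4 + h₁ * v' 4),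
    v'' 6 - ((k₁ + k₂) * v 6 + (h₁ + h₂) * v' 6), v'' 5 - 2 * (k₂ * v 5 + h₂ * v' 5),
    v' 0 - 2 * (k₁ * v 1 + h₁ * v' 1),
    -(r₁ * v 0 + h₁ * q₁ * v' 0) - lam ^ 2 / 2 * v' 1 - (k₁ * v 3 + h₁ * v' 3),
    v' 1 - (k₁ * v 4 + h₁ * v' 4), v' 2 - (k₁ * v 6 + h₁ * v' 6), v' 3,
    -(r₁ * v 1 + h₁ * q₁ * v' 1), v' 4,
    -(r₁ * v 2 + h₁ * q₁ * v' 2) - lam ^ 2 / 2 * v' 6, v' 6, v' 5,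
    -m * v' 0 - 2 * (k₂ * v 2 + h₂ * v' 2), -m * v' 1 - (k₂ * v 6 + h₂ * v' 6),
    -(r₂ * v 0 + h₂ * q₂ * v' 0) + m * v' 2 - (k₂ * v 5 + h₂ * v' 5), -m * v' 3, -m * v' 4,
    -(r₂ * v 1 + h₂ * q₂ * v' 1) + m * v' 6, -2 * (r₂ * v 2 + h₂ * q₂ * v' 2) - m * v' 5]

theorem hasDerivAt_covAmp {B : Background} {I : Set ℝ} (hB : B.IsVacuum I) {t : ℝ} (ht : t ∈ I)
    (lam m : ℝ) {v v' : ℝ → Fin 7 → ℝ} {v'' : Fin 7 → ℝ}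
    (hv : ∀ i, HasDerivAt (fun s => v s i) (B.N t * v' t i) t)
    (hv' : ∀ i, HasDerivAt (fun s => v' s i) (B.N t * v'' i) t) (i : Fin 24) :
    HasDerivAt (fun s => covAmp (B.H₁ s) (B.H₂ s) (B.q₁ s) (B.q₂ s) lam m (v s) (v' s) i)
      (B.N t * covAmp' (B.H₁ t) (B.H₂ t) (B.q₁ t) (B.q₂ t) lam m (v t) (v' t) v'' i) t := by
  have h1 := hB.hasDerivAt_H₁ ht
  have h2 := hB.hasDerivAt_H₂ ht
  have hr1 := h1.mul (hB.hasDerivAt_q₁ ht)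
  have hr2 := h2.mul (hB.hasDerivAt_q₂ ht)
  fin_cases i
  · exact hv' 0
  · exact ((hv' 1).sub (h1.mul (hv 1))).congr_deriv (by simp [covAmp']; ring)
  · exact ((hv' 2).sub (h2.mul (hv 2))).congr_deriv (by simp [covAmp']; ring)
  · exact ((hv' 3).sub ((h1.const_mul 2).mul (hv 3))).congr_deriv (by simp [covAmp']; ring)
  · exact ((hv' 4).sub ((h1.const_mul 2).mul (hv 4))).congr_deriv (by simp [covAmp']; ring)
  · exact ((hv' 6).sub ((h1.add h2).mul (hv 6))).congr_deriv (by simp [covAmp']; ring)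
  · exact ((hv' 5).sub ((h2.const_mul 2).mul (hv 5))).congr_deriv (by simp [covAmp']; ring)
  · exact ((hv 0).sub ((h1.const_mul 2).mul (hv 1))).congr_deriv (by simp [covAmp']; ring)
  · exact ((((h1.neg.mul (hB.hasDerivAt_q₁ ht)).mul (hv 0)).sub ((hv 1).const_mul (lam ^ 2 / 2))).sub
      (h1.mul (hv 3))).congr_deriv (by simp [covAmp']; ring)
  · exact ((hv 1).sub (h1.mul (hv 4))).congr_deriv (by simp [covAmp']; ring)
  · exact ((hv 2).sub (h1.mul (hv 6))).congr_deriv (by simp [covAmp']; ring)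
  · exact hv 3
  · exact ((h1.neg.mul (hB.hasDerivAt_q₁ ht)).mul (hv 1)).congr_deriv (by simp [covAmp']; ring)
  · exact hv 4
  · exact (((h1.neg.mul (hB.hasDerivAt_q₁ ht)).mul (hv 2)).sub
      ((hv 6).const_mul (lam ^ 2 / 2))).congr_deriv (by simp [covAmp']; ring)
  · exact hv 6
  · exact hv 5
  · exact (((hv 0).const_mul (-m)).sub ((h2.const_mul 2).mul (hv 2))).congr_deriv
      (by simp [covAmp']; ring)
  · exact (((hv 1).const_mul (-m)).sub (h2.mul (hv 6))).congr_deriv (by simp [covAmp']; ring)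
  · exact ((((h2.neg.mul (hB.hasDerivAt_q₂ ht)).mul (hv 0)).add ((hv 2).const_mul m)).sub
      (h2.mul (hv 5))).congr_deriv (by simp [covAmp']; ring)
  · exact ((hv 3).const_mul (-m)).congr_deriv (by simp [covAmp']; ring)
  · exact ((hv 4).const_mul (-m)).congr_deriv (by simp [covAmp']; ring)
  · exact (((h2.neg.mul (hB.hasDerivAt_q₂ ht)).mul (hv 1)).add ((hv 6).const_mul m)).congr_deriv
      (by simp [covAmp']; ring)
  · exact ((((h2.const_mul (-2)).mul (hB.hasDerivAt_q₂ ht)).mul (hv 2)).sub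
      ((hv 5).const_mul m)).congr_deriv (by simp [covAmp']; ring)

-- The lapse rate ν cancels: differentiating the power of N produces exactly the ν-terms that the
-- connection subtracts. The fourth derivatives x, y are arbitrary, since a 2-tensor involves the
-- jet only up to the Hessian.
set_option maxHeartbeats 2000000 in
theorem comp₃_covAmp (ν h₁ h₂ q₁ q₂ lam m x y : ℝ) (v v' j : Fin 7 → ℝ) (c a b : Fin 4) :
    compD (fun v j => comp₂ v j a b) (timeWeight a + timeWeight b) (fiberWeight a + fiberWeight b)
        ν m v v' j (jetD₁ lam j x y) (jetD₂ lam j x y) c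
      - ∑ d, (rotCoeff ν h₁ h₂ q₁ q₂ c a d * comp₂ v j d b
          + rotCoeff ν h₁ h₂ q₁ q₂ c b d * comp₂ v j a d)
      = comp₃ lam (covAmp h₁ h₂ q₁ q₂ lam m v v') j c a b := by
  rw [Fin.sum_univ_four]
  fin_cases c <;> fin_cases a <;> fin_cases b <;>
    simp [compD, timeWeight, fiberWeight, fiberSign, rotCoeff, comp₂, comp₃, covAmp, jetD₁,
      jetD₂] <;> ring

end BianchiIII

end

/-! ### The second covariant derivative and the linearized Ricci tensor on amplitudes. -/

noncomputable section

namespace BianchiIII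

open scoped ContDiff Topology
open Filter

/-- The normalized second covariant derivative with indices `e, c, a, b` of a 2-tensor of a mode
whose covariant derivative has amplitudes `τ`. -/
def comp₄ (ν h₁ h₂ q₁ q₂ lam m : ℝ) (τ τ' : Fin 24 → ℝ) (j j₁ j₂ : Fin 7 → ℝ)
    (e c a b : Fin 4) : ℝ :=
  compD (fun τ j => comp₃ lam τ j c a b) (timeWeight c + timeWeight a + timeWeight b)
      (fiberWeight c + fiberWeight a + fiberWeight b) ν m τ τ' j j₁ j₂ e
    - ∑ d, (rotCoeff ν h₁ h₂ q₁ q₂ e c d * comp₃ lam τ j d a b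
      + rotCoeff ν h₁ h₂ q₁ q₂ e a d * comp₃ lam τ j c d b
      + rotCoeff ν h₁ h₂ q₁ q₂ e b d * comp₃ lam τ j c a d)

/-- The amplitudes of twice the linearized Ricci tensor of the 2-tensor of a mode with amplitudes
`v`, whose first and second normalized time derivatives are `v'` and `v''`. -/
def ricciAmp (h₁ h₂ q₁ q₂ lam m : ℝ) (v v' v'' : Fin 7 → ℝ) : Fin 7 → ℝ :=
  ![(m ^ 2 / q₂ + lam ^ 2 / q₁) * v 0 - (2 * h₁ + h₂) * v' 0 - 2 * lam ^ 2 / q₁ * v' 1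
      + 2 * m / q₂ * v' 2 + 4 * h₁ * (h₂ - h₁) / q₁ * v 3 + 4 * h₁ / q₁ * v' 3 - 2 / q₁ * v'' 3
      - 2 * h₂ * (2 * h₁ + h₂) / q₂ * v 5 + 2 * h₂ / q₂ * v' 5 - 1 / q₂ * v'' 5,
    -(h₁ + h₂) * v 0 + (2 * h₁ ^ 2 + 4 * h₁ * h₂ + m ^ 2 / q₂) * v 1 + m / q₂ * v 2
      - 2 * h₁ * m / q₂ * v 6 + m / q₂ * v' 6 + 2 * h₁ / q₁ * v 3 - 1 / q₁ * v' 3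
      + h₁ * (lam ^ 2 + 2) / q₁ * v 4 - (lam ^ 2 / 2 + 1) / q₁ * v' 4 + (h₁ + h₂) / q₂ * v 5
      - 1 / q₂ * v' 5,
    2 * h₁ * m * v 0 + lam ^ 2 * m / q₁ * v 1 + lam ^ 2 / q₁ * v 2 + 2 * h₂ * lam ^ 2 / q₁ * v 6
      - lam ^ 2 / q₁ * v' 6 - 2 * (h₁ + h₂) * m / q₁ * v 3 + 2 * m / q₁ * v' 3,
    (2 * h₁ ^ 2 * q₁ + 4 * h₁ * h₂ * q₁ - lam ^ 2 / 2) * v 0 + h₁ * q₁ * v' 0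
      + (2 * h₁ + h₂) * lam ^ 2 * v 1 + lam ^ 2 * v' 1 - 2 * h₁ * q₁ * m / q₂ * v 2
      - lam ^ 2 * m / q₂ * v 6 + (m ^ 2 / q₂ + lam ^ 2 / q₁) * v 3 + h₂ * v' 3 + v'' 3
      + lam ^ 2 * (lam ^ 2 / 2 + 1) / q₁ * v 4
      + (lam ^ 2 / 2 - 2 * h₁ * h₂ * q₁) / q₂ * v 5 + h₁ * q₁ / q₂ * v' 5,
    v 0 - 2 * h₂ * v 1 - 2 * v' 1 + 2 * m / q₂ * v 6 + (4 * h₁ ^ 2 + m ^ 2 / q₂ - 2 / q₁) * v 4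
      + (h₂ - 2 * h₁) * v' 4 + v'' 4 - 1 / q₂ * v 5,
    -m ^ 2 * v 0 + h₂ * q₂ * v' 0 + 2 * h₂ * q₂ * lam ^ 2 / q₁ * v 1 - 4 * h₁ * m * v 2
      - 2 * m * v' 2 - 2 * lam ^ 2 * m / q₁ * v 6 + (2 * m ^ 2 - 4 * h₁ * h₂ * q₂) / q₁ * v 3
      + 2 * h₂ * q₂ / q₁ * v' 3 + (2 * h₂ ^ 2 + lam ^ 2 / q₁) * v 5 + 2 * (h₁ - h₂) * v' 5 + v'' 5,
    -m * v 0 + (2 * h₁ - h₂) * m * v 1 + m * v' 1 - h₂ * v 2 - v' 2 + 4 * h₁ * h₂ * v 6 - h₂ * v' 6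
      + v'' 6 + m / q₁ * v 3 + (lam ^ 2 / 2 + 1) * m / q₁ * v 4]

-- In this combination of second covariant derivatives the third and fourth derivatives of Ŝ cancel,
-- so the linearized Ricci tensor is again a tensor of the same mode, and the field equations are
-- ordinary differential equations for amplitudes.
set_option maxHeartbeats 4000000 in
theorem comp₂_ricciAmp {q₁ q₂ : ℝ} (hq₁ : q₁ ≠ 0) (hq₂ : q₂ ≠ 0) (ν h₁ h₂ lam m x y : ℝ)
    (v v' v'' j : Fin 7 → ℝ) {τ τ' : Fin 24 → ℝ} (hτ : τ = covAmp h₁ h₂ q₁ q₂ lam m v v')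
    (hτ' : τ' = covAmp' h₁ h₂ q₁ q₂ lam m v v' v'') (a b : Fin 4) :
    ∑ c, invDiag q₁ q₂ c *
        (comp₄ ν h₁ h₂ q₁ q₂ lam m τ τ' j (jetD₁ lam j x y) (jetD₂ lam j x y) c a b c
          + comp₄ ν h₁ h₂ q₁ q₂ lam m τ τ' j (jetD₁ lam j x y) (jetD₂ lam j x y) c b a c
          - comp₄ ν h₁ h₂ q₁ q₂ lam m τ τ' j (jetD₁ lam j x y) (jetD₂ lam j x y) c c a b
          - comp₄ ν h₁ h₂ q₁ q₂ lam m τ τ' j (jetD₁ lam j x y) (jetD₂ lam j x y) a b c c)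
      = comp₂ (ricciAmp h₁ h₂ q₁ q₂ lam m v v' v'') j a b := by
  simp only [Fin.sum_univ_four, comp₄]
  fin_cases a <;> fin_cases b <;>
    (simp [compD, timeWeight, fiberWeight, fiberSign, rotCoeff, comp₃, jetD₁, jetD₂, invDiag,
      comp₂];
     subst hτ hτ';
     simp [covAmp, covAmp', ricciAmp];
     field_simp;
     ring)

end BianchiIII

end

/-! ### From amplitudes back to covariant derivatives of tensor fields. -/

noncomputable section

namespace BianchiIII

open scoped ContDiff Topology
open Filter

/-- The tensor field `h` is over `I` the 2-tensor of the mode `M` with amplitudes `v`. -/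
def HasAmplitudes (B : Background) (M : ModeFunctions) (lam : ℝ) (I : Set ℝ) (h : Tensor2)
    (v : ℝ → Fin 7 → ℝ) : Prop :=
  ∀ p ∈ domain I, ∀ a b, h a b p = B.N (p 0) ^ (timeWeight a + timeWeight b)
    * M.fiberFn (fiberWeight a + fiberWeight b) (p 3) * comp₂ (v (p 0)) (M.jetAt lam p) a b

section

variable {B : Background} {I : Set ℝ} (hB : B.IsVacuum I) (hI : IsOpen I)
  {M : ModeFunctions} {lam : ℝ} {m : ℤ} (hM : M.IsMode lam m) (hS : IsHypEigen lam M.S)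
  {h : Tensor2} {v v' v'' : ℝ → Fin 7 → ℝ} (hh : HasAmplitudes B M lam I h v)
  (hv : ∀ t ∈ I, ∀ i, HasDerivAt (fun s => v s i) (B.N t * v' t i) t)
include hB hI hM hS hh hv

/-- The derivative and the connection terms share the factor made of N and the fiber function; once
it is pulled out, `comp₃_covAmp` is the whole content. -/
theorem covD2_of_hasAmplitudes {p : Pt} (hp : p ∈ domain I) (c a b : Fin 4) :
    covD2 B.metric h c a b p = B.N (p 0) ^ (timeWeight c + timeWeight a + timeWeight b)
      * M.fiberFn (fiberWeight c + fiberWeight a + fiberWeight b) (p 3)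
      * comp₃ lam (covAmp (B.H₁ (p 0)) (B.H₂ (p 0)) (B.q₁ (p 0)) (B.q₂ (p 0)) lam m (v (p 0))
          (v' (p 0))) (M.jetAt lam p) c a b := by
  have h1 : frameD c (h a b) p = _ :=
    (frameD_congr (eventually_of_mem ((isOpen_domain hI).mem_nhds hp) fun r hr => hh r hr a b)
      c).trans ((hasFrameD_component hB hI hM hS (isBilinearMap_comp₂ a b)
        (timeWeight a + timeWeight b) (fiberWeight a + fiberWeight b) hp (hv _ hp.1)).2 c)
  have h2 : ∀ d, conn B.metric c a d p * h d b p + conn B.metric c b d p * h a d p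
      = B.N (p 0) ^ (timeWeight c + timeWeight a + timeWeight b)
        * M.fiberFn (fiberWeight c + fiberWeight a + fiberWeight b) (p 3)
        * (rotCoeff (deriv B.N (p 0) / B.N (p 0) ^ 2) (B.H₁ (p 0)) (B.H₂ (p 0)) (B.q₁ (p 0))
            (B.q₂ (p 0)) c a d * comp₂ (v (p 0)) (M.jetAt lam p) d b
          + rotCoeff (deriv B.N (p 0) / B.N (p 0) ^ 2) (B.H₁ (p 0)) (B.H₂ (p 0)) (B.q₁ (p 0))
            (B.q₂ (p 0)) c b d * comp₂ (v (p 0)) (M.jetAt lam p) a d) := by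
    intro d
    rw [hh p hp d b, hh p hp a d, conn_mul_component hB hI M hp, add_comm (timeWeight a),
      add_comm (fiberWeight a), conn_mul_component hB hI M hp, add_right_comm (timeWeight c),
      add_right_comm (fiberWeight c), mul_add]
  rw [covD2, h1]
  simp only [h2]
  rw [← Finset.mul_sum, ← comp₃_covAmp (deriv B.N (p 0) / B.N (p 0) ^ 2) _ _ _ _ _ _
    (hypD₂ (hypD₂ (hess₂₂ lam M.S)) (p 1, p 2)) (hypD₂ (hypD₂ (hess₁₂ M.S)) (p 1, p 2)),
    mul_sub, add_assoc, add_assoc]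
  rfl

variable (hv' : ∀ t ∈ I, ∀ i, HasDerivAt (fun s => v' s i) (B.N t * v'' t i) t)
include hv'

theorem covDD_of_hasAmplitudes {p : Pt} (hp : p ∈ domain I) (e c a b : Fin 4) :
    covDD B.metric h e c a b p
      = B.N (p 0) ^ (timeWeight e + timeWeight c + timeWeight a + timeWeight b)
      * M.fiberFn (fiberWeight e + fiberWeight c + fiberWeight a + fiberWeight b) (p 3)
      * comp₄ (deriv B.N (p 0) / B.N (p 0) ^ 2) (B.H₁ (p 0)) (B.H₂ (p 0)) (B.q₁ (p 0))
          (B.q₂ (p 0)) lam m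
          (covAmp (B.H₁ (p 0)) (B.H₂ (p 0)) (B.q₁ (p 0)) (B.q₂ (p 0)) lam m (v (p 0)) (v' (p 0)))
          (covAmp' (B.H₁ (p 0)) (B.H₂ (p 0)) (B.q₁ (p 0)) (B.q₂ (p 0)) lam m (v (p 0)) (v' (p 0))
            (v'' (p 0))) (M.jetAt lam p) (M.jetAt₁ lam p) (M.jetAt₂ lam p) e c a b := by
  have hT := fun {r : Pt} (hr : r ∈ domain I) c a b =>
    covD2_of_hasAmplitudes hB hI hM hS hh hv hr c a b
  have h1 : frameD e (covD2 B.metric h c a b) p = _ :=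
    (frameD_congr (eventually_of_mem ((isOpen_domain hI).mem_nhds hp) fun r hr => hT hr c a b)
      e).trans ((hasFrameD_component hB hI hM hS (isBilinearMap_comp₃ lam c a b)
        (timeWeight c + timeWeight a + timeWeight b)
        (fiberWeight c + fiberWeight a + fiberWeight b) hp
        (τ := fun t => covAmp (B.H₁ t) (B.H₂ t) (B.q₁ t) (B.q₂ t) lam m (v t) (v' t))
        (hasDerivAt_covAmp hB hp.1 lam m (hv _ hp.1) (hv' _ hp.1))).2 e)
  have h2 : ∀ d, conn B.metric e c d p * covD2 B.metric h d a b p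
        + conn B.metric e a d p * covD2 B.metric h c d b p
        + conn B.metric e b d p * covD2 B.metric h c a d p
      = B.N (p 0) ^ (timeWeight e + (timeWeight c + timeWeight a + timeWeight b))
        * M.fiberFn (fiberWeight e + (fiberWeight c + fiberWeight a + fiberWeight b)) (p 3)
        * (rotCoeff (deriv B.N (p 0) / B.N (p 0) ^ 2) (B.H₁ (p 0)) (B.H₂ (p 0)) (B.q₁ (p 0))
            (B.q₂ (p 0)) e c d * comp₃ lam (covAmp (B.H₁ (p 0)) (B.H₂ (p 0)) (B.q₁ (p 0))
              (B.q₂ (p 0)) lam m (v (p 0)) (v' (p 0))) (M.jetAt lam p) d a b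
          + rotCoeff (deriv B.N (p 0) / B.N (p 0) ^ 2) (B.H₁ (p 0)) (B.H₂ (p 0)) (B.q₁ (p 0))
            (B.q₂ (p 0)) e a d * comp₃ lam (covAmp (B.H₁ (p 0)) (B.H₂ (p 0)) (B.q₁ (p 0))
              (B.q₂ (p 0)) lam m (v (p 0)) (v' (p 0))) (M.jetAt lam p) c d b
          + rotCoeff (deriv B.N (p 0) / B.N (p 0) ^ 2) (B.H₁ (p 0)) (B.H₂ (p 0)) (B.q₁ (p 0))
            (B.q₂ (p 0)) e b d * comp₃ lam (covAmp (B.H₁ (p 0)) (B.H₂ (p 0)) (B.q₁ (p 0))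
              (B.q₂ (p 0)) lam m (v (p 0)) (v' (p 0))) (M.jetAt lam p) c a d) := by
    intro d
    rw [hT hp d a b, hT hp c d b, hT hp c a d,
      show timeWeight d + timeWeight a + timeWeight b
        = timeWeight d + (timeWeight a + timeWeight b) by ring,
      show fiberWeight d + fiberWeight a + fiberWeight b
        = fiberWeight d + (fiberWeight a + fiberWeight b) by ring,
      show timeWeight c + timeWeight d + timeWeight b
        = timeWeight d + (timeWeight c + timeWeight b) by ring,
      show fiberWeight c + fiberWeight d + fiberWeight b
        = fiberWeight d + (fiberWeight c + fiberWeight b) by ring,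
      show timeWeight c + timeWeight a + timeWeight d
        = timeWeight d + (timeWeight c + timeWeight a) by ring,
      show fiberWeight c + fiberWeight a + fiberWeight d
        = fiberWeight d + (fiberWeight c + fiberWeight a) by ring,
      conn_mul_component hB hI M hp, conn_mul_component hB hI M hp, conn_mul_component hB hI M hp,
      show timeWeight e + timeWeight a + (timeWeight c + timeWeight b)
        = timeWeight e + (timeWeight c + timeWeight a + timeWeight b) by ring,
      show fiberWeight e + fiberWeight a + (fiberWeight c + fiberWeight b)
        = fiberWeight e + (fiberWeight c + fiberWeight a + fiberWeight b) by ring,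
      show timeWeight e + timeWeight b + (timeWeight c + timeWeight a)
        = timeWeight e + (timeWeight c + timeWeight a + timeWeight b) by ring,
      show fiberWeight e + fiberWeight b + (fiberWeight c + fiberWeight a)
        = fiberWeight e + (fiberWeight c + fiberWeight a + fiberWeight b) by ring,
      show timeWeight e + timeWeight c + (timeWeight a + timeWeight b)
        = timeWeight e + (timeWeight c + timeWeight a + timeWeight b) by ring,
      show fiberWeight e + fiberWeight c + (fiberWeight a + fiberWeight b)
        = fiberWeight e + (fiberWeight c + fiberWeight a + fiberWeight b) by ring]
    ring
  rw [covDD, covD3, h1]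
  simp only [h2]
  rw [← Finset.mul_sum, comp₄, ← mul_sub,
    show timeWeight e + timeWeight c + timeWeight a + timeWeight b
        = timeWeight e + (timeWeight c + timeWeight a + timeWeight b) by ring,
    show fiberWeight e + fiberWeight c + fiberWeight a + fiberWeight b
        = fiberWeight e + (fiberWeight c + fiberWeight a + fiberWeight b) by ring]

/-- The contracted index occurs twice: its powers of N cancel against the inverse metric, and it
does not change the parity that selects the fiber function. -/
theorem linRicci_of_hasAmplitudes {p : Pt} (hp : p ∈ domain I) (a b : Fin 4) :
    linRicci B.metric h a b p = (1 / 2) * (B.N (p 0) ^ (timeWeight a + timeWeight b)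
      * M.fiberFn (fiberWeight a + fiberWeight b) (p 3)
      * comp₂ (ricciAmp (B.H₁ (p 0)) (B.H₂ (p 0)) (B.q₁ (p 0)) (B.q₂ (p 0)) lam m (v (p 0))
          (v' (p 0)) (v'' (p 0))) (M.jetAt lam p) a b) := by
  have h1 := (hB.q₁_pos _ hp.1).ne'
  have h2 := (hB.q₂_pos _ hp.1).ne'
  have h3 := (hB.N_pos _ hp.1).ne'
  have hfib : ∀ k d, M.fiberFn (2 * fiberWeight d + k) = M.fiberFn k := fun k d => by
    simp [ModeFunctions.fiberFn, Nat.even_add]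
  rw [linRicci, ← comp₂_ricciAmp h1 h2 (deriv B.N (p 0) / B.N (p 0) ^ 2) (B.H₁ (p 0))
    (B.H₂ (p 0)) lam m (hypD₂ (hypD₂ (hess₂₂ lam M.S)) (p 1, p 2))
    (hypD₂ (hypD₂ (hess₁₂ M.S)) (p 1, p 2)) (v (p 0)) (v' (p 0)) (v'' (p 0)) (M.jetAt lam p) rfl rfl]
  congr 1
  rw [Finset.mul_sum]
  refine Finset.sum_congr rfl fun c _ => ?_
  simp only [hB.invMetric_eq hp, ite_mul, zero_mul, Finset.sum_ite_eq, Finset.mem_univ, if_true]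
  simp only [covDD_of_hasAmplitudes hB hI hM hS hh hv hv' hp]
  rw [show timeWeight c + timeWeight a + timeWeight b + timeWeight c
      = 2 * timeWeight c + (timeWeight a + timeWeight b) by ring,
    show timeWeight c + timeWeight b + timeWeight a + timeWeight c
      = 2 * timeWeight c + (timeWeight a + timeWeight b) by ring,
    show timeWeight c + timeWeight c + timeWeight a + timeWeight b
      = 2 * timeWeight c + (timeWeight a + timeWeight b) by ring,
    show timeWeight a + timeWeight b + timeWeight c + timeWeight c
      = 2 * timeWeight c + (timeWeight a + timeWeight b) by ring,
    show fiberWeight c + fiberWeight a + fiberWeight b + fiberWeight c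
      = 2 * fiberWeight c + (fiberWeight a + fiberWeight b) by ring,
    show fiberWeight c + fiberWeight b + fiberWeight a + fiberWeight c
      = 2 * fiberWeight c + (fiberWeight a + fiberWeight b) by ring,
    show fiberWeight c + fiberWeight c + fiberWeight a + fiberWeight b
      = 2 * fiberWeight c + (fiberWeight a + fiberWeight b) by ring,
    show fiberWeight a + fiberWeight b + fiberWeight c + fiberWeight c
      = 2 * fiberWeight c + (fiberWeight a + fiberWeight b) by ring, hfib, pow_add]
  change _ = _ * (_ * (comp₄ _ _ _ _ _ _ _ _ _ _ (M.jetAt₁ lam p) (M.jetAt₂ lam p) _ _ _ _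
    + comp₄ _ _ _ _ _ _ _ _ _ _ (M.jetAt₁ lam p) (M.jetAt₂ lam p) _ _ _ _
    - comp₄ _ _ _ _ _ _ _ _ _ _ (M.jetAt₁ lam p) (M.jetAt₂ lam p) _ _ _ _
    - comp₄ _ _ _ _ _ _ _ _ _ _ (M.jetAt₁ lam p) (M.jetAt₂ lam p) _ _ _ _))
  field_simp

end

end BianchiIII

end

noncomputable section

namespace BianchiIII

open scoped ContDiff Topology
open Filter

/-! ### The mode tensors in terms of jets -/

/-- With zero rates only the rotation of the hyperbolic frame is left; q₁ and q₂ enter `rotCoeff`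
multiplied by rates, so their value 0 is harmless. -/
theorem conn_stdMetric (a b d : Fin 4) (p : Pt) :
    conn stdMetric a b d p = rotCoeff 0 0 0 0 0 a b d := by
  have h1 : ∀ a b, invMetric stdMetric a b p = if a = b then 1 else 0 := by
    intro a b
    have : (Matrix.of fun i j => stdMetric i j p) = 1 := by
      ext i j
      simp [stdMetric, Matrix.one_apply]
    rw [invMetric, this, inv_one, Matrix.one_apply]
  have h2 : ∀ a b c, frameD a (stdMetric b c) p = 0 := fun a b c =>
    (HasFrameD.const (if b = c then 1 else 0) p).2 a
  have h3 : conn stdMetric a b d p = connLow stdMetric a b d p := by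
    simp [conn, h1]
  rw [h3]
  simp only [connLow, h2, Fin.sum_univ_four]
  fin_cases a <;> fin_cases b <;> fin_cases d <;> simp [stdMetric, frameC, rotCoeff] <;> norm_num

namespace ModeFunctions

variable {M : ModeFunctions} (hS : ContDiffOn ℝ ∞ M.S halfPlane)
include hS

theorem frameD_hatS {p : Pt} (hp : 0 < p 2) (a : Fin 4) :
    frameD a M.hatS p = ![0, hypD₁ M.S (p 1, p 2), hypD₂ M.S (p 1, p 2), 0] a :=
  (hasFrameD_base (differentiableAt_of_halfPlane hS (w := (p 1, p 2)) hp)).2 a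

theorem hessS_eq {p : Pt} (hp : 0 < p 2) (a b : Fin 4) :
    M.hessS a b p =
      (![![0, 0, 0, 0],
        ![0, hypD₁ (hypD₁ M.S) (p 1, p 2) - hypD₂ M.S (p 1, p 2), hess₁₂ M.S (p 1, p 2), 0],
        ![0, hess₁₂ M.S (p 1, p 2), hypD₂ (hypD₂ M.S) (p 1, p 2), 0],
        ![0, 0, 0, 0]] : Fin 4 → Fin 4 → ℝ) a b := by
  have hw : (p 1, p 2) ∈ halfPlane := hp
  have hcomm := hypD₁_hypD₂ hS hw
  have hnhds : {r : Pt | 0 < r 2} ∈ 𝓝 p :=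
    (isOpen_lt continuous_const (continuous_apply 2)).mem_nhds hp
  have h0 := fun b => frameD_congr (p := p)
    (eventually_of_mem hnhds fun r hr => frameD_hatS hS (M := M) hr b) a
  have h1 := (hasFrameD_base (differentiableAt_of_halfPlane (contDiffOn_hypD₁ hS) hw)).2 a
  have h2 := (hasFrameD_base (differentiableAt_of_halfPlane (contDiffOn_hypD₂ hS) hw)).2 a
  have h3 := (HasFrameD.const 0 p).2 a
  have hb : frameD a (frameD b M.hatS) p =
      (![0, frameD a (fun r => hypD₁ M.S (r 1, r 2)) p,
        frameD a (fun r => hypD₂ M.S (r 1, r 2)) p, 0] : Fin 4 → ℝ) b := by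
    refine (h0 b).trans ?_
    fin_cases b
    · exact h3
    · rfl
    · rfl
    · exact h3
  rw [hessS, covD1, hb, h1, h2]
  simp only [conn_stdMetric, frameD_hatS hS hp, Fin.sum_univ_four]
  fin_cases a <;> fin_cases b <;> simp [rotCoeff, hess₁₂, hcomm]

end ModeFunctions

theorem ModeFunctions.IsMode.isHypEigen {M : ModeFunctions} {lam : ℝ} {m : ℤ}
    (hM : M.IsMode lam m) : IsHypEigen lam M.S := by
  refine ⟨hM.smooth, fun w hw => ?_⟩
  have h := hM.eigen ![0, w.1, w.2, 0] hw
  rw [Fin.sum_univ_four] at h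
  simp only [ModeFunctions.hessS_eq (M := M) hM.smooth (p := ![0, w.1, w.2, 0]) hw,
    ModeFunctions.hatS] at h
  simp at h
  linarith

/-- The normalized amplitudes of an even perturbation. -/
def EvenVariables.amp (v : EvenVariables) (B : Background) (lam t : ℝ) : Fin 7 → ℝ :=
  ![-2 * v.s₀ t / B.N t, v.s₁ t / (lam * B.N t), v.s₃ t / B.N t, v.γ₁ t,
    1 / lam * √(2 / (lam ^ 2 + 2)) * v.γ₂ t, v.γ₃ t, v.γ₄ t / lam]

theorem EvenVariables.hasAmplitudes_perturbation (v : EvenVariables) {B : Background} {I : Set ℝ}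
    (hB : B.IsVacuum I) {M : ModeFunctions} {lam : ℝ} (hlam : 0 < lam)
    (hS : IsHypEigen lam M.S) :
    HasAmplitudes B M lam I (v.perturbation B M lam) (v.amp B lam) := by
  intro p hp a b
  have hN := (hB.N_pos _ hp.1).ne'
  have hl := hlam.ne'
  have hf := ModeFunctions.frameD_hatS hS.smooth hp.2
  have hH := ModeFunctions.hessS_eq hS.smooth hp.2
  have h11 := hS.hypD₁_hypD₁ (show (p 1, p 2) ∈ halfPlane from hp.2)
  have h22 : hypD₂ (hypD₂ M.S) (p 1, p 2) = hess₂₂ lam M.S (p 1, p 2)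
    - lam ^ 2 / 2 * M.S (p 1, p 2) := by simp [hess₂₂]
  simp only [perturbation, ModeFunctions.E₁, ModeFunctions.E₂, ModeFunctions.E₃,
    ModeFunctions.E₄, symProd, ModeFunctions.modeSvec, ModeFunctions.modeSbarVec,
    ModeFunctions.modeSbarSigma, ModeFunctions.hatSvec, ModeFunctions.hatSten, hf, hH, h11, h22,
    ModeFunctions.modeS, ModeFunctions.modeSbar, ModeFunctions.hatS]
  fin_cases a <;> fin_cases b <;>
    simp [dt, sigma3, hypMetric, timeWeight, fiberWeight, ModeFunctions.fiberFn, comp₂, amp,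
      ModeFunctions.jetAt, jet, ← sub_eq_add_neg] <;>
    field_simp <;> ring

end BianchiIII

end

noncomputable section

namespace BianchiIII

open scoped ContDiff Topology
open Filter

/-! ### Gauge transformations and gauge-invariant amplitudes -/

/-- The amplitudes of the sum of the perturbation with lapse and shift amplitudes `A, F, S` and
fiber amplitude `Z` and of the gauge perturbation of the vector field with amplitudes
`α, β, ζ`. -/
def gaugeAmp (h₁ h₂ q₁ q₂ lam m A F S Z α β ζ α' β' ζ' : ℝ) : Fin 7 → ℝ :=
  ![A - 2 * α', F + q₁ * β' - α, S + q₂ * ζ' + m * α, q₁ * (2 * h₁ * α - lam ^ 2 * β),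
    2 * (q₁ * β), q₂ * (Z + 2 * h₂ * α + 2 * m * ζ), q₂ * ζ - m * (q₁ * β)]

/-- The amplitudes of twice the linearized Ricci tensor in terms of the gauge-invariant amplitudes
of the perturbation. -/
def einsteinAmp (h₁ h₂ q₁ q₂ lam m A A' F F' S S' Z Z' Z'' : ℝ) : Fin 7 → ℝ :=
  ![(m ^ 2 / q₂ + lam ^ 2 / q₁) * A - (2 * h₁ + h₂) * A' - 2 * lam ^ 2 / q₁ * F' + 2 * m / q₂ * S'
      - 2 * h₂ * Z' - Z'',
    -(h₁ + h₂) * A + (2 / q₁ + m ^ 2 / q₂) * F + m / q₂ * S + (h₁ - h₂) * Z - Z',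
    2 * h₁ * m * A + lam ^ 2 * m / q₁ * F + lam ^ 2 / q₁ * S,
    (2 - lam ^ 2 / 2) * A + h₁ * q₁ * A' + (2 * h₁ + h₂) * lam ^ 2 * F + lam ^ 2 * F'
      - 2 * h₁ * q₁ * m / q₂ * S + lam ^ 2 / 2 * Z + h₁ * q₁ * Z',
    A - 2 * h₂ * F - 2 * F' - Z,
    -m ^ 2 * A + h₂ * q₂ * A' + 2 * h₂ * q₂ * lam ^ 2 / q₁ * F - 4 * h₁ * m * S - 2 * m * S'
      + q₂ * lam ^ 2 / q₁ * Z + 2 * (h₁ + h₂) * q₂ * Z' + q₂ * Z'',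
    -m * A + (2 * h₁ - h₂) * m * F + m * F' - h₂ * S - S']

/-- Gauge invariance: the linearized Ricci tensor of a Lie derivative of the metric is the Lie
derivative of the Ricci tensor, which vanishes on a vacuum background. The hypotheses on v' and v''
are the derivatives of `gaugeAmp` along the background, written out so that the statement is pure
algebra. -/
theorem ricciAmp_gaugeAmp {h₁ h₂ q₁ q₂ : ℝ} (hq₂ : q₂ ≠ 0) (hfr : q₁ * (h₁ * (h₁ + 2 * h₂)) = 1)
    (lam m A A' F F' S S' Z Z' Z'' α α' α'' β β' β'' ζ ζ' ζ'' : ℝ) {v v' v'' : Fin 7 → ℝ}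
    (hv : v = gaugeAmp h₁ h₂ q₁ q₂ lam m A F S Z α β ζ α' β' ζ')
    (h0 : v' 0 = A' - 2 * α'') (h1 : v' 1 = F' + q₁ * (β'' + 2 * h₁ * β') - α')
    (h2 : v' 2 = S' + q₂ * (ζ'' + 2 * h₂ * ζ') + m * α')
    (h3 : v' 3 = q₁ * (2 * h₁ * (h₂ - h₁) * α + 2 * h₁ * α' - lam ^ 2 * β'
      + 2 * h₁ * (2 * h₁ * α - lam ^ 2 * β)))
    (h4 : v' 4 = 2 * q₁ * (β' + 2 * h₁ * β))
    (h5 : v' 5 = q₂ * (Z' - 2 * h₂ * (2 * h₁ + h₂) * α + 2 * h₂ * α' + 2 * m * ζ'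
      + 2 * h₂ * (Z + 2 * h₂ * α + 2 * m * ζ)))
    (h6 : v' 6 = q₂ * (ζ' + 2 * h₂ * ζ) - m * q₁ * (β' + 2 * h₁ * β))
    (h3' : v'' 3 = q₁ * (2 * (h₁ * (h₂ - h₁) ^ 2
        + h₁ * (-h₂ * (2 * h₁ + h₂) - h₁ * (h₂ - h₁))) * α + 4 * h₁ * (h₂ - h₁) * α'
        + 2 * h₁ * α'' - lam ^ 2 * β''
      + 4 * h₁ * (2 * h₁ * (h₂ - h₁) * α + 2 * h₁ * α' - lam ^ 2 * β')
      + (2 * h₁ * (h₂ - h₁) + 4 * h₁ ^ 2) * (2 * h₁ * α - lam ^ 2 * β)))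
    (h4' : v'' 4 = 2 * q₁ * (β'' + 4 * h₁ * β' + (2 * h₁ * (h₂ - h₁) + 4 * h₁ ^ 2) * β))
    (h5' : v'' 5 = q₂ * (Z'' + 2 * (h₂ * (2 * h₁ + h₂) ^ 2
        - h₂ * (2 * h₁ * (h₂ - h₁) - h₂ * (2 * h₁ + h₂))) * α - 4 * h₂ * (2 * h₁ + h₂) * α'
        + 2 * h₂ * α'' + 2 * m * ζ''
      + 4 * h₂ * (Z' - 2 * h₂ * (2 * h₁ + h₂) * α + 2 * h₂ * α' + 2 * m * ζ')
      + (-2 * h₂ * (2 * h₁ + h₂) + 4 * h₂ ^ 2) * (Z + 2 * h₂ * α + 2 * m * ζ)))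
    (h6' : v'' 6 = q₂ * (ζ'' + 4 * h₂ * ζ' + (-2 * h₂ * (2 * h₁ + h₂) + 4 * h₂ ^ 2) * ζ)
      - m * q₁ * (β'' + 4 * h₁ * β' + (2 * h₁ * (h₂ - h₁) + 4 * h₁ ^ 2) * β)) :
    ricciAmp h₁ h₂ q₁ q₂ lam m v v' v''
      = einsteinAmp h₁ h₂ q₁ q₂ lam m A A' F F' S S' Z Z' Z'' := by
  -- With w = h₁ + 2h₂ the constraint is solved by q₁ = 1/(h₁w), and all denominators become
  -- monomials.
  obtain ⟨w, rfl⟩ : ∃ w, h₂ = (w - h₁) / 2 := ⟨h₁ + 2 * h₂, by ring⟩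
  replace hfr : q₁ * (h₁ * w) = 1 := by rw [← hfr]; ring
  have hc : h₁ * w ≠ 0 := right_ne_zero_of_mul (hfr ▸ one_ne_zero)
  have hh₁ := left_ne_zero_of_mul hc
  have hw := right_ne_zero_of_mul hc
  obtain rfl : q₁ = 1 / (h₁ * w) := by field_simp; linarith
  ext k
  fin_cases k <;>
    (simp [ricciAmp, einsteinAmp, h0, h1, h2, h3, h4, h5, h6, h3', h4', h5', h6', hv, gaugeAmp];
     field_simp;
     ring)

/-- The constraints determine the lapse and shift amplitudes in the absence of gauge-invariant
perturbations. -/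
theorem eq_zero_of_constraints {h₁ h₂ q₁ q₂ lam m A A' F F' S S' : ℝ} (hq₁ : 0 < q₁) (hq₂ : 0 < q₂)
    (hlam : 0 < lam)
    (h : einsteinAmp h₁ h₂ q₁ q₂ lam m A A' F F' S S' 0 0 0 = 0) : A = 0 ∧ F = 0 ∧ S = 0 := by
  have e0 := congrFun h 0
  have e1 := congrFun h 1
  have e2 := congrFun h 2
  have e3 := congrFun h 3
  have e5 := congrFun h 5
  simp [einsteinAmp] at e0 e1 e2 e3 e5
  -- The time-time component of the linearized Einstein tensor: the combination R₀₀ + 2R₃/q₁ + R₅/q₂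
  -- contains no derivatives of A, F, S.
  have ham : A + lam ^ 2 * (h₁ + h₂) * F - 2 * h₁ * m * q₁ / q₂ * S = 0 := by
    have : A + lam ^ 2 * (h₁ + h₂) * F - 2 * h₁ * m * q₁ / q₂ * S
        = (q₁ * ((m ^ 2 / q₂ + lam ^ 2 / q₁) * A - (2 * h₁ + h₂) * A' - 2 * lam ^ 2 / q₁ * F'
            + 2 * m / q₂ * S')
          + 2 * ((2 - lam ^ 2 / 2) * A + h₁ * q₁ * A' + (2 * h₁ + h₂) * lam ^ 2 * F + lam ^ 2 * F'
            - 2 * h₁ * q₁ * m / q₂ * S)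
          + q₁ / q₂ * (-(m ^ 2 * A) + h₂ * q₂ * A' + 2 * h₂ * q₂ * lam ^ 2 / q₁ * F
            - 4 * h₁ * m * S - 2 * m * S')) / 4 := by
      field_simp
      ring
    rw [this, e0, e3, e5]
    simp
  -- The two momentum constraints: the time-fiber one gives S, then the time-base one gives F in
  -- terms of A.
  have hs : S = -(2 * h₁ * m * q₁ / lam ^ 2) * A - m * F := by
    field_simp at e2 ⊢
    linarith
  have hF : F = q₁ / 2 * (h₁ + h₂ + 2 * h₁ * m ^ 2 * q₁ / (lam ^ 2 * q₂)) * A := by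
    rw [hs] at e1
    field_simp at e1 ⊢
    linarith
  -- After elimination the Hamiltonian constraint is A times 1 plus nonnegative terms, so A = 0.
  have hA : A * (1 + lam ^ 2 * q₁ / 2 * (h₁ + h₂ + 2 * h₁ * m ^ 2 * q₁ / (lam ^ 2 * q₂)) ^ 2
      + 4 * h₁ ^ 2 * m ^ 2 * q₁ ^ 2 / (lam ^ 2 * q₂)) = 0 := by
    rw [hs, hF] at ham
    rw [← ham]
    field_simp
    ring
  have hA0 : A = 0 := (mul_eq_zero.1 hA).resolve_right (by positivity)
  subst hA0
  have hF0 : F = 0 := by simpa using hF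
  subst hF0
  exact ⟨rfl, rfl, by simpa using hs⟩

end BianchiIII

end

/-! ### Proper time derivatives and gauge invariance along the background. -/

noncomputable section

namespace BianchiIII

open scoped ContDiff Topology
open Filter

/-- On `I` the function `f` has the derivative `f'` with respect to proper time. -/
def HasProperDeriv (B : Background) (I : Set ℝ) (f f' : ℝ → ℝ) : Prop :=
  ∀ t ∈ I, HasDerivAt f (B.N t * f' t) t

/-- The derivative with respect to proper time. -/
def properDeriv (B : Background) (f : ℝ → ℝ) (t : ℝ) : ℝ := deriv f t / B.N t

section

variable {B : Background} {I : Set ℝ} (hB : B.IsVacuum I)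

theorem HasProperDeriv.congr {f f' g' : ℝ → ℝ} (hf : HasProperDeriv B I f f')
    (h : ∀ t ∈ I, f' t = g' t) : HasProperDeriv B I f g' :=
  fun t ht => h t ht ▸ hf t ht

theorem HasProperDeriv.add {f f' g g' : ℝ → ℝ} (hf : HasProperDeriv B I f f')
    (hg : HasProperDeriv B I g g') :
    HasProperDeriv B I (fun t => f t + g t) (fun t => f' t + g' t) :=
  fun t ht => ((hf t ht).add (hg t ht)).congr_deriv (by ring)

theorem HasProperDeriv.sub {f f' g g' : ℝ → ℝ} (hf : HasProperDeriv B I f f')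
    (hg : HasProperDeriv B I g g') :
    HasProperDeriv B I (fun t => f t - g t) (fun t => f' t - g' t) :=
  fun t ht => ((hf t ht).sub (hg t ht)).congr_deriv (by ring)

theorem HasProperDeriv.mul {f f' g g' : ℝ → ℝ} (hf : HasProperDeriv B I f f')
    (hg : HasProperDeriv B I g g') :
    HasProperDeriv B I (fun t => f t * g t) (fun t => f' t * g t + f t * g' t) :=
  fun t ht => ((hf t ht).mul (hg t ht)).congr_deriv (by ring)

theorem HasProperDeriv.const_mul {f f' : ℝ → ℝ} (c : ℝ) (hf : HasProperDeriv B I f f') :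
    HasProperDeriv B I (fun t => c * f t) (fun t => c * f' t) :=
  fun t ht => ((hf t ht).const_mul c).congr_deriv (by ring)

theorem HasProperDeriv.div {f f' g g' : ℝ → ℝ} (hf : HasProperDeriv B I f f')
    (hg : HasProperDeriv B I g g') (h0 : ∀ t ∈ I, g t ≠ 0) :
    HasProperDeriv B I (fun t => f t / g t) (fun t => (f' t * g t - f t * g' t) / g t ^ 2) :=
  fun t ht => ((hf t ht).div (hg t ht) (h0 t ht)).congr_deriv (by ring)

theorem hasProperDeriv_const (c : ℝ) : HasProperDeriv B I (fun _ => c) (fun _ => 0) :=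
  fun t _ => by simpa using hasDerivAt_const t c

-- An identity valid on the open set I may be differentiated; this is how all derivatives of
-- amplitudes are obtained below.
include hB in
theorem HasProperDeriv.unique (hI : IsOpen I) {f f' g g' : ℝ → ℝ} (hf : HasProperDeriv B I f f')
    (hg : HasProperDeriv B I g g') (h : ∀ t ∈ I, f t = g t) {t : ℝ} (ht : t ∈ I) :
    f' t = g' t := by
  have h1 : HasDerivAt f (B.N t * g' t) t :=
    (hg t ht).congr_of_eventuallyEq (eventually_of_mem (hI.mem_nhds ht) h)
  exact mul_left_cancel₀ (hB.N_pos t ht).ne' ((hf t ht).unique h1)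

include hB in
theorem hasProperDeriv_properDeriv {f : ℝ → ℝ} (hf : ∀ t ∈ I, DifferentiableAt ℝ f t) :
    HasProperDeriv B I f (properDeriv B f) := fun t ht => by
  rw [properDeriv, mul_div_cancel₀ _ (hB.N_pos t ht).ne']
  exact (hf t ht).hasDerivAt

include hB in
theorem contDiffOn_properDeriv (hI : IsOpen I) {f : ℝ → ℝ} {k n : ℕ∞} (hf : ContDiffOn ℝ n f I)
    (hkn : k + 1 ≤ n) : ContDiffOn ℝ k (properDeriv B f) I :=
  (hf.deriv_of_isOpen hI (by exact_mod_cast hkn)).div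
    (hB.smooth_N.of_le (by exact_mod_cast le_top)) fun t ht => (hB.N_pos t ht).ne'

theorem differentiableAt_of_contDiffOn (hI : IsOpen I) {f : ℝ → ℝ} {n : WithTop ℕ∞}
    (hf : ContDiffOn ℝ n f I) (hn : n ≠ 0) : ∀ t ∈ I, DifferentiableAt ℝ f t :=
  fun _ ht => (hf.contDiffAt (hI.mem_nhds ht)).differentiableAt hn

-- The hypotheses of `ricciAmp_gaugeAmp` come from differentiating the decomposition: once for the
-- lapse and shift amplitudes, twice for the others. Since `ricciAmp` contains no second derivative
-- of lapse or shift, no third derivative of the gauge vector appears.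
include hB in
theorem ricciAmp_eq_einsteinAmp (hI : IsOpen I) (lam m : ℝ) {v v' v'' : ℝ → Fin 7 → ℝ}
    {A A' F F' S S' Z Z' Z'' α α' α'' β β' β'' ζ ζ' ζ'' : ℝ → ℝ}
    (hv : ∀ i, HasProperDeriv B I (fun t => v t i) (fun t => v' t i))
    (hv' : ∀ i, HasProperDeriv B I (fun t => v' t i) (fun t => v'' t i))
    (hA : HasProperDeriv B I A A') (hF : HasProperDeriv B I F F') (hS : HasProperDeriv B I S S')
    (hZ : HasProperDeriv B I Z Z') (hZ' : HasProperDeriv B I Z' Z'')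
    (hα : HasProperDeriv B I α α') (hα' : HasProperDeriv B I α' α'')
    (hβ : HasProperDeriv B I β β') (hβ' : HasProperDeriv B I β' β'')
    (hζ : HasProperDeriv B I ζ ζ') (hζ' : HasProperDeriv B I ζ' ζ'')
    (h : ∀ t ∈ I, v t = gaugeAmp (B.H₁ t) (B.H₂ t) (B.q₁ t) (B.q₂ t) lam m (A t) (F t) (S t)
      (Z t) (α t) (β t) (ζ t) (α' t) (β' t) (ζ' t)) {t : ℝ} (ht : t ∈ I) :
    ricciAmp (B.H₁ t) (B.H₂ t) (B.q₁ t) (B.q₂ t) lam m (v t) (v' t) (v'' t)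
      = einsteinAmp (B.H₁ t) (B.H₂ t) (B.q₁ t) (B.q₂ t) lam m (A t) (A' t) (F t) (F' t) (S t)
        (S' t) (Z t) (Z' t) (Z'' t) := by
  have hq₁ : HasProperDeriv B I B.q₁ fun t => 2 * B.H₁ t * B.q₁ t := fun t => hB.hasDerivAt_q₁
  have hq₂ : HasProperDeriv B I B.q₂ fun t => 2 * B.H₂ t * B.q₂ t := fun t => hB.hasDerivAt_q₂
  have hH₁ : HasProperDeriv B I B.H₁ fun t => B.H₁ t * (B.H₂ t - B.H₁ t) :=
    fun t => hB.hasDerivAt_H₁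
  have hH₂ : HasProperDeriv B I B.H₂ fun t => -B.H₂ t * (2 * B.H₁ t + B.H₂ t) :=
    fun t => hB.hasDerivAt_H₂
  have h' : ∀ t ∈ I, ∀ i, v t i = _ := fun t ht i => congrFun (h t ht) i
  have d3 := hq₁.mul (((hH₁.const_mul 2).mul hα).sub (hβ.const_mul (lam ^ 2)))
  have d4 := (hq₁.mul hβ).const_mul 2
  have d5 := hq₂.mul ((hZ.add ((hH₂.const_mul 2).mul hα)).add (hζ.const_mul (2 * m)))
  have d6 := (hq₂.mul hζ).sub ((hq₁.mul hβ).const_mul m)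
  have e3 := fun t ht => HasProperDeriv.unique hB hI (t := t) (hv 3) d3 (fun t ht => h' t ht 3) ht
  have e4 := fun t ht => HasProperDeriv.unique hB hI (t := t) (hv 4) d4 (fun t ht => h' t ht 4) ht
  have e5 := fun t ht => HasProperDeriv.unique hB hI (t := t) (hv 5) d5 (fun t ht => h' t ht 5) ht
  have e6 := fun t ht => HasProperDeriv.unique hB hI (t := t) (hv 6) d6 (fun t ht => h' t ht 6) ht
  have hH₁' := hH₁.mul (hH₂.sub hH₁)
  have hH₂' := (hH₂.const_mul (-1)).mul ((hH₁.const_mul 2).add hH₂)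
  refine ricciAmp_gaugeAmp (hB.q₂_pos t ht).ne' (hB.friedmann ht) lam m _ _ _ _ _ _ _ _ _
    (α t) (α' t) (α'' t) (β t) (β' t) (β'' t) (ζ t) (ζ' t) (ζ'' t) (h t ht) ?_ ?_ ?_ ?_ ?_ ?_ ?_
    ?_ ?_ ?_ ?_
  · exact HasProperDeriv.unique hB hI (hv 0) (hA.sub (hα'.const_mul 2)) (fun t ht => h' t ht 0) ht
  · refine (HasProperDeriv.unique hB hI (hv 1) ((hF.add (hq₁.mul hβ')).sub hα)
      (fun t ht => h' t ht 1) ht).trans ?_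
    ring
  · refine (HasProperDeriv.unique hB hI (hv 2) ((hS.add (hq₂.mul hζ')).add (hα.const_mul m))
      (fun t ht => h' t ht 2) ht).trans ?_
    ring
  · rw [e3 t ht]; ring
  · rw [e4 t ht]; ring
  · rw [e5 t ht]; ring
  · rw [e6 t ht]; ring
  · refine (HasProperDeriv.unique hB hI (hv' 3)
      ((((hH₁.const_mul 2).mul hq₁).mul (((hH₁.const_mul 2).mul hα).sub (hβ.const_mul (lam ^ 2)))).add
        (hq₁.mul (((hH₁'.const_mul 2).mul hα).add (((hH₁.const_mul 2).mul hα').sub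
          (hβ'.const_mul (lam ^ 2))))))
      (fun t ht => (e3 t ht).trans (by ring)) ht).trans ?_
    ring
  · refine (HasProperDeriv.unique hB hI (hv' 4)
      ((((hH₁.const_mul 2).mul (hq₁.mul hβ)).add (hq₁.mul hβ')).const_mul 2)
      (fun t ht => (e4 t ht).trans (by ring)) ht).trans ?_
    ring
  · refine (HasProperDeriv.unique hB hI (hv' 5)
      ((((hH₂.const_mul 2).mul hq₂).mul ((hZ.add ((hH₂.const_mul 2).mul hα)).add
        (hζ.const_mul (2 * m)))).add
        (hq₂.mul ((hZ'.add (((hH₂'.const_mul 2).mul hα).add ((hH₂.const_mul 2).mul hα'))).add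
          (hζ'.const_mul (2 * m)))))
      (fun t ht => (e5 t ht).trans (by ring)) ht).trans ?_
    ring
  · refine (HasProperDeriv.unique hB hI (hv' 6)
      ((((hH₂.const_mul 2).mul (hq₂.mul hζ)).add (hq₂.mul hζ')).sub
        (((((hH₁.const_mul 2).mul (hq₁.mul hβ)).add (hq₁.mul hβ')).const_mul m)))
      (fun t ht => (e6 t ht).trans (by ring)) ht).trans ?_
    ring

end

end BianchiIII

end

noncomputable section

namespace BianchiIII

/-! ### Algebra of the reduced field equations -/

/-- In variables scaled by the expansion rate of the base: the Hamilton equations for `k` and `p`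
imply the first order equations for the shift amplitude `F` and the lapse amplitude `A`. -/
theorem shift_equation {l h u k p dk dp om : ℝ} (hl : l + 2 ≠ 0) (hh : 1 + 2 * h ≠ 0) (hom₀ : om ≠ 0)
    (hom : om = 1 + 2 * u + l / (l + 2) * u ^ 2) {dh du dom a da V : ℝ}
    (hdh : dh = -h * (1 + 2 * h)) (hdu : du = -h * (1 + 2 * h) + 2 * (u - h) * (1 - h))
    (hdom : dom = (2 + 2 * (l / (l + 2)) * u) * du)
    (ha : a = -(l - 1) * (1 + 2 * h) + 2 * (1 + h) - 5
      - ((7 * l + 8) * u + l * (l - 1) * u * (1 + 2 * h) + 2 * l * u ^ 2) / (l + 2))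
    (hda : da = -(l - 1) * (2 * dh) + 2 * dh
      - ((7 * l + 8) * du + l * (l - 1) * (du * (1 + 2 * h) + u * (2 * dh)) + 4 * l * u * du) / (l + 2))
    (hV : V = (11 * l + 4) / 4 + (l + 2) * (1 + h) + l * (l - 1) ^ 2 * (1 + 2 * h) ^ 2 / 4
      + (5 * l ^ 2 / 2 - l - 3) * (1 + 2 * h) + (5 * l + 4) * u + l * (l - 1) * u * (1 + 2 * h)
      + l * u ^ 2)
    (hdk : dk * om = (-2 * h * k + p) * om - k * dom)
    (hdp : dp * om = -p * om + k * ((-V * om / (l + 2) + a ^ 2 / 4 + da / 2 + a / 2 * (1 - 2 * h)) * om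
      - a / 2 * dom))
    {A dA F dF : ℝ}
    (hA : A = k * (-((l - 1) * (1 + 2 * h) + 3) / (l + 2) + (1 + l / (l + 2) * u) * (1 + h))
      - (1 + l / (l + 2) * u) * p)
    (hdA : dA = dk * (-((l - 1) * (1 + 2 * h) + 3) / (l + 2) + (1 + l / (l + 2) * u) * (1 + h))
      + k * (-((l - 1) * (2 * dh)) / (l + 2) + l / (l + 2) * du * (1 + h) + (1 + l / (l + 2) * u) * dh)
      - (l / (l + 2) * du * p + (1 + l / (l + 2) * u) * dp))
    (hF : F * ((l + 2) * (1 + 2 * h)) = -(du * k + 2 * h * u * k - u * p)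
      - (l + 2 + l * u) * (1 + 2 * h) * k / 2)
    (hdF : dF * ((l + 2) * (1 + 2 * h)) + F * ((l + 2) * (2 * dh))
      = -((-dh * (1 + 2 * h) - h * (2 * dh) + 2 * (du - dh) * (1 - h) - 2 * (u - h) * dh) * k + du * dk
          + 2 * (dh * u * k + h * du * k + h * u * dk) - (du * p + u * dp))
        - (l * du * (1 + 2 * h) * k + (l + 2 + l * u) * (2 * dh) * k
          + (l + 2 + l * u) * (1 + 2 * h) * dk) / 2) :
    2 * dF + 2 * F = A - k * om ∧
    dA = -(-2 * h * k * om + om * p) - 2 * (1 + u + h) * A - l * (1 + 2 * h) * (2 + u - h) * F := by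
  -- The substitutions g = 1 + 2h and c = l + 2 make these denominators single variables.
  obtain ⟨g, rfl⟩ : ∃ g, h = (g - 1) / 2 := ⟨1 + 2 * h, by ring⟩
  obtain ⟨c, rfl⟩ : ∃ c, l = c - 2 := ⟨l + 2, by ring⟩
  rw [show 1 + 2 * ((g - 1) / 2) = g by ring] at *
  rw [show c - 2 + 2 = c by ring] at *
  have hF' : F = (-(du * k + 2 * ((g - 1) / 2) * u * k - u * p)
      - (c + (c - 2) * u) * g * k / 2) / (c * g) := by
    rw [eq_div_iff (mul_ne_zero hl hh), hF]
  have hdk' : dk = ((-2 * ((g - 1) / 2) * k + p) * om - k * dom) / om := by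
    rw [eq_div_iff hom₀, hdk]
  have hdp' := eq_div_of_mul_eq hom₀ hdp
  have hdF' : dF = _ := eq_div_of_mul_eq (mul_ne_zero hl hh) (eq_sub_of_add_eq hdF)
  constructor
  · rw [hdF', hF', hA, hdk', hdp']
    field_simp
    rw [hda, ha, hV, hdom, hdu, hdh, hom]
    field_simp
    ring
  · rw [hdA, hF', hA, hdk', hdp']
    field_simp
    rw [hda, ha, hV, hdom, hdu, hdh, hom]
    field_simp
    ring

/-- The constraints and the first order equations for `F` and `A` imply all field equations. -/
theorem einsteinAmp_eq_zero {h₁ h₂ q₁ q₂ lam m A A' F F' S S' Z Z' Z'' : ℝ} (hq₂ : q₂ ≠ 0)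
    (hlam : lam ≠ 0) (hfr : q₁ * (h₁ * (h₁ + 2 * h₂)) = 1)
    (hZ' : Z' = -(h₁ + h₂) * A + (2 / q₁ + m ^ 2 / q₂) * F + m / q₂ * S + (h₁ - h₂) * Z)
    (hS : S = -(2 * m / lam ^ 2) * (h₁ * q₁ * A) - m * F)
    (hF' : 2 * F' = A - 2 * h₂ * F - Z)
    (hA' : h₁ * q₁ * A' = -(2 * A + h₁ * q₁ * Z' + 2 * h₁ * lam ^ 2 * F
      - 2 * h₁ * q₁ * m / q₂ * S))
    (ham : A + lam ^ 2 * (h₁ + h₂) * F - 2 * h₁ * m * q₁ / q₂ * S + q₁ * h₁ * Z'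
      + lam ^ 2 / 2 * Z = 0)
    (hS' : S' = -(2 * m / lam ^ 2) * ((h₁ * (h₂ - h₁) * q₁ + h₁ * (2 * h₁ * q₁)) * A
      + h₁ * q₁ * A') - m * F')
    (hZ'' : Z'' = -(h₁ * (h₂ - h₁) - h₂ * (2 * h₁ + h₂)) * A - (h₁ + h₂) * A'
      + (-4 * h₁ / q₁ - 2 * h₂ * m ^ 2 / q₂) * F + (2 / q₁ + m ^ 2 / q₂) * F'
      - 2 * h₂ * m / q₂ * S + m / q₂ * S' + (h₁ * (h₂ - h₁) + h₂ * (2 * h₁ + h₂)) * Z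
      + (h₁ - h₂) * Z') :
    einsteinAmp h₁ h₂ q₁ q₂ lam m A A' F F' S S' Z Z' Z'' = 0 := by
  obtain ⟨w, rfl⟩ : ∃ w, h₂ = (w - h₁) / 2 := ⟨h₁ + 2 * h₂, by ring⟩
  replace hfr : q₁ * (h₁ * w) = 1 := by rw [← hfr]; ring
  have hc : h₁ * w ≠ 0 := right_ne_zero_of_mul (hfr ▸ one_ne_zero)
  have hh₁ := left_ne_zero_of_mul hc
  have hw := right_ne_zero_of_mul hc
  obtain rfl : q₁ = 1 / (h₁ * w) := by field_simp; linarith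
  have hA'' : A' = -(2 * w * A + Z' + 2 * h₁ * w * lam ^ 2 * F - 2 * m / q₂ * S) := by
    field_simp at hA' ⊢
    linarith
  have hF'' : F' = (A - (w - h₁) * F - Z) / 2 := by linarith
  -- The fiber-fiber equation is a multiple of the Hamiltonian constraint once the first order
  -- equations and the differentiated momentum constraints `hS'` and `hZ''` are inserted.
  have e5 : -m ^ 2 * A + (w - h₁) / 2 * q₂ * A' + 2 * ((w - h₁) / 2) * q₂ * lam ^ 2 / (1 / (h₁ * w)) * F
      - 4 * h₁ * m * S - 2 * m * S' + q₂ * lam ^ 2 / (1 / (h₁ * w)) * Z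
      + 2 * (h₁ + (w - h₁) / 2) * q₂ * Z' + q₂ * Z'' = 0 := by
    refine Eq.trans ?_ ((congrArg ((2 * q₂ * (h₁ * w) - 2 * m ^ 2 / lam ^ 2) * ·) ham).trans
      (mul_zero _))
    simp only [hZ'', hS', hA'', hF'']
    rw [hZ', hS]
    field_simp
    ring
  ext i
  fin_cases i
  · have e0 : (m ^ 2 / q₂ + lam ^ 2 / (1 / (h₁ * w))) * A - (2 * h₁ + (w - h₁) / 2) * A'
        - 2 * lam ^ 2 / (1 / (h₁ * w)) * F' + 2 * m / q₂ * S' - 2 * ((w - h₁) / 2) * Z' - Z''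
        = 4 * h₁ * w * (A + lam ^ 2 * (h₁ + (w - h₁) / 2) * F - 2 * h₁ * m * (1 / (h₁ * w)) / q₂ * S
            + 1 / (h₁ * w) * h₁ * Z' + lam ^ 2 / 2 * Z)
          - (-m ^ 2 * A + (w - h₁) / 2 * q₂ * A'
            + 2 * ((w - h₁) / 2) * q₂ * lam ^ 2 / (1 / (h₁ * w)) * F
            - 4 * h₁ * m * S - 2 * m * S' + q₂ * lam ^ 2 / (1 / (h₁ * w)) * Z
            + 2 * (h₁ + (w - h₁) / 2) * q₂ * Z' + q₂ * Z'') / q₂ := by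
      rw [hA'', hF'']
      field_simp
      ring
    rw [ham, e5] at e0
    simpa [einsteinAmp] using e0
  · simp [einsteinAmp]
    rw [hZ']
    field_simp
    ring
  · simp [einsteinAmp]
    rw [hS]
    field_simp
    ring
  · simp [einsteinAmp]
    rw [hA'', hF'']
    field_simp
    ring
  · simp [einsteinAmp]
    linarith
  · simpa [einsteinAmp] using e5
  -- The base-fiber equation is likewise a multiple of the Hamiltonian constraint, with factor
  -- -2m/λ².
  · refine Eq.trans ?_ ((congrArg ((-2 * m / lam ^ 2) * ·) ham).trans (mul_zero _))
    simp [einsteinAmp]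
    simp only [hS', hA'', hF'']
    rw [hZ', hS]
    field_simp
    ring

end BianchiIII

end

noncomputable section

namespace BianchiIII

/-! ### Scaled background variables -/

namespace Background

variable (B : Background) (lam : ℝ) (m : ℤ)

/-- The ratio of the expansion rates of the fiber and the base. -/
def ratio (t : ℝ) : ℝ := B.H₂ t / B.H₁ t

/-- The function `q₁ Σ / q₂`. -/
def scaledSig (t : ℝ) : ℝ := B.q₁ t * B.Sig lam m t / B.q₂ t

/-- The function `Ω / q₂²`. -/
def scaledOmega (t : ℝ) : ℝ := B.Omega lam m t / B.q₂ t ^ 2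

end Background

/-- The numerator of `α₃₃` in scaled variables. -/
def alphaNum (l h u : ℝ) : ℝ :=
  -(l - 1) * (1 + 2 * h) + 2 * (1 + h) - 5
    - ((7 * l + 8) * u + l * (l - 1) * u * (1 + 2 * h) + 2 * l * u ^ 2) / (l + 2)

/-- The derivative of `alphaNum`. -/
def alphaNum' (l h u dh du : ℝ) : ℝ :=
  -(l - 1) * (2 * dh) + 2 * dh
    - ((7 * l + 8) * du + l * (l - 1) * (du * (1 + 2 * h) + u * (2 * dh)) + 4 * l * u * du) / (l + 2)

/-- The potential in scaled variables. -/
def scaledPotential (l h u : ℝ) : ℝ :=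
  (11 * l + 4) / 4 + (l + 2) * (1 + h) + l * (l - 1) ^ 2 * (1 + 2 * h) ^ 2 / 4
    + (5 * l ^ 2 / 2 - l - 3) * (1 + 2 * h) + (5 * l + 4) * u + l * (l - 1) * u * (1 + 2 * h)
    + l * u ^ 2

/-- The scaled derivative of `ratio`. -/
def ratio' (h : ℝ) : ℝ := -h * (1 + 2 * h)

/-- The scaled derivative of `scaledSig`. -/
def scaledSig' (h u : ℝ) : ℝ := -h * (1 + 2 * h) + 2 * (u - h) * (1 - h)

/-- The scaled derivative of `scaledOmega`. -/
def scaledOmega' (l h u : ℝ) : ℝ := (2 + 2 * (l / (l + 2)) * u) * scaledSig' h u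

namespace Background

variable {B : Background} {I : Set ℝ} (hB : B.IsVacuum I) {t : ℝ}
include hB

theorem IsVacuum.H₂_eq (ht : t ∈ I) : B.H₂ t = B.ratio t * B.H₁ t := by
  rw [ratio, div_mul_cancel₀ _ (hB.H₁_ne_zero ht)]

theorem IsVacuum.friedmann' (ht : t ∈ I) :
    B.q₁ t * (B.H₁ t ^ 2 * (1 + 2 * B.ratio t)) = 1 := by
  have h := hB.friedmann ht
  rw [hB.H₂_eq ht] at h
  linear_combination h

/-- In q₁H₁²(1 + 2h) = 1 the other factors are positive. -/
theorem IsVacuum.ratio_pos (ht : t ∈ I) : 0 < 1 + 2 * B.ratio t := by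
  have h1 := hB.friedmann' ht
  have h2 := hB.q₁_pos t ht
  have h3 := hB.H₁_ne_zero ht
  by_contra h
  have : B.q₁ t * (B.H₁ t ^ 2 * (1 + 2 * B.ratio t)) ≤ 0 :=
    mul_nonpos_of_nonneg_of_nonpos h2.le
      (mul_nonpos_of_nonneg_of_nonpos (sq_nonneg _) (not_lt.1 h))
  linarith

theorem IsVacuum.q₁_eq (ht : t ∈ I) :
    B.q₁ t = 1 / (B.H₁ t ^ 2 * (1 + 2 * B.ratio t)) :=
  eq_one_div_of_mul_eq_one_left (hB.friedmann' ht)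

theorem IsVacuum.π₂_scaled (ht : t ∈ I) : B.π₂ t = -2 * B.q₁ t * B.H₁ t / √(B.q₂ t) := by
  rw [← hB.π₂_eq ht, mul_div_cancel_right₀ _ (Real.sqrt_pos.2 (hB.q₂_pos t ht)).ne']

theorem IsVacuum.π₁_scaled (ht : t ∈ I) : B.π₁ t = -2 * √(B.q₂ t) * (B.H₁ t + B.H₂ t) := by
  have h1 := (hB.q₁_pos t ht).ne'
  have h3 := (Real.sqrt_pos.2 (hB.q₂_pos t ht)).ne'
  simp only [H₁, H₂]
  have hs : B.q₂ t = √(B.q₂ t) ^ 2 := (Real.sq_sqrt (hB.q₂_pos t ht).le).symm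
  generalize √(B.q₂ t) = r at *
  rw [hs]
  field_simp
  ring

/-- Thus Δ₁ is the ratio of the derivatives of q₂ and q₁. A time shift changes γ¹ and γ³ in this
proportion, which is why γ³ - Δ₁γ¹ does not feel it. -/
theorem IsVacuum.Delta₁_eq (ht : t ∈ I) : B.Delta₁ t = B.q₂ t * B.ratio t / B.q₁ t := by
  have h1 := (hB.q₁_pos t ht).ne'
  have h2 := hB.H₁_ne_zero ht
  have h3 := (Real.sqrt_pos.2 (hB.q₂_pos t ht)).ne'
  have hs : B.q₂ t = √(B.q₂ t) ^ 2 := (Real.sq_sqrt (hB.q₂_pos t ht).le).symm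
  rw [Delta₁, hB.π₁_scaled ht, hB.π₂_scaled ht, hB.H₂_eq ht]
  generalize √(B.q₂ t) = r at *
  rw [hs]
  field_simp
  ring

theorem IsVacuum.Sig_eq (ht : t ∈ I) (lam : ℝ) (m : ℤ) :
    B.Sig lam m t = B.q₂ t * B.scaledSig lam m t / B.q₁ t := by
  have h1 := (hB.q₁_pos t ht).ne'
  have h2 := (hB.q₂_pos t ht).ne'
  rw [scaledSig]
  field_simp

theorem IsVacuum.scaledSig_eq (ht : t ∈ I) (lam : ℝ) (m : ℤ) :
    B.scaledSig lam m t = B.ratio t + 2 * (m : ℝ) ^ 2 / lam ^ 2 * (B.q₁ t / B.q₂ t) := by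
  have h1 := (hB.q₁_pos t ht).ne'
  have h2 := (hB.q₂_pos t ht).ne'
  have h3 : B.Sig lam m t = B.Delta₁ t + 2 * (m : ℝ) ^ 2 / lam ^ 2 := rfl
  rw [scaledSig, h3, hB.Delta₁_eq ht]
  field_simp

theorem IsVacuum.Omega_eq (ht : t ∈ I) (lam : ℝ) (m : ℤ) :
    B.Omega lam m t = B.q₂ t ^ 2 * B.scaledOmega lam m t := by
  rw [scaledOmega, mul_div_cancel₀ _ (pow_ne_zero 2 (hB.q₂_pos t ht).ne')]

theorem IsVacuum.scaledOmega_eq (ht : t ∈ I) (lam : ℝ) (m : ℤ) :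
    B.scaledOmega lam m t = 1 + 2 * B.scaledSig lam m t
      + lam ^ 2 / (lam ^ 2 + 2) * B.scaledSig lam m t ^ 2 := by
  have h1 := (hB.q₁_pos t ht).ne'
  have h2 := (hB.q₂_pos t ht).ne'
  rw [scaledOmega, Omega, hB.Sig_eq ht]
  field_simp

/-- Since u exceeds h by a nonnegative multiple of m², Ω/q₂² ≥ 1 + 2u ≥ 1 + 2h > 0. -/
theorem IsVacuum.scaledOmega_pos (ht : t ∈ I) (lam : ℝ) (m : ℤ) : 0 < B.scaledOmega lam m t := by
  have h1 := hB.q₁_pos t ht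
  have h2 := hB.q₂_pos t ht
  have h3 := hB.ratio_pos ht
  have h4 : 0 ≤ 2 * (m : ℝ) ^ 2 / lam ^ 2 * (B.q₁ t / B.q₂ t) := by positivity
  have h5 : 0 ≤ lam ^ 2 / (lam ^ 2 + 2) * B.scaledSig lam m t ^ 2 := by positivity
  have h6 := hB.scaledSig_eq ht lam m
  rw [hB.scaledOmega_eq ht]
  linarith

theorem IsVacuum.Omega_pos (ht : t ∈ I) (lam : ℝ) (m : ℤ) : 0 < B.Omega lam m t := by
  rw [hB.Omega_eq ht]
  exact mul_pos (pow_pos (hB.q₂_pos t ht) 2) (hB.scaledOmega_pos ht lam m)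

/-- The constraint removes q₁, and what remains is a rational function of λ², h, u times a
dimensional factor. Writing q₂ as the square of its root r makes the identity rational. -/
theorem IsVacuum.alpha₃₃_eq (ht : t ∈ I) (lam : ℝ) (m : ℤ) :
    B.alpha₃₃ lam m t = -(1 / 2) * (alphaNum (lam ^ 2) (B.ratio t) (B.scaledSig lam m t)
      / B.scaledOmega lam m t) * (B.q₁ t * B.H₁ t / (B.q₂ t * √(B.q₂ t))) := by
  have h0 := (hB.scaledOmega_pos ht lam m).ne'
  have h2 := hB.H₁_ne_zero ht
  have h3 := (Real.sqrt_pos.2 (hB.q₂_pos t ht)).ne'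
  have h4 := (hB.ratio_pos ht).ne'
  have hs : B.q₂ t = √(B.q₂ t) ^ 2 := (Real.sq_sqrt (hB.q₂_pos t ht).le).symm
  have hl : lam ^ 2 + 2 ≠ 0 := by positivity
  rw [alpha₃₃, hB.Omega_eq ht, hB.π₁_scaled ht, hB.π₂_scaled ht, hB.Sig_eq ht, hB.H₂_eq ht,
    hB.q₁_eq ht]
  generalize B.scaledOmega lam m t = om at *
  generalize B.scaledSig lam m t = u at *
  generalize B.ratio t = h at *
  generalize √(B.q₂ t) = r at *
  rw [hs, alphaNum]
  obtain ⟨g, rfl⟩ : ∃ g, h = (g - 1) / 2 := ⟨1 + 2 * h, by ring⟩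
  rw [show 1 + 2 * ((g - 1) / 2) = g by ring] at *
  field_simp
  ring

theorem IsVacuum.potential_eq (ht : t ∈ I) (lam : ℝ) (m : ℤ) :
    B.potential lam m t = scaledPotential (lam ^ 2) (B.ratio t) (B.scaledSig lam m t)
      / (B.q₂ t * (1 + 2 * B.ratio t) * (lam ^ 2 + 2)) := by
  have h2 := hB.H₁_ne_zero ht
  have h3 := (Real.sqrt_pos.2 (hB.q₂_pos t ht)).ne'
  have h4 := (hB.ratio_pos ht).ne'
  have hs : B.q₂ t = √(B.q₂ t) ^ 2 := (Real.sq_sqrt (hB.q₂_pos t ht).le).symm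
  have hl : lam ^ 2 + 2 ≠ 0 := by positivity
  rw [potential, hB.π₁_scaled ht, hB.π₂_scaled ht, hB.Sig_eq ht, hB.H₂_eq ht, hB.q₁_eq ht]
  generalize B.scaledSig lam m t = u at *
  generalize B.ratio t = h at *
  generalize √(B.q₂ t) = r at *
  rw [hs, scaledPotential]
  obtain ⟨g, rfl⟩ : ∃ g, h = (g - 1) / 2 := ⟨1 + 2 * h, by ring⟩
  rw [show 1 + 2 * ((g - 1) / 2) = g by ring] at *
  field_simp
  ring

/-- Division by H₁ amounts to using log √q₁ as time; in it h, u and Ω/q₂² obey equations in h and u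
alone. -/
theorem IsVacuum.hasProperDeriv_ratio :
    HasProperDeriv B I B.ratio fun t => B.H₁ t * ratio' (B.ratio t) := by
  have hH₁ : HasProperDeriv B I B.H₁ fun t => B.H₁ t * (B.H₂ t - B.H₁ t) :=
    fun t => hB.hasDerivAt_H₁
  have hH₂ : HasProperDeriv B I B.H₂ fun t => -B.H₂ t * (2 * B.H₁ t + B.H₂ t) :=
    fun t => hB.hasDerivAt_H₂
  refine (hH₂.div hH₁ fun t ht => hB.H₁_ne_zero ht).congr fun t ht => ?_
  have h2 := hB.H₁_ne_zero ht
  rw [hB.H₂_eq ht, ratio']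
  field_simp
  ring

theorem IsVacuum.hasProperDeriv_scaledSig (hI : IsOpen I) (lam : ℝ) (m : ℤ) :
    HasProperDeriv B I (B.scaledSig lam m)
      fun t => B.H₁ t * scaledSig' (B.ratio t) (B.scaledSig lam m t) := by
  have hq₁ : HasProperDeriv B I B.q₁ fun t => 2 * B.H₁ t * B.q₁ t := fun t => hB.hasDerivAt_q₁
  have hq₂ : HasProperDeriv B I B.q₂ fun t => 2 * B.H₂ t * B.q₂ t := fun t => hB.hasDerivAt_q₂
  have h := (hB.hasProperDeriv_ratio).add ((hq₁.div hq₂ fun t ht => (hB.q₂_pos t ht).ne').const_mul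
    (2 * (m : ℝ) ^ 2 / lam ^ 2))
  have h' : HasProperDeriv B I (B.scaledSig lam m) _ := fun t ht =>
    (h t ht).congr_of_eventuallyEq (Filter.eventually_of_mem (hI.mem_nhds ht)
      fun s hs => hB.scaledSig_eq hs lam m)
  refine h'.congr fun t ht => ?_
  have h2 := (hB.q₂_pos t ht).ne'
  have h3 := hB.scaledSig_eq ht lam m
  rw [scaledSig', h3, hB.H₂_eq ht, ratio']
  generalize 2 * (m : ℝ) ^ 2 / lam ^ 2 = μ
  field_simp
  ring

theorem IsVacuum.hasProperDeriv_scaledOmega (hI : IsOpen I) (lam : ℝ) (m : ℤ) :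
    HasProperDeriv B I (B.scaledOmega lam m)
      fun t => B.H₁ t * scaledOmega' (lam ^ 2) (B.ratio t) (B.scaledSig lam m t) := by
  have hu := hB.hasProperDeriv_scaledSig hI lam m
  have h := ((hasProperDeriv_const 1).add (hu.const_mul 2)).add
    ((hu.mul hu).const_mul (lam ^ 2 / (lam ^ 2 + 2)))
  have h' : HasProperDeriv B I (B.scaledOmega lam m) _ := fun t ht =>
    (h t ht).congr_of_eventuallyEq (Filter.eventually_of_mem (hI.mem_nhds ht)
      fun s hs => (hB.scaledOmega_eq hs lam m).trans (by ring))
  refine h'.congr fun t ht => ?_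
  rw [scaledOmega']
  ring

theorem IsVacuum.hasProperDeriv_alphaNum (hI : IsOpen I) (lam : ℝ) (m : ℤ) :
    HasProperDeriv B I (fun t => alphaNum (lam ^ 2) (B.ratio t) (B.scaledSig lam m t))
      fun t => B.H₁ t * alphaNum' (lam ^ 2) (B.ratio t) (B.scaledSig lam m t)
        (ratio' (B.ratio t)) (scaledSig' (B.ratio t) (B.scaledSig lam m t)) := by
  have hu := hB.hasProperDeriv_scaledSig hI lam m
  have hr := hB.hasProperDeriv_ratio
  have hg := (hasProperDeriv_const 1).add (hr.const_mul 2)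
  have h := (((hg.const_mul (-(lam ^ 2 - 1))).add
    (((hasProperDeriv_const 1).add hr).const_mul 2)).sub (hasProperDeriv_const 5)).sub
    ((((hu.const_mul (7 * lam ^ 2 + 8)).add ((hu.const_mul (lam ^ 2 * (lam ^ 2 - 1))).mul hg)).add
      ((hu.mul hu).const_mul (2 * lam ^ 2))).const_mul (1 / (lam ^ 2 + 2)))
  intro t ht
  refine ((h t ht).congr_of_eventuallyEq (Filter.Eventually.of_forall fun s => ?_)).congr_deriv ?_
  · simp only [alphaNum]; ring
  · simp only [alphaNum']; ring

end Background

end BianchiIII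

end

noncomputable section

namespace BianchiIII

open Filter Topology

/-! ### Scaled canonical variables -/

namespace Background

/-- The scaled derivative of the momentum variable. -/
def momentum' (l h u om k p : ℝ) : ℝ :=
  -p + k * (-scaledPotential l h u * om / (l + 2) + alphaNum l h u ^ 2 / 4
    + alphaNum' l h u (ratio' h) (scaledSig' h u) / 2 + alphaNum l h u / 2 * (1 - 2 * h)
    - alphaNum l h u / 2 * scaledOmega' l h u / om)

variable {B : Background} {I : Set ℝ} (hB : B.IsVacuum I) (hI : IsOpen I) {lam : ℝ} {m : ℤ}
  {Q P : ℝ → ℝ} (hQP : B.GaugeInvariantEvolution lam m I Q P)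
include hB

theorem IsVacuum.hasProperDeriv_q₁ : HasProperDeriv B I B.q₁ fun t => 2 * B.H₁ t * B.q₁ t :=
  fun _ => hB.hasDerivAt_q₁

theorem IsVacuum.hasProperDeriv_q₂ : HasProperDeriv B I B.q₂ fun t => 2 * B.H₂ t * B.q₂ t :=
  fun _ => hB.hasDerivAt_q₂

theorem IsVacuum.hasProperDeriv_H₁ :
    HasProperDeriv B I B.H₁ fun t => B.H₁ t * (B.H₂ t - B.H₁ t) :=
  fun _ => hB.hasDerivAt_H₁

theorem IsVacuum.hasProperDeriv_H₂ :
    HasProperDeriv B I B.H₂ fun t => -B.H₂ t * (2 * B.H₁ t + B.H₂ t) :=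
  fun _ => hB.hasDerivAt_H₂

theorem IsVacuum.hasProperDeriv_sqrt :
    HasProperDeriv B I (fun t => √(B.q₂ t)) fun t => B.H₂ t * √(B.q₂ t) :=
  fun _ => hB.hasDerivAt_sqrt

include hQP

theorem IsVacuum.hasProperDeriv_Q : HasProperDeriv B I Q fun t =>
    B.q₁ t * B.H₁ t * (B.scaledOmega lam m t * B.q₂ t / B.q₁ t)
      * (P t * √(B.q₂ t) / (B.q₁ t * B.H₁ t)) := fun t ht => by
  refine ((hQP t ht).1).congr_deriv ?_
  have h1 := (hB.q₁_pos t ht).ne'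
  have h2 := hB.H₁_ne_zero ht
  have h3 := (Real.sqrt_pos.2 (hB.q₂_pos t ht)).ne'
  have hs : B.q₂ t = √(B.q₂ t) ^ 2 := (Real.sq_sqrt (hB.q₂_pos t ht).le).symm
  beta_reduce
  rw [hB.Omega_eq ht]
  generalize √(B.q₂ t) = r at *
  rw [hs]
  field_simp

include hI

theorem IsVacuum.hasProperDeriv_scaledQ :
    HasProperDeriv B I (fun t => Q t * B.q₂ t / B.Omega lam m t)
      fun t => B.H₁ t * (-2 * B.ratio t * (Q t * B.q₂ t / B.Omega lam m t)
        + P t * √(B.q₂ t) / (B.q₁ t * B.H₁ t)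
        - Q t * B.q₂ t / B.Omega lam m t
          * scaledOmega' (lam ^ 2) (B.ratio t) (B.scaledSig lam m t) / B.scaledOmega lam m t) := by
  have h := (hB.hasProperDeriv_Q hQP).div
    (hB.hasProperDeriv_q₂.mul (hB.hasProperDeriv_scaledOmega hI lam m))
    fun t ht => mul_ne_zero (hB.q₂_pos t ht).ne' (hB.scaledOmega_pos ht lam m).ne'
  have h' : HasProperDeriv B I (fun t => Q t * B.q₂ t / B.Omega lam m t) _ := fun t ht =>
    (h t ht).congr_of_eventuallyEq (eventually_of_mem (hI.mem_nhds ht) fun s hs => by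
      have h1 := (hB.q₂_pos s hs).ne'
      have h2 := (hB.scaledOmega_pos hs lam m).ne'
      simp only [hB.Omega_eq hs]
      field_simp)
  refine h'.congr fun t ht => ?_
  have h0 := (hB.q₁_pos t ht).ne'
  have h1 := (hB.q₂_pos t ht).ne'
  have h2 := (hB.scaledOmega_pos ht lam m).ne'
  have h3 := hB.H₁_ne_zero ht
  rw [hB.Omega_eq ht, hB.H₂_eq ht]
  field_simp
  ring

/-- The derivative of α₃₃ in Hamilton's equation is computed from its scaled form. All dimensional
factors then cancel, so (k, p) satisfy a linear system with coefficients in λ², h and u. -/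
theorem IsVacuum.hasProperDeriv_scaledP :
    HasProperDeriv B I (fun t => P t * √(B.q₂ t) / (B.q₁ t * B.H₁ t))
      fun t => B.H₁ t * momentum' (lam ^ 2) (B.ratio t) (B.scaledSig lam m t)
        (B.scaledOmega lam m t) (Q t * B.q₂ t / B.Omega lam m t)
        (P t * √(B.q₂ t) / (B.q₁ t * B.H₁ t)) := by
  have hα := (((hB.hasProperDeriv_alphaNum hI lam m).div (hB.hasProperDeriv_scaledOmega hI lam m)
    fun t ht => (hB.scaledOmega_pos ht lam m).ne').const_mul (-(1 / 2))).mul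
    ((hB.hasProperDeriv_q₁.mul hB.hasProperDeriv_H₁).div
      (hB.hasProperDeriv_q₂.mul hB.hasProperDeriv_sqrt) fun t ht =>
        mul_ne_zero (hB.q₂_pos t ht).ne' (Real.sqrt_pos.2 (hB.q₂_pos t ht)).ne')
  have hα' : ∀ t ∈ I, deriv (B.alpha₃₃ lam m) t = _ := fun t ht =>
    ((hα t ht).congr_of_eventuallyEq (eventually_of_mem (hI.mem_nhds ht) fun s hs =>
      hB.alpha₃₃_eq hs lam m)).deriv
  have hP : HasProperDeriv B I P fun t =>
      (-((B.potential lam m t - B.Omega lam m t * B.alpha₃₃ lam m t ^ 2 / B.q₁ t)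
          * (B.N t * Q t / √(B.q₂ t)))
        - deriv (B.alpha₃₃ lam m) t * Q t) / B.N t := fun t ht => by
    rw [mul_div_cancel₀ _ (hB.N_pos t ht).ne']
    exact (hQP t ht).2
  refine ((hP.mul hB.hasProperDeriv_sqrt).div (hB.hasProperDeriv_q₁.mul hB.hasProperDeriv_H₁)
    fun t ht => mul_ne_zero (hB.q₁_pos t ht).ne' (hB.H₁_ne_zero ht)).congr fun t ht => ?_
  have hN := (hB.N_pos t ht).ne'
  have h2 := hB.H₁_ne_zero ht
  have h3 := (Real.sqrt_pos.2 (hB.q₂_pos t ht)).ne'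
  have h4 := (hB.ratio_pos ht).ne'
  have h5 := (hB.scaledOmega_pos ht lam m).ne'
  have hs : B.q₂ t = √(B.q₂ t) ^ 2 := (Real.sq_sqrt (hB.q₂_pos t ht).le).symm
  have hl : lam ^ 2 + 2 ≠ 0 := by positivity
  simp only [hα' t ht, hB.potential_eq ht, hB.alpha₃₃_eq ht, hB.Omega_eq ht, hB.H₂_eq ht, momentum']
  rw [hB.q₁_eq ht]
  generalize scaledPotential (lam ^ 2) (B.ratio t) (B.scaledSig lam m t) = V
  generalize alphaNum' (lam ^ 2) (B.ratio t) (B.scaledSig lam m t) _ _ = a'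
  generalize alphaNum (lam ^ 2) (B.ratio t) (B.scaledSig lam m t) = a
  generalize scaledOmega' (lam ^ 2) (B.ratio t) (B.scaledSig lam m t) = om'
  generalize B.scaledOmega lam m t = om at *
  generalize B.scaledSig lam m t = u at *
  generalize B.ratio t = h at *
  generalize √(B.q₂ t) = r at *
  rw [hs]
  obtain ⟨g, rfl⟩ : ∃ g, h = (g - 1) / 2 := ⟨1 + 2 * h, by ring⟩
  rw [show 1 + 2 * ((g - 1) / 2) = g by ring] at *
  field_simp
  ring

end Background

end BianchiIII

end

noncomputable section

namespace BianchiIII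

open scoped ContDiff
open Filter

/-! ### Smoothness -/

/-- Solutions of a linear system with smooth coefficients are smooth. -/
theorem contDiffOn_of_linear_system {I : Set ℝ} (hI : IsOpen I) {a b x y : ℝ → ℝ}
    (ha : ContDiffOn ℝ ∞ a I) (hb : ContDiffOn ℝ ∞ b I)
    (hx : ∀ t ∈ I, HasDerivAt x (a t * y t) t) (hy : ∀ t ∈ I, HasDerivAt y (b t * x t) t) :
    ContDiffOn ℝ ∞ x I ∧ ContDiffOn ℝ ∞ y I := by
  have h : ∀ n : ℕ, ContDiffOn ℝ n x I ∧ ContDiffOn ℝ n y I := by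
    intro n
    induction n with
    | zero =>
      simp only [Nat.cast_zero, contDiffOn_zero]
      exact ⟨fun t ht => (hx t ht).continuousAt.continuousWithinAt,
        fun t ht => (hy t ht).continuousAt.continuousWithinAt⟩
    | succ n ih =>
      have hn : ((n + 1 : ℕ) : WithTop ℕ∞) = n + 1 := by push_cast; rfl
      have hle : (n : WithTop ℕ∞) ≤ ∞ := by exact_mod_cast le_top
      simp only [hn, contDiffOn_succ_iff_deriv_of_isOpen hI]
      refine ⟨⟨fun t ht => (hx t ht).differentiableAt.differentiableWithinAt, by simp,
          ((ha.of_le hle).mul ih.2).congr fun t ht => (hx t ht).deriv⟩,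
        ⟨fun t ht => (hy t ht).differentiableAt.differentiableWithinAt, by simp,
          ((hb.of_le hle).mul ih.1).congr fun t ht => (hy t ht).deriv⟩⟩
  exact ⟨contDiffOn_infty.2 fun n => (h n).1, contDiffOn_infty.2 fun n => (h n).2⟩

namespace Background

variable {B : Background} {I : Set ℝ} (hB : B.IsVacuum I) (hI : IsOpen I) (lam : ℝ) (m : ℤ)
include hB

theorem IsVacuum.smooth_sqrt : ContDiffOn ℝ ∞ (fun t => √(B.q₂ t)) I :=
  hB.smooth_q₂.sqrt fun t ht => (hB.q₂_pos t ht).ne'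

theorem IsVacuum.smooth_Delta₁ : ContDiffOn ℝ ∞ B.Delta₁ I :=
  (hB.smooth_π₁.div hB.smooth_π₂ fun _ => hB.π₂_ne_zero).sub
    (hB.smooth_q₂.div hB.smooth_q₁ fun t ht => (hB.q₁_pos t ht).ne')

theorem IsVacuum.smooth_Sig : ContDiffOn ℝ ∞ (B.Sig lam m) I :=
  hB.smooth_Delta₁.add contDiffOn_const

theorem IsVacuum.smooth_Omega : ContDiffOn ℝ ∞ (B.Omega lam m) I :=
  ((hB.smooth_q₂.pow 2).add (((contDiffOn_const (c := (2 : ℝ))).mul hB.smooth_q₁ |>.mul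
    hB.smooth_q₂).mul (hB.smooth_Sig lam m))).add
    ((contDiffOn_const.mul (hB.smooth_q₁.pow 2)).mul ((hB.smooth_Sig lam m).pow 2))

theorem IsVacuum.smooth_H₁ : ContDiffOn ℝ ∞ B.H₁ I := by
  have h := (contDiffOn_const (c := -(1 / 2 : ℝ))).mul
    ((hB.smooth_π₂.mul hB.smooth_sqrt).div hB.smooth_q₁ fun t ht => (hB.q₁_pos t ht).ne')
  refine h.congr fun t ht => ?_
  have h1 := (hB.q₁_pos t ht).ne'
  have h3 := (Real.sqrt_pos.2 (hB.q₂_pos t ht)).ne'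
  simp only [Pi.div_apply, hB.π₂_scaled ht]
  field_simp

theorem IsVacuum.smooth_ratio : ContDiffOn ℝ ∞ B.ratio I :=
  ((hB.smooth_Delta₁.mul hB.smooth_q₁).div hB.smooth_q₂
    fun t ht => (hB.q₂_pos t ht).ne').congr fun t ht => by
      have h1 := (hB.q₁_pos t ht).ne'
      have h2 := (hB.q₂_pos t ht).ne'
      simp only [Pi.div_apply, hB.Delta₁_eq ht]
      field_simp

theorem IsVacuum.smooth_scaledSig : ContDiffOn ℝ ∞ (B.scaledSig lam m) I :=
  (hB.smooth_q₁.mul (hB.smooth_Sig lam m)).div hB.smooth_q₂ fun t ht => (hB.q₂_pos t ht).ne'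

theorem IsVacuum.smooth_scaledOmega : ContDiffOn ℝ ∞ (B.scaledOmega lam m) I :=
  (hB.smooth_Omega lam m).div (hB.smooth_q₂.pow 2) fun t ht => pow_ne_zero 2 (hB.q₂_pos t ht).ne'

theorem IsVacuum.smooth_alpha₃₃ : ContDiffOn ℝ ∞ (B.alpha₃₃ lam m) I := by
  have hu := hB.smooth_scaledSig lam m
  have hh := hB.smooth_ratio
  have ha : ContDiffOn ℝ ∞ (fun t => alphaNum (lam ^ 2) (B.ratio t) (B.scaledSig lam m t)) I := by
    unfold alphaNum
    fun_prop
  refine ((contDiffOn_const.mul (ha.div (hB.smooth_scaledOmega lam m)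
    fun t ht => (hB.scaledOmega_pos ht lam m).ne')).mul
    ((hB.smooth_q₁.mul hB.smooth_H₁).div (hB.smooth_q₂.mul hB.smooth_sqrt) fun t ht =>
      mul_ne_zero (hB.q₂_pos t ht).ne' (Real.sqrt_pos.2 (hB.q₂_pos t ht)).ne')).congr
    fun t ht => hB.alpha₃₃_eq ht lam m

theorem IsVacuum.smooth_potential : ContDiffOn ℝ ∞ (B.potential lam m) I := by
  have hu := hB.smooth_scaledSig lam m
  have hh := hB.smooth_ratio
  have hV : ContDiffOn ℝ ∞
      (fun t => scaledPotential (lam ^ 2) (B.ratio t) (B.scaledSig lam m t)) I := by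
    unfold scaledPotential
    fun_prop
  refine (hV.div ((hB.smooth_q₂.mul (contDiffOn_const.add (contDiffOn_const.mul hh))).mul
    contDiffOn_const) fun t ht => mul_ne_zero (mul_ne_zero (hB.q₂_pos t ht).ne'
      (hB.ratio_pos ht).ne') ?_).congr fun t ht => hB.potential_eq ht lam m
  positivity

end Background

/-- The coefficient of `P` in the Hamilton equation for `Q`. -/
def Background.kineticCoeff (B : Background) (lam : ℝ) (m : ℤ) (t : ℝ) : ℝ :=
  B.N t * B.Omega lam m t / (B.q₁ t * √(B.q₂ t))

/-- The coefficient of `Q` in the Hamilton equation for `P`. -/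
def Background.forceCoeff (B : Background) (lam : ℝ) (m : ℤ) (t : ℝ) : ℝ :=
  -((B.potential lam m t - B.Omega lam m t * B.alpha₃₃ lam m t ^ 2 / B.q₁ t)
    * (B.N t / √(B.q₂ t))) - deriv (B.alpha₃₃ lam m) t

namespace Background

theorem gaugeInvariantEvolution_iff (B : Background) (lam : ℝ) (m : ℤ) (I : Set ℝ) (Q P : ℝ → ℝ) :
    B.GaugeInvariantEvolution lam m I Q P ↔ ∀ t ∈ I,
      HasDerivAt Q (B.kineticCoeff lam m t * P t) t ∧
      HasDerivAt P (B.forceCoeff lam m t * Q t) t := by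
  refine forall₂_congr fun t _ => ?_
  rw [kineticCoeff, forceCoeff, div_mul_eq_mul_div, sub_mul (-_), neg_mul,
    mul_assoc (_ - _), div_mul_eq_mul_div _ _ (Q t)]

variable {B : Background} {I : Set ℝ} (hB : B.IsVacuum I) (hI : IsOpen I) (lam : ℝ) (m : ℤ)
include hB

theorem IsVacuum.smooth_kineticCoeff : ContDiffOn ℝ ∞ (B.kineticCoeff lam m) I :=
  (hB.smooth_N.mul (hB.smooth_Omega lam m)).div (hB.smooth_q₁.mul hB.smooth_sqrt) fun t ht =>
    mul_ne_zero (hB.q₁_pos t ht).ne' (Real.sqrt_pos.2 (hB.q₂_pos t ht)).ne'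

include hI

theorem IsVacuum.smooth_forceCoeff : ContDiffOn ℝ ∞ (B.forceCoeff lam m) I :=
  (((hB.smooth_potential lam m).sub (((hB.smooth_Omega lam m).mul
    ((hB.smooth_alpha₃₃ lam m).pow 2)).div hB.smooth_q₁ fun t ht => (hB.q₁_pos t ht).ne')).mul
    (hB.smooth_N.div hB.smooth_sqrt fun t ht => (Real.sqrt_pos.2 (hB.q₂_pos t ht)).ne')).neg.sub
    ((hB.smooth_alpha₃₃ lam m).deriv_of_isOpen hI (by exact_mod_cast le_top))

variable {lam m} {Q P : ℝ → ℝ} (hQP : B.GaugeInvariantEvolution lam m I Q P)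
include hQP

/-- Solutions are only assumed to satisfy the equations pointwise; the regularity demanded of an
even perturbation has to come from the smooth coefficients. -/
theorem IsVacuum.smooth_solution : ContDiffOn ℝ ∞ Q I ∧ ContDiffOn ℝ ∞ P I := by
  rw [gaugeInvariantEvolution_iff] at hQP
  exact contDiffOn_of_linear_system hI (hB.smooth_kineticCoeff lam m)
    (hB.smooth_forceCoeff hI lam m) (fun t ht => (hQP t ht).1) fun t ht => (hQP t ht).2

end Background

end BianchiIII

end

noncomputable section

namespace BianchiIII

open scoped ContDiff
open Filter

/-! ### The even variables of the standard gauge -/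

/-- The even variables of the perturbation `Q G^(even)`. -/
def standardVariables (B : Background) (lam : ℝ) (m : ℤ) (Q : ℝ → ℝ) : EvenVariables where
  γ₁ t := -(Q t * (B.q₁ t * B.q₂ t / B.Omega lam m t))
  γ₂ t := -(Q t * (2 * B.q₁ t ^ 2 * B.Delta₂ lam m t / B.Omega lam m t))
  γ₃ t := Q t * (B.q₂ t * (B.q₁ t * B.Delta₁ t + B.q₂ t) / B.Omega lam m t)
  γ₄ t := -(Q t * (2 * ((m : ℝ) / lam) * B.q₁ t * B.q₂ t / B.Omega lam m t))
  s₀ t := -(Q t * (B.N t / 2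
    * (-(1 / (lam ^ 2 + 2) * (4 * (lam ^ 2 - 1) * B.q₁ t / B.π₂ t ^ 2 + 3 * B.q₂ t)
        / B.Omega lam m t)
      + 2 / deriv B.q₁ t * (B.Ups₁ lam m t + lam ^ 2 / (lam ^ 2 + 2) * B.Ups₂ lam m t))))
  s₁ t := -(Q t * (lam / (lam ^ 2 + 2) * (B.Ups₂ lam m t + B.Ups₃ lam m t)))
  s₃ t := -(Q t * ((m : ℝ) / (lam ^ 2 + 2) * (B.Ups₂ lam m t + B.Ups₃ lam m t)
    + 2 * (m : ℝ) / lam ^ 2 * B.Ups₁ lam m t))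

theorem mul_Geven_eq_perturbation (B : Background) (M : ModeFunctions) (lam : ℝ) (m : ℤ)
    (Q : ℝ → ℝ) (a b : Fin 4) (p : Pt) :
    Q (p 0) * Geven B M lam m a b p
      = (standardVariables B lam m Q).perturbation B M lam a b p := by
  simp only [Geven, EvenVariables.perturbation, standardVariables, symProd]
  ring

namespace Background

variable {B : Background} {I : Set ℝ} (hB : B.IsVacuum I) (hI : IsOpen I) (lam : ℝ) (m : ℤ)
include hB

theorem IsVacuum.deriv_q₁ {t : ℝ} (ht : t ∈ I) :
    deriv B.q₁ t = B.N t * (2 * B.H₁ t * B.q₁ t) := (hB.hasDerivAt_q₁ ht).deriv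

theorem IsVacuum.deriv_q₁_ne_zero {t : ℝ} (ht : t ∈ I) : deriv B.q₁ t ≠ 0 := by
  rw [hB.deriv_q₁ ht]
  have h1 := (hB.q₁_pos t ht).ne'
  have h2 := hB.H₁_ne_zero ht
  have h3 := (hB.N_pos t ht).ne'
  positivity

/-- Inserting the coefficients gives Q/Ω times q₁q₂Δ₁ + 2q₁²Δ₂² + q₂(q₁Δ₁ + q₂) + (4m²/λ²)q₁q₂, and
this sum is Ω. -/
theorem IsVacuum.gaugeInvariant_standardVariables {lam : ℝ} (hlam : 0 < lam) (Q : ℝ → ℝ) {t : ℝ}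
    (ht : t ∈ I) : (standardVariables B lam m Q).gaugeInvariant B lam m t = Q t := by
  have hO := (hB.Omega_pos ht lam m).ne'
  have hs : √(2 * (lam ^ 2 + 2)) ^ 2 = 2 * (lam ^ 2 + 2) := Real.sq_sqrt (by positivity)
  have hs0 : √(2 * (lam ^ 2 + 2)) ≠ 0 := (Real.sqrt_pos.2 (by positivity)).ne'
  have hl := hlam.ne'
  have hS : B.Sig lam m t = B.Delta₁ t + 2 * (m : ℝ) ^ 2 / lam ^ 2 := rfl
  have hl2 : lam ^ 2 + 2 ≠ 0 := by positivity
  simp only [EvenVariables.gaugeInvariant, standardVariables, Delta₂]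
  have h2 : lam / √(2 * (lam ^ 2 + 2)) * B.Sig lam m t *
      -(Q t * (2 * B.q₁ t ^ 2 * (lam / √(2 * (lam ^ 2 + 2)) * B.Sig lam m t) / B.Omega lam m t))
      = -(Q t * (B.q₁ t ^ 2 * (lam ^ 2 / (lam ^ 2 + 2)) * B.Sig lam m t ^ 2) / B.Omega lam m t) := by
    field_simp
    rw [hs]
  rw [h2]
  field_simp
  rw [Omega, hS]
  field_simp
  ring

include hI

theorem IsVacuum.smooth_Ups₁ : ContDiffOn ℝ ∞ (B.Ups₁ lam m) I :=
  ((hB.smooth_q₁.mul hB.smooth_q₂).div (hB.smooth_Omega lam m)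
    fun t ht => (hB.Omega_pos ht lam m).ne').deriv_of_isOpen hI (by exact_mod_cast le_top)

theorem IsVacuum.smooth_Ups₂ : ContDiffOn ℝ ∞ (B.Ups₂ lam m) I :=
  (((hB.smooth_q₁.pow 2).mul (hB.smooth_Sig lam m)).div (hB.smooth_Omega lam m)
    fun t ht => (hB.Omega_pos ht lam m).ne').deriv_of_isOpen hI (by exact_mod_cast le_top)

theorem IsVacuum.smooth_Ups₃ : ContDiffOn ℝ ∞ (B.Ups₃ lam m) I :=
  ((hB.smooth_q₁.pow 2).mul ((hB.smooth_Sig lam m).deriv_of_isOpen hI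
    (by exact_mod_cast le_top))).div (hB.smooth_Omega lam m)
    fun t ht => (hB.Omega_pos ht lam m).ne'

theorem IsVacuum.smooth_standardVariables {Q : ℝ → ℝ} (hQ : ContDiffOn ℝ ∞ Q I) :
    (standardVariables B lam m Q).IsRegular I := by
  have hO : ∀ t ∈ I, B.Omega lam m t ≠ 0 := fun t ht => (hB.Omega_pos ht lam m).ne'
  have h₁ := hB.smooth_q₁
  have h₂ := hB.smooth_q₂
  have hΩ := hB.smooth_Omega lam m
  have hD := hB.smooth_Delta₁
  have hSig := hB.smooth_Sig lam m
  have hU₁ := hB.smooth_Ups₁ hI lam m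
  have hU₂ := hB.smooth_Ups₂ hI lam m
  have hU₃ := hB.smooth_Ups₃ hI lam m
  have hN := hB.smooth_N
  have hπ := hB.smooth_π₂
  have hd := h₁.deriv_of_isOpen (m := ∞) hI (by exact_mod_cast le_top)
  have hle : (2 : WithTop ℕ∞) ≤ ∞ := WithTop.coe_le_coe.2 le_top
  refine ⟨ContDiffOn.of_le (n := ∞) ?_ hle, ContDiffOn.of_le (n := ∞) ?_ hle,
    ContDiffOn.of_le (n := ∞) ?_ hle, ContDiffOn.of_le (n := ∞) ?_ hle,
    ContDiffOn.of_le (n := ∞) ?_ hle, ContDiffOn.of_le (n := ∞) ?_ hle,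
    ContDiffOn.of_le (n := ∞) ?_ hle⟩
  · exact (hQ.mul ((h₁.mul h₂).div hΩ hO)).neg
  · exact (hQ.mul (((contDiffOn_const.mul (h₁.pow 2)).mul (contDiffOn_const.mul hSig)).div hΩ hO)).neg
  · exact hQ.mul ((h₂.mul ((h₁.mul hD).add h₂)).div hΩ hO)
  · exact (hQ.mul (((contDiffOn_const.mul h₁).mul h₂).div hΩ hO)).neg
  · have e₁ := ((contDiffOn_const (c := 4 * (lam ^ 2 - 1))).mul h₁).div (hπ.pow 2)
      fun t ht => pow_ne_zero 2 (hB.π₂_ne_zero ht)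
    have e₂ := (((contDiffOn_const (c := 1 / (lam ^ 2 + 2))).mul
      (e₁.add ((contDiffOn_const (c := 3)).mul h₂))).div hΩ hO).neg
    have e₃ := ((contDiffOn_const (c := 2)).div hd fun t ht => hB.deriv_q₁_ne_zero ht).mul
      (hU₁.add ((contDiffOn_const (c := lam ^ 2 / (lam ^ 2 + 2))).mul hU₂))
    exact (hQ.mul ((hN.div_const 2).mul (e₂.add e₃))).neg
  · exact (hQ.mul (contDiffOn_const.mul (hU₂.add hU₃))).neg
  · exact (hQ.mul ((contDiffOn_const.mul (hU₂.add hU₃)).add (contDiffOn_const.mul hU₁))).neg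

/-- All three Υ acquire the common factor N H₁ q₁q₂/Ω; the rest depends on λ², h and u. -/
theorem IsVacuum.Ups₁_eq {t : ℝ} (ht : t ∈ I) : B.Ups₁ lam m t =
    B.N t * (B.H₁ t * (B.q₁ t * B.q₂ t / B.Omega lam m t * (2 - 2 * B.ratio t
      - scaledOmega' (lam ^ 2) (B.ratio t) (B.scaledSig lam m t) / B.scaledOmega lam m t))) := by
  have h := ((hB.hasProperDeriv_q₁.div hB.hasProperDeriv_q₂ fun t ht => (hB.q₂_pos t ht).ne').div
    (hB.hasProperDeriv_scaledOmega hI lam m) fun t ht => (hB.scaledOmega_pos ht lam m).ne') t ht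
  have h' := h.congr_of_eventuallyEq (f₁ := fun s => B.q₁ s * B.q₂ s / B.Omega lam m s)
    (eventually_of_mem (hI.mem_nhds ht) fun s hs => by
      have h1 := (hB.q₂_pos s hs).ne'
      simp only [hB.Omega_eq hs]
      field_simp)
  rw [Ups₁, h'.deriv]
  have h1 := (hB.q₂_pos t ht).ne'
  have h2 := (hB.scaledOmega_pos ht lam m).ne'
  beta_reduce
  rw [hB.Omega_eq ht, hB.H₂_eq ht]
  field_simp

theorem IsVacuum.Ups₂_eq {t : ℝ} (ht : t ∈ I) : B.Ups₂ lam m t =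
    B.N t * (B.H₁ t * (B.q₁ t * B.q₂ t / B.Omega lam m t
      * (scaledSig' (B.ratio t) (B.scaledSig lam m t) + B.scaledSig lam m t * (2 - 2 * B.ratio t
      - scaledOmega' (lam ^ 2) (B.ratio t) (B.scaledSig lam m t) / B.scaledOmega lam m t)))) := by
  have h := (((hB.hasProperDeriv_q₁.div hB.hasProperDeriv_q₂ fun t ht => (hB.q₂_pos t ht).ne').mul
    (hB.hasProperDeriv_scaledSig hI lam m)).div
    (hB.hasProperDeriv_scaledOmega hI lam m) fun t ht => (hB.scaledOmega_pos ht lam m).ne') t ht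
  have h' := h.congr_of_eventuallyEq (f₁ := fun s => B.q₁ s ^ 2 * B.Sig lam m s / B.Omega lam m s)
    (eventually_of_mem (hI.mem_nhds ht) fun s hs => by
      have h1 := (hB.q₂_pos s hs).ne'
      have h2 := (hB.q₁_pos s hs).ne'
      simp only [hB.Omega_eq hs, hB.Sig_eq hs]
      field_simp)
  rw [Ups₂, h'.deriv]
  have h1 := (hB.q₂_pos t ht).ne'
  have h2 := (hB.scaledOmega_pos ht lam m).ne'
  beta_reduce
  rw [hB.Omega_eq ht, hB.H₂_eq ht]
  field_simp
  ring

theorem IsVacuum.Ups₃_eq {t : ℝ} (ht : t ∈ I) : B.Ups₃ lam m t =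
    B.N t * (B.H₁ t * (B.q₁ t * B.q₂ t / B.Omega lam m t
      * (scaledSig' (B.ratio t) (B.scaledSig lam m t)
        - B.scaledSig lam m t * (2 - 2 * B.ratio t)))) := by
  have h := ((hB.hasProperDeriv_q₂.mul (hB.hasProperDeriv_scaledSig hI lam m)).div
    hB.hasProperDeriv_q₁ fun t ht => (hB.q₁_pos t ht).ne') t ht
  have h' := h.congr_of_eventuallyEq (f₁ := B.Sig lam m)
    (eventually_of_mem (hI.mem_nhds ht) fun s hs => hB.Sig_eq hs lam m)
  rw [Ups₃, h'.deriv]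
  have h1 := (hB.q₁_pos t ht).ne'
  have h2 := (hB.Omega_pos ht lam m).ne'
  beta_reduce
  rw [hB.H₂_eq ht]
  field_simp
  ring

end Background

end BianchiIII

end

noncomputable section

namespace BianchiIII

open scoped ContDiff
open Filter

/-! ### The field equations in the standard gauge -/

/-- The lapse amplitude of the standard gauge. -/
def lapseAmp (l h u k p : ℝ) : ℝ :=
  k * (-((l - 1) * (1 + 2 * h) + 3) / (l + 2) + (1 + l / (l + 2) * u) * (1 + h))
    - (1 + l / (l + 2) * u) * p

/-- The scaled base shift amplitude of the standard gauge. -/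
def shiftAmp (l h u k p : ℝ) : ℝ :=
  (-(scaledSig' h u * k + 2 * h * u * k - u * p) - (l + 2 + l * u) * (1 + 2 * h) * k / 2)
    / ((l + 2) * (1 + 2 * h))

/-- The fiber shift amplitude in terms of the lapse and base shift amplitudes. -/
def fiberShiftAmp (h₁ q₁ lam m A F : ℝ) : ℝ := -(2 * m / lam ^ 2) * (h₁ * q₁ * A) - m * F

/-- The scaled variable `Q q₂ / Ω`. -/
def scaledQ (B : Background) (lam : ℝ) (m : ℤ) (Q : ℝ → ℝ) (t : ℝ) : ℝ :=
  Q t * B.q₂ t / B.Omega lam m t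

/-- The scaled variable `P √q₂ / (q₁ H₁)`. -/
def scaledP (B : Background) (P : ℝ → ℝ) (t : ℝ) : ℝ :=
  P t * √(B.q₂ t) / (B.q₁ t * B.H₁ t)

/-- The scaled derivative of `scaledQ`. -/
def scaledQ' (l h u om k p : ℝ) : ℝ := -2 * h * k + p - k * scaledOmega' l h u / om

namespace Background

variable {B : Background} {I : Set ℝ} (hB : B.IsVacuum I) (hI : IsOpen I) {lam : ℝ}
  (hlam : 0 < lam) {m : ℤ} {Q P : ℝ → ℝ} (hQP : B.GaugeInvariantEvolution lam m I Q P)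

/-- The time component of the gauge vector field of the standard gauge. -/
def gaugeTime (B : Background) (lam : ℝ) (m : ℤ) (Q : ℝ → ℝ) (t : ℝ) : ℝ :=
  -(1 / 2) * ((1 + lam ^ 2 / (lam ^ 2 + 2) * B.scaledSig lam m t) * scaledQ B lam m Q t / B.H₁ t)

/-- The base component of the gauge vector field of the standard gauge. -/
def gaugeBase (B : Background) (lam : ℝ) (m : ℤ) (Q : ℝ → ℝ) (t : ℝ) : ℝ :=
  -(1 / (lam ^ 2 + 2)) * (B.scaledSig lam m t * scaledQ B lam m Q t)

/-- The fiber component of the gauge vector field of the standard gauge. -/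
def gaugeFiber (B : Background) (lam : ℝ) (m : ℤ) (Q : ℝ → ℝ) (t : ℝ) : ℝ :=
  -m * (B.q₁ t / B.q₂ t * (scaledQ B lam m Q t
    * (2 / lam ^ 2 + 1 / (lam ^ 2 + 2) * B.scaledSig lam m t)))

include hB hI hQP

theorem IsVacuum.hasProperDeriv_gaugeTime : HasProperDeriv B I (B.gaugeTime lam m Q) fun t =>
    -(1 / 2) * (lam ^ 2 / (lam ^ 2 + 2) * scaledSig' (B.ratio t) (B.scaledSig lam m t)
        * scaledQ B lam m Q t
      + (1 + lam ^ 2 / (lam ^ 2 + 2) * B.scaledSig lam m t)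
        * (scaledQ' (lam ^ 2) (B.ratio t) (B.scaledSig lam m t) (B.scaledOmega lam m t)
            (scaledQ B lam m Q t) (scaledP B P t)
          + scaledQ B lam m Q t * (1 - B.ratio t))) := by
  have hk : HasProperDeriv B I (scaledQ B lam m Q) _ := hB.hasProperDeriv_scaledQ hI hQP
  have hu := hB.hasProperDeriv_scaledSig hI lam m
  refine ((((hasProperDeriv_const 1).add (hu.const_mul (lam ^ 2 / (lam ^ 2 + 2)))).mul hk |>.div
    hB.hasProperDeriv_H₁ fun t => hB.H₁_ne_zero).const_mul (-(1 / 2))).congr fun t ht => ?_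
  have h1 := hB.H₁_ne_zero ht
  rw [hB.H₂_eq ht]
  simp only [scaledQ', scaledQ, scaledP]
  generalize Q t * B.q₂ t / B.Omega lam m t = k
  generalize P t * √(B.q₂ t) / (B.q₁ t * B.H₁ t) = p
  field_simp
  ring

theorem IsVacuum.hasProperDeriv_gaugeBase : HasProperDeriv B I (B.gaugeBase lam m Q) fun t =>
    -(B.H₁ t / (lam ^ 2 + 2)) * (scaledSig' (B.ratio t) (B.scaledSig lam m t)
        * scaledQ B lam m Q t + B.scaledSig lam m t
        * scaledQ' (lam ^ 2) (B.ratio t) (B.scaledSig lam m t) (B.scaledOmega lam m t)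
            (scaledQ B lam m Q t) (scaledP B P t)) := by
  have hk : HasProperDeriv B I (scaledQ B lam m Q) _ := hB.hasProperDeriv_scaledQ hI hQP
  have hu := hB.hasProperDeriv_scaledSig hI lam m
  refine ((hu.mul hk).const_mul (-(1 / (lam ^ 2 + 2)))).congr fun t ht => ?_
  simp only [scaledQ', scaledQ, scaledP]
  ring

theorem IsVacuum.hasProperDeriv_gaugeFiber : HasProperDeriv B I (B.gaugeFiber lam m Q) fun t =>
    -m * (B.H₁ t * (B.q₁ t / B.q₂ t)) * ((2 - 2 * B.ratio t) * scaledQ B lam m Q t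
        * (2 / lam ^ 2 + 1 / (lam ^ 2 + 2) * B.scaledSig lam m t)
      + scaledQ' (lam ^ 2) (B.ratio t) (B.scaledSig lam m t) (B.scaledOmega lam m t)
            (scaledQ B lam m Q t) (scaledP B P t)
        * (2 / lam ^ 2 + 1 / (lam ^ 2 + 2) * B.scaledSig lam m t)
      + scaledQ B lam m Q t
        * (1 / (lam ^ 2 + 2) * scaledSig' (B.ratio t) (B.scaledSig lam m t))) := by
  have hk : HasProperDeriv B I (scaledQ B lam m Q) _ := hB.hasProperDeriv_scaledQ hI hQP
  have hu := hB.hasProperDeriv_scaledSig hI lam m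
  refine (((hB.hasProperDeriv_q₁.div hB.hasProperDeriv_q₂ fun t ht => (hB.q₂_pos t ht).ne').mul
    (hk.mul ((hasProperDeriv_const (2 / lam ^ 2)).add (hu.const_mul (1 / (lam ^ 2 + 2)))))).const_mul
      (-m : ℝ)).congr fun t ht => ?_
  have h1 := (hB.q₂_pos t ht).ne'
  rw [hB.H₂_eq ht]
  simp only [scaledQ', scaledQ, scaledP]
  generalize Q t * B.q₂ t / B.Omega lam m t = k
  generalize P t * √(B.q₂ t) / (B.q₁ t * B.H₁ t) = p
  generalize 2 / lam ^ 2 = c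
  generalize 1 / (lam ^ 2 + 2) = d
  field_simp
  ring

include hlam

/-- The gauge vector is forced by γ¹, γ² and γ⁴; subtracting its derivative from lapse and shift
leaves A, F, S, and Z = Q/q₂ = k·Ω/q₂². The terms with the derivative of k that come from the Υ are
absorbed by the gauge vector; that is the role of the Υ in the lapse and shift. -/
theorem IsVacuum.amp_standardVariables {α' β' ζ' : ℝ → ℝ}
    (hα : HasProperDeriv B I (B.gaugeTime lam m Q) α')
    (hβ : HasProperDeriv B I (B.gaugeBase lam m Q) β')
    (hζ : HasProperDeriv B I (B.gaugeFiber lam m Q) ζ') {t : ℝ} (ht : t ∈ I) :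
    (standardVariables B lam m Q).amp B lam t =
      gaugeAmp (B.H₁ t) (B.H₂ t) (B.q₁ t) (B.q₂ t) lam m
        (lapseAmp (lam ^ 2) (B.ratio t) (B.scaledSig lam m t) (scaledQ B lam m Q t) (scaledP B P t))
        (shiftAmp (lam ^ 2) (B.ratio t) (B.scaledSig lam m t) (scaledQ B lam m Q t) (scaledP B P t)
          / B.H₁ t)
        (fiberShiftAmp (B.H₁ t) (B.q₁ t) lam m
          (lapseAmp (lam ^ 2) (B.ratio t) (B.scaledSig lam m t) (scaledQ B lam m Q t)
            (scaledP B P t))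
          (shiftAmp (lam ^ 2) (B.ratio t) (B.scaledSig lam m t) (scaledQ B lam m Q t)
            (scaledP B P t) / B.H₁ t))
        (scaledQ B lam m Q t * B.scaledOmega lam m t)
        (B.gaugeTime lam m Q t) (B.gaugeBase lam m Q t) (B.gaugeFiber lam m Q t)
        (α' t) (β' t) (ζ' t) := by
  have hα' := HasProperDeriv.unique hB hI hα (hB.hasProperDeriv_gaugeTime hI hQP)
    (fun _ _ => rfl) ht
  have hβ' := HasProperDeriv.unique hB hI hβ (hB.hasProperDeriv_gaugeBase hI hQP)
    (fun _ _ => rfl) ht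
  have hζ' := HasProperDeriv.unique hB hI hζ (hB.hasProperDeriv_gaugeFiber hI hQP)
    (fun _ _ => rfl) ht
  have hl2 : lam ^ 2 + 2 ≠ 0 := by positivity
  have hl := hlam.ne'
  have hN := (hB.N_pos t ht).ne'
  have hH := hB.H₁_ne_zero ht
  have hg := (hB.ratio_pos ht).ne'
  have hq₂ := (hB.q₂_pos t ht).ne'
  have hq₁ := (hB.q₁_pos t ht).ne'
  have hom := (hB.scaledOmega_pos ht lam m).ne'
  have hu := hB.scaledSig_eq ht lam m
  have hQ : Q t = scaledQ B lam m Q t * (B.q₂ t * B.scaledOmega lam m t) := by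
    rw [scaledQ, hB.Omega_eq ht]
    field_simp
  -- The normalization of Ŝ_ab and the factor in Δ₂ carry complementary square roots.
  have hroot : 1 / lam * √(2 / (lam ^ 2 + 2)) * B.Delta₂ lam m t
      = B.q₂ t * B.scaledSig lam m t / B.q₁ t / (lam ^ 2 + 2) := by
    rw [Delta₂, hB.Sig_eq ht, Real.sqrt_div' _ (by positivity), Real.sqrt_mul' _ (by positivity)]
    have h1 : √(lam ^ 2 + 2) ^ 2 = lam ^ 2 + 2 := Real.sq_sqrt (by positivity)
    have h2 : √(lam ^ 2 + 2) ≠ 0 := (Real.sqrt_pos.2 (by positivity)).ne'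
    have h3 : √(2 : ℝ) ≠ 0 := (Real.sqrt_pos.2 (by positivity)).ne'
    field_simp
    rw [h1]
  -- π₂²q₂ = 4q₁²H₁² combined with the constraint q₁H₁²(1 + 2h) = 1.
  have hπ : B.q₁ t / B.π₂ t ^ 2 = B.q₂ t * (1 + 2 * B.ratio t) / 4 := by
    rw [hB.π₂_scaled ht, div_pow, Real.sq_sqrt (hB.q₂_pos t ht).le, hB.q₁_eq ht]
    field_simp
    norm_num
  have hπ' : 4 * (lam ^ 2 - 1) * B.q₁ t / B.π₂ t ^ 2
      = (lam ^ 2 - 1) * (B.q₂ t * (1 + 2 * B.ratio t)) := by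
    rw [mul_div_assoc, hπ]
    ring
  have hd := hB.deriv_q₁ ht
  have hU₁ := hB.Ups₁_eq hI lam m ht
  have hU₂ := hB.Ups₂_eq hI lam m ht
  have hU₃ := hB.Ups₃_eq hI lam m ht
  have hΩ := hB.Omega_eq ht lam m
  have hom' := hB.scaledOmega_eq ht lam m
  have hD := hB.Delta₁_eq ht
  have hq := hB.q₁_eq ht
  have hH₂ := hB.H₂_eq ht
  rw [hΩ] at hU₁ hU₂ hU₃
  simp only [EvenVariables.amp, gaugeAmp, standardVariables, hU₁, hU₂, hU₃, hd, hΩ, hD, hπ', hα',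
    hβ', hζ', hH₂, scaledQ', gaugeTime, gaugeBase, gaugeFiber, lapseAmp, shiftAmp, fiberShiftAmp]
  rw [hQ]
  generalize scaledQ B lam m Q t = k
  generalize scaledP B P t = p
  generalize hdu : scaledSig' (B.ratio t) (B.scaledSig lam m t) = du at *
  generalize scaledOmega' (lam ^ 2) (B.ratio t) (B.scaledSig lam m t) = dom at *
  generalize B.scaledOmega lam m t = om at *
  generalize B.scaledSig lam m t = u at *
  generalize B.ratio t = h at *
  generalize B.q₂ t = q₂ at *
  generalize B.H₁ t = H at *
  generalize B.N t = N at *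
  generalize hm₀ : (m : ℝ) = μ at *
  ext i
  fin_cases i
  · simp
    field_simp
    ring
  · simp
    rw [hq]
    obtain ⟨g, rfl⟩ : ∃ g, h = (g - 1) / 2 := ⟨1 + 2 * h, by ring⟩
    rw [show 1 + 2 * ((g - 1) / 2) = g by ring] at *
    field_simp
    ring
  · simp
    rw [hq, ← hdu, scaledSig']
    obtain ⟨g, rfl⟩ : ∃ g, h = (g - 1) / 2 := ⟨1 + 2 * h, by ring⟩
    rw [show 1 + 2 * ((g - 1) / 2) = g by ring] at *
    field_simp
    ring
  · simp
    field_simp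
    ring
  · refine Eq.trans (b := -(k * (q₂ * om) * (2 * B.q₁ t ^ 2
      * (1 / lam * √(2 / (lam ^ 2 + 2)) * B.Delta₂ lam m t) / (q₂ ^ 2 * om)))) ?_ ?_
    · simp
      ring
    · rw [hroot]
      simp
      field_simp
  -- The definition of u solved for m²q₁; it removes the mode number from the fiber-fiber component.
  · have hm : μ ^ 2 * B.q₁ t = lam ^ 2 * q₂ * (u - h) / 2 := by
      rw [hu]
      field_simp
      ring
    simp
    field_simp
    rw [hom']
    field_simp
    linear_combination k * (2 * lam ^ 2 * u + 4 * lam ^ 2 + 8) * hm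
  · simp
    field_simp
    ring

end Background

end BianchiIII

end

/-! ### Constraints and evolution of the lapse and shift amplitudes. -/

noncomputable section

namespace BianchiIII

open scoped ContDiff
open Filter

theorem HasProperDeriv.congr_fun {B : Background} {I : Set ℝ} {f f' g g' : ℝ → ℝ}
    (hf : HasProperDeriv B I f f') (h : ∀ t, g t = f t) (h' : ∀ t ∈ I, f' t = g' t) :
    HasProperDeriv B I g g' :=
  (funext h : g = f) ▸ hf.congr h'

/-- The momentum constraint in scaled variables. -/
theorem momentum_constraint {l h u k p om : ℝ} (hl : l + 2 ≠ 0) (hh : 1 + 2 * h ≠ 0)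
    (hom : om = 1 + 2 * u + l / (l + 2) * u ^ 2) :
    (-2 * h * k + p) * om = -(1 + u) * lapseAmp l h u k p
      + 2 * (1 + 2 * h) * shiftAmp l h u k p + (1 - h) * (k * om) := by
  obtain ⟨g, rfl⟩ : ∃ g, h = (g - 1) / 2 := ⟨1 + 2 * h, by ring⟩
  rw [lapseAmp, shiftAmp, scaledSig', hom]
  rw [show 1 + 2 * ((g - 1) / 2) = g by ring] at *
  field_simp
  ring

/-- The Hamiltonian constraint in scaled variables. -/
theorem hamiltonian_constraint {l h u k p om : ℝ} (hl : l + 2 ≠ 0) (hh : 1 + 2 * h ≠ 0)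
    (hom : om = 1 + 2 * u + l / (l + 2) * u ^ 2) :
    lapseAmp l h u k p * (1 + 2 * (u - h) / (1 + 2 * h)) + l * (1 + u) * shiftAmp l h u k p
      + (-2 * h * k + p) * om / (1 + 2 * h) + l / 2 * (k * om) = 0 := by
  obtain ⟨g, rfl⟩ : ∃ g, h = (g - 1) / 2 := ⟨1 + 2 * h, by ring⟩
  rw [lapseAmp, shiftAmp, scaledSig', hom]
  rw [show 1 + 2 * ((g - 1) / 2) = g by ring] at *
  field_simp
  ring

/-- The derivative of `lapseAmp`. -/
def lapseAmp' (l h u k p dh du dk dp : ℝ) : ℝ :=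
  dk * (-((l - 1) * (1 + 2 * h) + 3) / (l + 2) + (1 + l / (l + 2) * u) * (1 + h))
      + k * (-((l - 1) * (2 * dh)) / (l + 2) + l / (l + 2) * du * (1 + h) + (1 + l / (l + 2) * u) * dh)
      - (l / (l + 2) * du * p + (1 + l / (l + 2) * u) * dp)

/-- The derivative of `shiftAmp`. -/
def shiftAmp' (l h u k p dh du dk dp : ℝ) : ℝ :=
  (-((-dh * (1 + 2 * h) - h * (2 * dh) + 2 * (du - dh) * (1 - h) - 2 * (u - h) * dh) * k
        + scaledSig' h u * dk + 2 * (dh * u * k + h * du * k + h * u * dk) - (du * p + u * dp))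
      - (l * du * (1 + 2 * h) * k + (l + 2 + l * u) * (2 * dh) * k
        + (l + 2 + l * u) * (1 + 2 * h) * dk) / 2
    - shiftAmp l h u k p * ((l + 2) * (2 * dh))) / ((l + 2) * (1 + 2 * h))

/-- The Hamilton equations in scaled variables imply the evolution equations of the lapse and shift
amplitudes. -/
theorem lapse_shift_evolution {l h u k p om : ℝ} (hl : l + 2 ≠ 0) (hh : 1 + 2 * h ≠ 0) (hom₀ : om ≠ 0)
    (hom : om = 1 + 2 * u + l / (l + 2) * u ^ 2) :
    2 * shiftAmp' l h u k p (ratio' h) (scaledSig' h u) (scaledQ' l h u om k p)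
        (Background.momentum' l h u om k p) + 2 * shiftAmp l h u k p
      = lapseAmp l h u k p - k * om ∧
    lapseAmp' l h u k p (ratio' h) (scaledSig' h u) (scaledQ' l h u om k p)
        (Background.momentum' l h u om k p)
      = -(-2 * h * k * om + om * p) - 2 * (1 + u + h) * lapseAmp l h u k p
        - l * (1 + 2 * h) * (2 + u - h) * shiftAmp l h u k p :=
  shift_equation (dh := ratio' h) (du := scaledSig' h u) (dom := scaledOmega' l h u)
    (a := alphaNum l h u) (da := alphaNum' l h u (ratio' h) (scaledSig' h u))
    (V := scaledPotential l h u) hl hh hom₀ hom rfl rfl rfl rfl rfl rfl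
    (by rw [scaledQ']; field_simp)
    (by rw [Background.momentum']; field_simp)
    rfl rfl (by rw [shiftAmp, div_mul_cancel₀ _ (mul_ne_zero hl hh)])
    (by rw [shiftAmp', div_mul_cancel₀ _ (mul_ne_zero hl hh), sub_add_cancel])

namespace Background

variable {B : Background} {I : Set ℝ} (hB : B.IsVacuum I) (hI : IsOpen I) {lam : ℝ}
  (hlam : 0 < lam) {m : ℤ} {Q P : ℝ → ℝ} (hQP : B.GaugeInvariantEvolution lam m I Q P)
include hB hI hQP

theorem IsVacuum.hasProperDeriv_lapseAmp : HasProperDeriv B I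
    (fun t => lapseAmp (lam ^ 2) (B.ratio t) (B.scaledSig lam m t) (scaledQ B lam m Q t)
      (scaledP B P t))
    fun t => B.H₁ t * lapseAmp' (lam ^ 2) (B.ratio t) (B.scaledSig lam m t) (scaledQ B lam m Q t)
      (scaledP B P t) (ratio' (B.ratio t)) (scaledSig' (B.ratio t) (B.scaledSig lam m t))
      (scaledQ' (lam ^ 2) (B.ratio t) (B.scaledSig lam m t) (B.scaledOmega lam m t)
        (scaledQ B lam m Q t) (scaledP B P t))
      (momentum' (lam ^ 2) (B.ratio t) (B.scaledSig lam m t) (B.scaledOmega lam m t)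
        (scaledQ B lam m Q t) (scaledP B P t)) := by
  have hk : HasProperDeriv B I (scaledQ B lam m Q) _ := hB.hasProperDeriv_scaledQ hI hQP
  have hp : HasProperDeriv B I (scaledP B P) _ := hB.hasProperDeriv_scaledP hI hQP
  have hu := hB.hasProperDeriv_scaledSig hI lam m
  have hr := hB.hasProperDeriv_ratio
  have hw := (hasProperDeriv_const (B := B) (I := I) 1).add
    (hu.const_mul (lam ^ 2 / (lam ^ 2 + 2)))
  refine ((hk.mul ((((((hasProperDeriv_const 1).add (hr.const_mul 2)).const_mul (lam ^ 2 - 1)).add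
    (hasProperDeriv_const 3)).const_mul (-(1 / (lam ^ 2 + 2)))).add
    (hw.mul ((hasProperDeriv_const 1).add hr)))).sub (hw.mul hp)).congr_fun
    (fun t => ?_) fun t _ => ?_
  · rw [lapseAmp]; ring
  · simp only [lapseAmp', scaledQ', scaledQ, scaledP]; ring

theorem IsVacuum.hasProperDeriv_shiftAmp : HasProperDeriv B I
    (fun t => shiftAmp (lam ^ 2) (B.ratio t) (B.scaledSig lam m t) (scaledQ B lam m Q t)
      (scaledP B P t))
    fun t => B.H₁ t * shiftAmp' (lam ^ 2) (B.ratio t) (B.scaledSig lam m t) (scaledQ B lam m Q t)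
      (scaledP B P t) (ratio' (B.ratio t)) (scaledSig' (B.ratio t) (B.scaledSig lam m t))
      (scaledQ' (lam ^ 2) (B.ratio t) (B.scaledSig lam m t) (B.scaledOmega lam m t)
        (scaledQ B lam m Q t) (scaledP B P t))
      (momentum' (lam ^ 2) (B.ratio t) (B.scaledSig lam m t) (B.scaledOmega lam m t)
        (scaledQ B lam m Q t) (scaledP B P t)) := by
  have hk : HasProperDeriv B I (scaledQ B lam m Q) _ := hB.hasProperDeriv_scaledQ hI hQP
  have hp : HasProperDeriv B I (scaledP B P) _ := hB.hasProperDeriv_scaledP hI hQP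
  have hu := hB.hasProperDeriv_scaledSig hI lam m
  have hr := hB.hasProperDeriv_ratio
  have hg := (hasProperDeriv_const (B := B) (I := I) 1).add (hr.const_mul 2)
  have hl : lam ^ 2 + 2 ≠ 0 := by positivity
  have hs := (((hr.const_mul (-1)).mul hg).add (((hu.sub hr).const_mul 2).mul
    ((hasProperDeriv_const (B := B) (I := I) 1).sub hr)))
  refine ((((((hs.mul hk).add (((hr.const_mul 2).mul hu).mul hk)).sub (hu.mul hp)).const_mul
    (-1)).sub (((((hasProperDeriv_const (B := B) (I := I) (lam ^ 2 + 2)).add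
      (hu.const_mul (lam ^ 2))).mul hg).mul hk).const_mul (1 / 2))).div
    (hg.const_mul (lam ^ 2 + 2)) fun t ht => mul_ne_zero hl (hB.ratio_pos ht).ne').congr_fun
    (fun t => ?_) fun t ht => ?_
  · rw [shiftAmp, scaledSig']; ring
  · have hg0 := (hB.ratio_pos ht).ne'
    rw [div_eq_iff (pow_ne_zero 2 (mul_ne_zero hl hg0))]
    simp only [shiftAmp', shiftAmp, scaledQ', scaledQ, scaledP]
    generalize Q t * B.q₂ t / B.Omega lam m t = k
    generalize P t * √(B.q₂ t) / (B.q₁ t * B.H₁ t) = p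
    generalize momentum' _ _ _ _ _ _ = dp
    generalize scaledOmega' (lam ^ 2) (B.ratio t) (B.scaledSig lam m t) = x
    simp only [scaledSig']
    generalize ratio' (B.ratio t) = dh
    generalize B.ratio t = h at *
    generalize B.scaledSig lam m t = u at *
    generalize B.scaledOmega lam m t = om at *
    obtain ⟨g, rfl⟩ : ∃ g, h = (g - 1) / 2 := ⟨1 + 2 * h, by ring⟩
    rw [show 1 + 2 * ((g - 1) / 2) = g by ring] at *
    generalize lam ^ 2 = l at *
    field_simp
    ring

end Background

end BianchiIII

end

noncomputable section

namespace BianchiIII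

open scoped ContDiff
open Filter

/-! ### The linearized field equations in terms of the amplitudes -/

/-- The time-base constraint restored to dimensional form, with S eliminated by the time-fiber
constraint and m² expressed through u - h. -/
theorem momentum_constraint_unscaled {H h q₁ q₂ lam m u A F z z' : ℝ} (hq₂ : q₂ ≠ 0) (hlam : lam ≠ 0)
    (hfr : q₁ * (H ^ 2 * (1 + 2 * h)) = 1) (hm : m ^ 2 * q₁ = lam ^ 2 * q₂ * (u - h) / 2)
    (hz : z' = -(1 + u) * A + 2 * (1 + 2 * h) * F + (1 - h) * z) :
    H * z' = -1 * (H + h * H) * A + (2 / q₁ + m ^ 2 / q₂) * (F / H)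
      + m / q₂ * (-(2 * m / lam ^ 2) * (H * q₁ * A) - m * (F / H)) + (H - h * H) * z := by
  have hc : H ^ 2 * (1 + 2 * h) ≠ 0 := right_ne_zero_of_mul (hfr ▸ one_ne_zero)
  have hH : H ≠ 0 := fun h0 => hc (by simp [h0])
  have hg : 1 + 2 * h ≠ 0 := right_ne_zero_of_mul hc
  have hq : q₁ = 1 / (H ^ 2 * (1 + 2 * h)) := eq_one_div_of_mul_eq_one_left hfr
  have e1 : 2 / q₁ * (F / H) = H * (2 * (1 + 2 * h) * F) := by
    rw [hq]
    field_simp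
  have e2 : m / q₂ * (-(2 * m / lam ^ 2) * (H * q₁ * A)) = -(H * ((u - h) * A)) := by
    have : m / q₂ * (-(2 * m / lam ^ 2) * (H * q₁ * A))
      = -(2 / (q₂ * lam ^ 2) * (H * A)) * (m ^ 2 * q₁) := by ring
    rw [this, hm]
    field_simp
  linear_combination H * hz - e1 - e2

/-- The constraints and evolution equations in scaled variables imply the field equations. -/
theorem einsteinAmp_eq_zero_of_scaled {H h q₁ q₂ lam m u A A' F F' z z' S' Z'' : ℝ} (hq₂ : q₂ ≠ 0)
    (hlam : lam ≠ 0) (hfr : q₁ * (H ^ 2 * (1 + 2 * h)) = 1)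
    (hm : m ^ 2 * q₁ = lam ^ 2 * q₂ * (u - h) / 2)
    (hz : z' = -(1 + u) * A + 2 * (1 + 2 * h) * F + (1 - h) * z)
    (ham : A * (1 + 2 * (u - h) / (1 + 2 * h)) + lam ^ 2 * (1 + u) * F + z' / (1 + 2 * h)
      + lam ^ 2 / 2 * z = 0)
    (hF' : 2 * (F' + F * (1 - h)) = A - 2 * h * F - z)
    (hA' : A' = -z' - 2 * (1 + u + h) * A - lam ^ 2 * (1 + 2 * h) * (2 + u - h) * F)
    (hS' : S' = -(2 * m / lam ^ 2) * ((H * (h * H - H) * q₁ + H * (2 * H * q₁)) * A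
      + H * q₁ * (H * A')) - m * (F' + F * (1 - h)))
    (hZ'' : Z'' = -(H * (h * H - H) - h * H * (2 * H + h * H)) * A - (H + h * H) * (H * A')
      + (-4 * H / q₁ - 2 * (h * H) * m ^ 2 / q₂) * (F / H)
      + (2 / q₁ + m ^ 2 / q₂) * (F' + F * (1 - h))
      - 2 * (h * H) * m / q₂ * (-(2 * m / lam ^ 2) * (H * q₁ * A) - m * (F / H)) + m / q₂ * S'
      + (H * (h * H - H) + h * H * (2 * H + h * H)) * z + (H - h * H) * (H * z')) :
    einsteinAmp H (h * H) q₁ q₂ lam m A (H * A') (F / H) (F' + F * (1 - h))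
      (-(2 * m / lam ^ 2) * (H * q₁ * A) - m * (F / H)) S' z (H * z') Z'' = 0 := by
  have hc : H ^ 2 * (1 + 2 * h) ≠ 0 := right_ne_zero_of_mul (hfr ▸ one_ne_zero)
  have hH : H ≠ 0 := fun h0 => hc (by simp [h0])
  have hg : 1 + 2 * h ≠ 0 := right_ne_zero_of_mul hc
  have hq : q₁ = 1 / (H ^ 2 * (1 + 2 * h)) := eq_one_div_of_mul_eq_one_left hfr
  have hS : 2 * H * q₁ * m / q₂ * (-(2 * m / lam ^ 2) * (H * q₁ * A) - m * (F / H))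
      = -(2 * (u - h) / (1 + 2 * h) * A + lam ^ 2 * (u - h) * F) := by
    have : 2 * H * q₁ * m / q₂ * (-(2 * m / lam ^ 2) * (H * q₁ * A) - m * (F / H))
      = -(2 / q₂ * H * (2 / lam ^ 2 * (H * q₁ * A) + F / H)) * (m ^ 2 * q₁) := by ring
    rw [this, hm, hq]
    field_simp
  refine einsteinAmp_eq_zero hq₂ hlam ?_ ?_ rfl ?_ ?_ ?_ hS' hZ''
  · linear_combination hfr
  · rw [momentum_constraint_unscaled hq₂ hlam hfr hm hz]
    ring
  · rw [hF']
    field_simp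
  · rw [hA']
    have e : H * q₁ * (H * z') = z' / (1 + 2 * h) := by rw [hq]; field_simp
    have e' : H * q₁ * (H * (-z' - 2 * (1 + u + h) * A - lam ^ 2 * (1 + 2 * h) * (2 + u - h) * F))
        = -(z' / (1 + 2 * h)) - 2 * (1 + u + h) / (1 + 2 * h) * A - lam ^ 2 * (2 + u - h) * F := by
      rw [hq]; field_simp
    have e'' : 2 * H * lam ^ 2 * (F / H) = 2 * lam ^ 2 * F := by field_simp
    have e₃ : 2 * (1 + u + h) / (1 + 2 * h) = 2 + 2 * (u - h) / (1 + 2 * h) := by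
      field_simp
      ring
    rw [e', e, hS, e'', e₃]
    ring
  · have e : q₁ * H * (H * z') = z' / (1 + 2 * h) := by rw [hq]; field_simp
    have e' : lam ^ 2 * (H + h * H) * (F / H) = lam ^ 2 * (1 + h) * F := by field_simp
    have e'' : 2 * H * m * q₁ / q₂ = 2 * H * q₁ * m / q₂ := by ring
    rw [e, e', e'', hS, ← ham]
    ring

variable {B : Background} {I : Set ℝ} (hB : B.IsVacuum I) (hI : IsOpen I) {lam : ℝ}
  (hlam : 0 < lam) {m : ℤ} {Q P : ℝ → ℝ} (hQP : B.GaugeInvariantEvolution lam m I Q P)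

/-- The proper time derivative of a time-dependent vector. -/
def properDerivVec (B : Background) (v : ℝ → Fin 7 → ℝ) (t : ℝ) (i : Fin 7) : ℝ :=
  properDeriv B (fun s => v s i) t

include hB

theorem EvenVariables.IsRegular.contDiffOn_amp {v : EvenVariables} (hv : v.IsRegular I) (lam : ℝ)
    (i : Fin 7) : ContDiffOn ℝ (2 : ℕ∞) (fun t => v.amp B lam t i) I := by
  obtain ⟨h₁, h₂, h₃, h₄, h₀, h₅, h₆⟩ := hv
  have hN : ContDiffOn ℝ (2 : ℕ∞) B.N I := hB.smooth_N.of_le (WithTop.coe_le_coe.2 le_top)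
  have hN0 : ∀ t ∈ I, B.N t ≠ 0 := fun t ht => (hB.N_pos t ht).ne'
  -- For λ = 0 the base shift amplitude is a division by zero, hence the constant 0.
  rcases eq_or_ne lam 0 with rfl | hl
  · fin_cases i
    · exact (contDiffOn_const.mul h₀).div hN hN0
    · simpa [amp] using contDiffOn_const
    · exact h₆.div hN hN0
    · exact h₁
    · exact contDiffOn_const.mul h₂
    · exact h₃
    · exact h₄.div_const _
  · fin_cases i
    · exact (contDiffOn_const.mul h₀).div hN hN0
    · exact h₅.div (contDiffOn_const.mul hN) fun t ht => mul_ne_zero hl (hN0 t ht)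
    · exact h₆.div hN hN0
    · exact h₁
    · exact contDiffOn_const.mul h₂
    · exact h₃
    · exact h₄.div_const _

include hI

theorem hasProperDeriv_properDerivVec {v : ℝ → Fin 7 → ℝ}
    (hv : ∀ i, ContDiffOn ℝ (2 : ℕ∞) (fun t => v t i) I) :
    (∀ i, HasProperDeriv B I (fun t => v t i) (fun t => properDerivVec B v t i)) ∧
    ∀ i, HasProperDeriv B I (fun t => properDerivVec B v t i)
      (fun t => properDerivVec B (properDerivVec B v) t i) :=
  ⟨fun i => hasProperDeriv_properDeriv hB (differentiableAt_of_contDiffOn hI (hv i) (by decide)),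
    fun i => hasProperDeriv_properDeriv hB (differentiableAt_of_contDiffOn hI
      (contDiffOn_properDeriv hB hI (k := 1) (hv i) (by norm_num)) (by decide))⟩

include hlam hQP

/-- The gauge part drops out by `ricciAmp_eq_einsteinAmp`. The scaled constraints and evolution
equations then supply the hypotheses of `einsteinAmp_eq_zero_of_scaled`. -/
theorem ricciAmp_standardVariables {v' v'' : ℝ → Fin 7 → ℝ}
    (hv : ∀ i, HasProperDeriv B I (fun t => (standardVariables B lam m Q).amp B lam t i)
      (fun t => v' t i))
    (hv' : ∀ i, HasProperDeriv B I (fun t => v' t i) (fun t => v'' t i)) {t : ℝ} (ht : t ∈ I) :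
    ricciAmp (B.H₁ t) (B.H₂ t) (B.q₁ t) (B.q₂ t) lam m
      ((standardVariables B lam m Q).amp B lam t) (v' t) (v'' t) = 0 := by
  have hl2 : lam ^ 2 + 2 ≠ 0 := by positivity
  have hsm := (hB.smooth_solution hI hQP).1
  have hsP := (hB.smooth_solution hI hQP).2
  have hk : ContDiffOn ℝ ∞ (scaledQ B lam m Q) I := (hsm.mul hB.smooth_q₂).div
    (hB.smooth_Omega lam m) fun t ht => (hB.Omega_pos ht lam m).ne'
  have hp : ContDiffOn ℝ ∞ (scaledP B P) I := (hsP.mul hB.smooth_sqrt).div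
    (hB.smooth_q₁.mul hB.smooth_H₁) fun t ht =>
      mul_ne_zero (hB.q₁_pos t ht).ne' (hB.H₁_ne_zero ht)
  have hsu := hB.smooth_scaledSig lam m
  have hα : ContDiffOn ℝ ∞ (B.gaugeTime lam m Q) I := contDiffOn_const.mul
    (((contDiffOn_const.add (contDiffOn_const.mul hsu)).mul hk).div hB.smooth_H₁
      fun t ht => hB.H₁_ne_zero ht)
  have hβ : ContDiffOn ℝ ∞ (B.gaugeBase lam m Q) I := contDiffOn_const.mul (hsu.mul hk)
  have hζ : ContDiffOn ℝ ∞ (B.gaugeFiber lam m Q) I := contDiffOn_const.mul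
    ((hB.smooth_q₁.div hB.smooth_q₂ fun t ht => (hB.q₂_pos t ht).ne').mul
      (hk.mul (contDiffOn_const.add (contDiffOn_const.mul hsu))))
  have hd : ∀ {f : ℝ → ℝ}, ContDiffOn ℝ ∞ f I → HasProperDeriv B I f (properDeriv B f) :=
    fun hf => hasProperDeriv_properDeriv hB (differentiableAt_of_contDiffOn hI hf (by decide))
  have hd' : ∀ {f : ℝ → ℝ}, ContDiffOn ℝ ∞ f I → ContDiffOn ℝ ∞ (properDeriv B f) I :=
    fun hf => contDiffOn_properDeriv hB hI (k := ⊤) (n := ⊤) hf le_top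
  have hA := hB.hasProperDeriv_lapseAmp hI hQP
  have hF := (hB.hasProperDeriv_shiftAmp hI hQP).div hB.hasProperDeriv_H₁
    fun t ht => hB.H₁_ne_zero ht
  have hS := (((hB.hasProperDeriv_H₁.mul hB.hasProperDeriv_q₁).mul hA).const_mul
    (-(2 * (m : ℝ) / lam ^ 2))).sub (hF.const_mul (m : ℝ))
  have hZ : HasProperDeriv B I (fun t => scaledQ B lam m Q t * B.scaledOmega lam m t)
      fun t => B.H₁ t * ((-2 * B.ratio t * scaledQ B lam m Q t + scaledP B P t)
        * B.scaledOmega lam m t) :=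
    ((hB.hasProperDeriv_scaledQ hI hQP).mul (hB.hasProperDeriv_scaledOmega hI lam m)).congr
      fun t ht => by
        have hom := (hB.scaledOmega_pos ht lam m).ne'
        simp only [scaledQ, scaledP]
        generalize Q t * B.q₂ t / B.Omega lam m t = k
        generalize P t * √(B.q₂ t) / (B.q₁ t * B.H₁ t) = p
        field_simp
        ring
  have hZ' : ContDiffOn ℝ ∞ (fun t => B.H₁ t * ((-2 * B.ratio t * scaledQ B lam m Q t
      + scaledP B P t) * B.scaledOmega lam m t)) I :=
    hB.smooth_H₁.mul ((((contDiffOn_const.mul hB.smooth_ratio).mul hk).add hp).mul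
      (hB.smooth_scaledOmega lam m))
  rw [ricciAmp_eq_einsteinAmp hB hI lam m hv hv' hA hF hS hZ (hd hZ') (hd hα) (hd (hd' hα)) (hd hβ)
    (hd (hd' hβ)) (hd hζ) (hd (hd' hζ))
    (fun t ht => hB.amp_standardVariables hI hlam hQP (hd hα) (hd hβ) (hd hζ) ht) ht]
  have hμ : ∀ t ∈ I, (m : ℝ) ^ 2 * B.q₁ t
      = lam ^ 2 * B.q₂ t * (B.scaledSig lam m t - B.ratio t) / 2 := fun t ht => by
    have h2 := (hB.q₂_pos t ht).ne'
    rw [hB.scaledSig_eq ht]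
    field_simp
    ring
  have hE := fun t (ht : t ∈ I) => momentum_constraint (k := scaledQ B lam m Q t)
    (p := scaledP B P t) hl2 (hB.ratio_pos ht).ne' (hB.scaledOmega_eq ht lam m)
  have hH := fun t (ht : t ∈ I) => hamiltonian_constraint (k := scaledQ B lam m Q t)
    (p := scaledP B P t) hl2 (hB.ratio_pos ht).ne' (hB.scaledOmega_eq ht lam m)
  have hev := lapse_shift_evolution (k := scaledQ B lam m Q t) (p := scaledP B P t) hl2
    (hB.ratio_pos ht).ne' (hB.scaledOmega_pos ht lam m).ne' (hB.scaledOmega_eq ht lam m)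
  have hD := (((((hB.hasProperDeriv_H₁.add hB.hasProperDeriv_H₂).const_mul (-1)).mul hA).add
    ((((hasProperDeriv_const 2).div hB.hasProperDeriv_q₁ fun t ht => (hB.q₁_pos t ht).ne').add
      ((hasProperDeriv_const ((m : ℝ) ^ 2)).div hB.hasProperDeriv_q₂
        fun t ht => (hB.q₂_pos t ht).ne')).mul hF)).add
    (((hasProperDeriv_const (m : ℝ)).div hB.hasProperDeriv_q₂
        fun t ht => (hB.q₂_pos t ht).ne').mul hS)).add
    ((hB.hasProperDeriv_H₁.sub hB.hasProperDeriv_H₂).mul hZ)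
  have hDe := fun t (ht : t ∈ I) => momentum_constraint_unscaled (hB.q₂_pos t ht).ne' hlam.ne'
    (hB.friedmann' ht) (hμ t ht) (hE t ht)
  -- The momentum constraint expresses Z' on all of I, so Z'' is obtained by differentiating it, not
  -- from a further field equation.
  have hZ'' := HasProperDeriv.unique hB hI (hd hZ') hD
    (fun t ht => (hDe t ht).trans (by rw [hB.H₂_eq ht])) ht
  have hH₁ := hB.H₁_ne_zero ht
  have hq₁ := (hB.q₁_pos t ht).ne'
  have hq₂ := (hB.q₂_pos t ht).ne'
  have hF' : ∀ x y : ℝ, (B.H₁ t * x * B.H₁ t - y * (B.H₁ t * (B.ratio t * B.H₁ t - B.H₁ t)))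
      / B.H₁ t ^ 2 = x + y * (1 - B.ratio t) := fun x y => by
    field_simp
    ring
  simp only [hB.H₂_eq ht, hF'] at hZ'' ⊢
  refine einsteinAmp_eq_zero_of_scaled hq₂ hlam.ne' (hB.friedmann' ht) (hμ t ht) (hE t ht) (hH t ht)
    ?_ ?_ rfl ?_
  · linear_combination hev.1
  · rw [hev.2]
    ring
  · rw [hZ'']
    field_simp
    ring

end BianchiIII

end

noncomputable section

namespace BianchiIII

/-! ### The standard gauge solves the linearized field equations -/

variable {B : Background} {I : Set ℝ} (hB : B.IsVacuum I) (hI : IsOpen I) {lam : ℝ}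
  (hlam : 0 < lam) {m : ℤ} {M : ModeFunctions} (hM : M.IsMode lam m)

theorem comp₂_zero (j : Fin 7 → ℝ) (a b : Fin 4) : comp₂ 0 j a b = 0 := by
  fin_cases a <;> fin_cases b <;> simp [comp₂]

include hB hI hlam hM

theorem linRicci_of_isRegular {v : EvenVariables} (hv : v.IsRegular I) {h : Tensor2}
    (hh : ∀ p ∈ domain I, ∀ a b, h a b p = v.perturbation B M lam a b p) {p : Pt}
    (hp : p ∈ domain I) (a b : Fin 4) :
    linRicci B.metric h a b p = (1 / 2) * (B.N (p 0) ^ (timeWeight a + timeWeight b)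
      * M.fiberFn (fiberWeight a + fiberWeight b) (p 3)
      * comp₂ (ricciAmp (B.H₁ (p 0)) (B.H₂ (p 0)) (B.q₁ (p 0)) (B.q₂ (p 0)) lam m
          (v.amp B lam (p 0)) (properDerivVec B (v.amp B lam) (p 0))
          (properDerivVec B (properDerivVec B (v.amp B lam)) (p 0))) (M.jetAt lam p) a b) := by
  obtain ⟨h1, h2⟩ := hasProperDeriv_properDerivVec hB hI (hv.contDiffOn_amp hB lam)
  exact linRicci_of_hasAmplitudes hB hI hM hM.isHypEigen
    (fun p hp a b => (hh p hp a b).trans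
      (v.hasAmplitudes_perturbation hB hlam hM.isHypEigen p hp a b))
    (fun t ht i => h1 i t ht) (fun t ht i => h2 i t ht) hp a b

theorem isEvenVacuumPerturbation_of_eq_Geven {Q P : ℝ → ℝ}
    (hQP : B.GaugeInvariantEvolution lam m I Q P) {G : Tensor2}
    (hG : ∀ p ∈ domain I, ∀ a b, G a b p = Geven B M lam m a b p) :
    IsEvenVacuumPerturbation B M lam m I Q (fun a b p => Q (p 0) * G a b p) := by
  have hreg := hB.smooth_standardVariables hI lam m (hB.smooth_solution hI hQP).1
  have heq : ∀ p ∈ domain I, ∀ a b, Q (p 0) * G a b p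
      = (standardVariables B lam m Q).perturbation B M lam a b p := fun p hp a b => by
    rw [hG p hp, mul_Geven_eq_perturbation]
  refine ⟨⟨_, hreg, heq, fun t ht => (hB.gaugeInvariant_standardVariables m hlam Q ht).symm⟩,
    fun p hp a b => ?_⟩
  obtain ⟨h1, h2⟩ := hasProperDeriv_properDerivVec hB hI (hreg.contDiffOn_amp hB lam)
  rw [linRicci_of_isRegular hB hI hlam hM hreg heq hp,
    ricciAmp_standardVariables hB hI hlam hQP h1 h2 hp.1, comp₂_zero]
  ring

end BianchiIII

end

noncomputable section

namespace BianchiIII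

open Filter Topology
open MeasureTheory (norm_integral_le_of_norm_le ae_restrict_mem)

/-! ### Global solutions of linear differential equations -/

section LinearODE

variable {E : Type*} [NormedAddCommGroup E] [NormedSpace ℝ E]

/-- The terms of the Picard series of the equation `X' = L X` with initial value `x₀` at `t₀`. -/
def picardTerm (L : ℝ → E →L[ℝ] E) (t₀ : ℝ) (x₀ : E) : ℕ → ℝ → E
  | 0, _ => x₀
  | n + 1, t => ∫ s in t₀..t, L s (picardTerm L t₀ x₀ n s)

/-- Each integration of |τ - t₀|ⁿ supplies the factor 1/(n + 1) that builds up the factorial. -/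
theorem norm_picardTerm_le {L : ℝ → E →L[ℝ] E} {t₀ : ℝ} (x₀ : E) {s : Set ℝ} (hs : s.OrdConnected) (ht₀ : t₀ ∈ s) {K : ℝ} (hK0 : 0 ≤ K)
    (hK : ∀ t ∈ s, ‖L t‖ ≤ K) (n : ℕ) {t : ℝ} (ht : t ∈ s) :
    ‖picardTerm L t₀ x₀ n t‖ ≤ (K * |t - t₀|) ^ n / n.factorial * ‖x₀‖ := by
  induction n generalizing t with
  | zero => simp [picardTerm]
  | succ n ih =>
    calc ‖picardTerm L t₀ x₀ (n + 1) t‖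
        ≤ ∫ τ in Set.uIoc t₀ t, K ^ (n + 1) * |τ - t₀| ^ n / n.factorial * ‖x₀‖ := by
          rw [picardTerm, intervalIntegral.norm_intervalIntegral_eq]
          refine norm_integral_le_of_norm_le (Continuous.integrableOn_uIoc (by fun_prop)) ?_
          refine (ae_restrict_mem measurableSet_uIoc).mono fun τ hτ => ?_
          have hτ' : τ ∈ s := hs.uIcc_subset ht₀ ht (Set.uIoc_subset_uIcc hτ)
          refine ((L τ).le_opNorm _).trans ((mul_le_mul (hK τ hτ') (ih hτ') (norm_nonneg _)
            hK0).trans_eq ?_)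
          rw [mul_pow, pow_succ]
          ring
      _ ≤ (K * |t - t₀|) ^ (n + 1) / (n + 1).factorial * ‖x₀‖ := by
          refine le_of_abs_le ?_
          rw [← intervalIntegral.abs_intervalIntegral_eq, intervalIntegral.integral_mul_const,
            intervalIntegral.integral_div, intervalIntegral.integral_const_mul, abs_mul, abs_div,
            abs_mul, intervalIntegral.abs_intervalIntegral_eq, integral_pow_abs_sub_uIoc, abs_div,
            abs_pow, abs_pow, abs_norm, abs_of_nonneg hK0, abs_abs, mul_div, div_div, ← abs_mul,
            ← Nat.cast_succ, ← Nat.cast_mul, ← Nat.factorial_succ, Nat.abs_cast, ← mul_pow]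

variable [CompleteSpace E] {I : Set ℝ} (hI : IsOpen I) (hc : I.OrdConnected) {L : ℝ → E →L[ℝ] E}
  (hL : ContinuousOn L I) {t₀ : ℝ} (ht₀ : t₀ ∈ I) (x₀ : E)
include hI hc hL ht₀

theorem hasDerivAt_picardTerm_succ {n : ℕ} (hn : ContinuousOn (picardTerm L t₀ x₀ n) I) {t : ℝ}
    (ht : t ∈ I) :
    HasDerivAt (picardTerm L t₀ x₀ (n + 1)) (L t (picardTerm L t₀ x₀ n t)) t := by
  have h : ContinuousOn (fun s => L s (picardTerm L t₀ x₀ n s)) I := hL.clm_apply hn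
  exact intervalIntegral.integral_hasDerivAt_right
    (h.mono (hc.uIcc_subset ht₀ ht)).intervalIntegrable
    (h.stronglyMeasurableAtFilter hI t ht) (h.continuousAt (hI.mem_nhds ht))

theorem continuousOn_picardTerm (n : ℕ) : ContinuousOn (picardTerm L t₀ x₀ n) I := by
  induction n with
  | zero => exact continuousOn_const
  | succ n ih =>
    exact fun t ht => (hasDerivAt_picardTerm_succ hI hc hL ht₀ x₀ ih
      ht).continuousAt.continuousWithinAt

/-- For a linear equation the factorial beats the bound of L on any compact interval, so the series
solves the equation on all of I and not only near t₀. -/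
theorem exists_solution_linear_ode :
    ∃ X : ℝ → E, X t₀ = x₀ ∧ ∀ t ∈ I, HasDerivAt X (L t (X t)) t := by
  -- One function serves all times; convergence and termwise differentiation are checked on a window
  -- (c, d) that contains t and t₀ and whose closure lies in I.
  refine ⟨fun t => ∑' n, picardTerm L t₀ x₀ n t, ?_, fun t ht => ?_⟩
  · beta_reduce
    rw [tsum_eq_single 0 fun n hn => ?_]
    · rfl
    · obtain ⟨n, rfl⟩ := Nat.exists_eq_succ_of_ne_zero hn
      simp [picardTerm]
  obtain ⟨c, hc1, hc2⟩ : ∃ c < min t t₀, c ∈ I := by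
    have h : min t t₀ ∈ I := by rcases min_choice t t₀ with h | h <;> rwa [h]
    obtain ⟨ε, hε, hb⟩ := Metric.isOpen_iff.1 hI _ h
    exact ⟨min t t₀ - ε / 2, by linarith, hb (by simp [abs_of_pos, hε])⟩
  obtain ⟨d, hd1, hd2⟩ : ∃ d > max t t₀, d ∈ I := by
    have h : max t t₀ ∈ I := by rcases max_choice t t₀ with h | h <;> rwa [h]
    obtain ⟨ε, hε, hb⟩ := Metric.isOpen_iff.1 hI _ h
    exact ⟨max t t₀ + ε / 2, by linarith, hb (by simp [abs_of_pos, hε])⟩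
  have hsub : Set.Icc c d ⊆ I := hc.out hc2 hd2
  obtain ⟨K, hK⟩ := isCompact_Icc.exists_bound_of_continuousOn (hL.mono hsub)
  have htJ : t ∈ Set.Ioo c d :=
    ⟨hc1.trans_le (min_le_left _ _), (le_max_left _ _).trans_lt hd1⟩
  have ht₀J : t₀ ∈ Set.Ioo c d :=
    ⟨hc1.trans_le (min_le_right _ _), (le_max_right _ _).trans_lt hd1⟩
  have hK0 : 0 ≤ K := (norm_nonneg _).trans (hK t (Set.Ioo_subset_Icc_self htJ))
  have hbound : ∀ n, ∀ y ∈ Set.Ioo c d,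
      ‖picardTerm L t₀ x₀ n y‖ ≤ (K * (d - c)) ^ n / n.factorial * ‖x₀‖ := fun n y hy => by
    refine (norm_picardTerm_le x₀ Set.ordConnected_Icc (Set.Ioo_subset_Icc_self ht₀J) hK0 hK n
      (Set.Ioo_subset_Icc_self hy)).trans ?_
    have : |y - t₀| ≤ d - c :=
      abs_sub_le_iff.2 ⟨by linarith [hy.2, ht₀J.1], by linarith [hy.1, ht₀J.2]⟩
    gcongr
  have hsum : Summable fun n : ℕ => (K * (d - c)) ^ n / n.factorial * ‖x₀‖ :=
    (Real.summable_pow_div_factorial _).mul_right _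
  have hX : ∀ y ∈ Set.Ioo c d, Summable fun n => picardTerm L t₀ x₀ n y :=
    fun y hy => .of_norm_bounded hsum fun n => hbound n y hy
  have hcont := continuousOn_picardTerm hI hc hL ht₀ x₀
  -- Index shift: the zeroth term is constant, and the derivative of term n + 1 is L applied to term
  -- n.
  let g' : ℕ → ℝ → E := fun n y => Nat.casesOn n 0 fun k => L y (picardTerm L t₀ x₀ k y)
  let u : ℕ → ℝ := fun n =>
    Nat.casesOn n 0 fun k => K * ((K * (d - c)) ^ k / k.factorial * ‖x₀‖)
  have hu : Summable u := (summable_nat_add_iff 1).1 (hsum.mul_left K)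
  have hg₁ : ∀ n, ∀ y ∈ Set.Ioo c d, HasDerivAt (picardTerm L t₀ x₀ n) (g' n y) y := by
    intro n y hy
    cases n with
    | zero => exact hasDerivAt_const y x₀
    | succ k =>
      exact hasDerivAt_picardTerm_succ hI hc hL ht₀ x₀ (hcont k) (hsub (Set.Ioo_subset_Icc_self hy))
  have hg₂ : ∀ n, ∀ y ∈ Set.Ioo c d, ‖g' n y‖ ≤ u n := by
    intro n y hy
    cases n with
    | zero => simp [g', u]
    | succ k =>
      exact ((L y).le_opNorm _).trans (mul_le_mul (hK y (Set.Ioo_subset_Icc_self hy))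
        (hbound k y hy) (norm_nonneg _) hK0)
  have key := hasDerivAt_tsum_of_isPreconnected hu isOpen_Ioo isPreconnected_Ioo hg₁ hg₂ htJ
    (hX t htJ) htJ
  have hg : Summable fun n => g' n t := (summable_nat_add_iff 1).1 ((hX t htJ).map (L t)
    (L t).continuous)
  refine key.congr_deriv ?_
  rw [hg.tsum_eq_zero_add, (L t).map_tsum (hX t htJ)]
  exact zero_add _

end LinearODE

theorem Background.IsVacuum.exists_solution {B : Background} {I : Set ℝ} (hB : B.IsVacuum I)
    (hI : IsOpen I) (hc : I.OrdConnected) (lam : ℝ) (m : ℤ) {t₀ : ℝ} (ht₀ : t₀ ∈ I) (Q₀ P₀ : ℝ) :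
    ∃ Q P, B.GaugeInvariantEvolution lam m I Q P ∧ Q t₀ = Q₀ ∧ P t₀ = P₀ := by
  let L : ℝ → ℝ × ℝ →L[ℝ] ℝ × ℝ := fun t =>
    (B.kineticCoeff lam m t • ContinuousLinearMap.snd ℝ ℝ ℝ).prod
      (B.forceCoeff lam m t • ContinuousLinearMap.fst ℝ ℝ ℝ)
  have hL : ContinuousOn L I := by
    have h1 := (hB.smooth_kineticCoeff lam m).continuousOn
    have h2 := (hB.smooth_forceCoeff hI lam m).continuousOn
    exact (ContinuousLinearMap.prodₗᵢ ℝ (E := ℝ × ℝ) (F := ℝ) (G := ℝ)).continuous.comp_continuousOn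
      ((h1.smul continuousOn_const).prodMk (h2.smul continuousOn_const))
  obtain ⟨X, hX0, hX⟩ := exists_solution_linear_ode hI hc hL ht₀ (Q₀, P₀)
  refine ⟨fun t => (X t).1, fun t => (X t).2, ?_, by simp [hX0], by simp [hX0]⟩
  rw [gaugeInvariantEvolution_iff]
  exact fun t ht => ⟨(hX t ht).fst, (hX t ht).snd⟩

end BianchiIII

end

noncomputable section

namespace BianchiIII

/-! ### Independence of the mode tensors -/

section

variable {lam : ℝ} (hlam : 0 < lam) {m : ℤ} {M : ModeFunctions} (hM : M.IsMode lam m)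
include hM

theorem ModeFunctions.IsMode.exists_fiberFn_ne_zero (k : ℕ) : ∃ z, M.fiberFn k z ≠ 0 := by
  by_contra! h
  rcases Nat.even_or_odd k with hk | hk
  · simp only [fiberFn, hk, if_true] at h
    simpa [h] using hM.norm_c
  · simp only [fiberFn, Nat.not_even_iff_odd.2 hk, if_false] at h
    simpa [h] using hM.norm_cbar

include hlam

/-- Ŝ, its gradient and its trace-free Hessian are each nonzero somewhere, and so are c and c̄.
Different amplitudes may be tested at different points, because they do not depend on the point. -/
theorem ModeFunctions.IsMode.amplitudes_eq_zero {w : Fin 7 → ℝ}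
    (h : ∀ p : Pt, 0 < p 2 → ∀ a b,
      M.fiberFn (fiberWeight a + fiberWeight b) (p 3) * comp₂ w (M.jetAt lam p) a b = 0) :
    w = 0 := by
  have hne : ∃ r ∈ halfPlane, M.S r ≠ 0 := hM.nonzero
  have key : ∀ r ∈ halfPlane, ∀ a b, comp₂ w (fun k => jet lam M.S k r) a b = 0 := by
    intro r hr a b
    obtain ⟨z, hz⟩ := hM.exists_fiberFn_ne_zero (fiberWeight a + fiberWeight b)
    exact (mul_eq_zero.1 (h ![0, r.1, r.2, z] hr a b)).resolve_left hz
  obtain ⟨r₁, hr₁, h₁⟩ := hM.isHypEigen.exists_gradient_ne_zero hlam hne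
  obtain ⟨r₂, hr₂, h₂⟩ := hM.isHypEigen.exists_hessian_ne_zero hlam hne
  obtain ⟨r₀, hr₀, h₀⟩ := hne
  have key₀ := key r₀ hr₀
  have key₁ := key r₁ hr₁
  have key₂ := key r₂ hr₂
  have e₀ : w 0 = 0 := by simpa [comp₂, jet, h₀] using key₀ 0 0
  have e₁ : w 1 = 0 := by
    rcases h₁ with h₁ | h₁
    · simpa [comp₂, jet, h₁] using key₁ 0 1
    · simpa [comp₂, jet, h₁] using key₁ 0 2
  have e₂ : w 2 = 0 := by simpa [comp₂, jet, h₀] using key₀ 0 3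
  -- Adding the two diagonal base components cancels the trace-free part.
  have e₃ : w 3 = 0 := by
    have a := key₀ 1 1
    have b := key₀ 2 2
    simp [comp₂, jet] at a b
    exact (mul_eq_zero.1 (show w 3 * M.S r₀ = 0 by linarith)).resolve_right h₀
  have e₄ : w 4 = 0 := by
    rcases h₂ with h₂ | h₂
    · simpa [comp₂, jet, h₂, e₃] using key₂ 2 2
    · simpa [comp₂, jet, h₂] using key₂ 1 2
  have e₅ : w 5 = 0 := by simpa [comp₂, jet, h₀] using key₀ 3 3
  have e₆ : w 6 = 0 := by
    rcases h₁ with h₁ | h₁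
    · simpa [comp₂, jet, h₁] using key₁ 1 3
    · simpa [comp₂, jet, h₁] using key₁ 2 3
  ext i
  fin_cases i <;> assumption

end

theorem comp₂_sub (v w j : Fin 7 → ℝ) (a b : Fin 4) :
    comp₂ (v - w) j a b = comp₂ v j a b - comp₂ w j a b := by
  fin_cases a <;> fin_cases b <;> simp [comp₂] <;> ring

theorem comp₂_smul (r : ℝ) (v j : Fin 7 → ℝ) (a b : Fin 4) :
    comp₂ (r • v) j a b = r * comp₂ v j a b := by
  fin_cases a <;> fin_cases b <;> simp [comp₂] <;> ring

theorem ricciAmp_sub (h₁ h₂ q₁ q₂ lam m : ℝ) (v v' v'' w w' w'' : Fin 7 → ℝ) :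
    ricciAmp h₁ h₂ q₁ q₂ lam m (v - w) (v' - w') (v'' - w'')
      = ricciAmp h₁ h₂ q₁ q₂ lam m v v' v'' - ricciAmp h₁ h₂ q₁ q₂ lam m w w' w'' := by
  ext i
  fin_cases i <;> simp [ricciAmp] <;> ring

section

variable {B : Background} {I : Set ℝ} (hB : B.IsVacuum I) {lam : ℝ} (hlam : 0 < lam) {m : ℤ}
  {M : ModeFunctions} (hM : M.IsMode lam m)
include hB hlam hM

/-- The amplitudes of a tensor are unique. -/
theorem HasAmplitudes.unique {h k : Tensor2} {v w : ℝ → Fin 7 → ℝ}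
    (hv : HasAmplitudes B M lam I h v) (hw : HasAmplitudes B M lam I k w) {t : ℝ} (ht : t ∈ I)
    {r s : ℝ} (hhk : ∀ p ∈ domain I, p 0 = t → ∀ a b, r * h a b p = s * k a b p) :
    r • v t = s • w t := by
  rw [← sub_eq_zero]
  refine hM.amplitudes_eq_zero hlam fun p hp a b => ?_
  -- Only the time coordinate is replaced; the jets and the fiber functions ignore it.
  have hq : (![t, p 1, p 2, p 3] : Pt) ∈ domain I := ⟨ht, hp⟩
  have e := hhk _ hq rfl a b
  rw [hv _ hq, hw _ hq] at e
  have hj : M.jetAt lam (![t, p 1, p 2, p 3] : Pt) = M.jetAt lam p := rfl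
  have hN : B.N t ^ (timeWeight a + timeWeight b) ≠ 0 := pow_ne_zero _ (hB.N_pos t ht).ne'
  refine mul_left_cancel₀ hN ?_
  rw [comp₂_sub, comp₂_smul, comp₂_smul, mul_zero, ← hj]
  change r * (B.N t ^ (timeWeight a + timeWeight b)
    * M.fiberFn (fiberWeight a + fiberWeight b) (p 3) * comp₂ (v t) _ a b)
    = s * (B.N t ^ (timeWeight a + timeWeight b)
    * M.fiberFn (fiberWeight a + fiberWeight b) (p 3) * comp₂ (w t) _ a b) at e
  linear_combination e

end

end BianchiIII

end

noncomputable section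

namespace BianchiIII

open scoped ContDiff
open Filter

/-! ### Perturbations without gauge-invariant part -/

/-- The base component of the gauge vector field of a perturbation with amplitudes `u`. -/
def baseOf (B : Background) (u : ℝ → Fin 7 → ℝ) (t : ℝ) : ℝ := u t 4 / (2 * B.q₁ t)

/-- The time component of the gauge vector field of a perturbation with amplitudes `u`. -/
def timeOf (B : Background) (lam : ℝ) (u : ℝ → Fin 7 → ℝ) (t : ℝ) : ℝ :=
  (u t 3 / B.q₁ t + lam ^ 2 * baseOf B u t) / (2 * B.H₁ t)

/-- The fiber component of the gauge vector field of a perturbation with amplitudes `u`. -/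
def fiberOf (B : Background) (m : ℝ) (u : ℝ → Fin 7 → ℝ) (t : ℝ) : ℝ :=
  (u t 6 + m * (B.q₁ t * baseOf B u t)) / B.q₂ t

/-- The gauge-invariant variable in terms of the amplitudes. -/
def invariantOf (B : Background) (lam : ℝ) (m : ℤ) (t : ℝ) (u : Fin 7 → ℝ) : ℝ :=
  -B.Delta₁ t * u 3 - lam ^ 2 / 2 * B.Sig lam m t * u 4 + u 5 - 2 * m * u 6

theorem EvenVariables.gaugeInvariant_eq_invariantOf (v : EvenVariables) (B : Background) {lam : ℝ}
    (hlam : 0 < lam) (m : ℤ) (t : ℝ) :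
    v.gaugeInvariant B lam m t = invariantOf B lam m t (v.amp B lam t) := by
  have hl := hlam.ne'
  have h2 : √(lam ^ 2 + 2) ≠ 0 := (Real.sqrt_pos.2 (by positivity)).ne'
  have h3 : √(2 : ℝ) ≠ 0 := (Real.sqrt_pos.2 (by positivity)).ne'
  have h4 : √(2 : ℝ) ^ 2 = 2 := Real.sq_sqrt (by positivity)
  simp only [gaugeInvariant, invariantOf, amp, Background.Delta₂]
  simp
  field_simp
  linear_combination lam ^ 2 * B.Sig lam m t * v.γ₂ t * h4

section

variable {B : Background} {I : Set ℝ} (hB : B.IsVacuum I) (hI : IsOpen I) {lam : ℝ} {m : ℤ}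
  (hlam : 0 < lam) {u : ℝ → Fin 7 → ℝ} (hu : ∀ i, ContDiffOn ℝ (2 : ℕ∞) (fun t => u t i) I)
include hB hu

theorem contDiffOn_baseOf : ContDiffOn ℝ (2 : ℕ∞) (baseOf B u) I :=
  (hu 4).div (contDiffOn_const.mul (hB.smooth_q₁.of_le (WithTop.coe_le_coe.2 le_top)))
    fun t ht => mul_ne_zero two_ne_zero (hB.q₁_pos t ht).ne'

theorem contDiffOn_timeOf (lam : ℝ) : ContDiffOn ℝ (2 : ℕ∞) (timeOf B lam u) I :=
  (((hu 3).div (hB.smooth_q₁.of_le (WithTop.coe_le_coe.2 le_top))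
    fun t ht => (hB.q₁_pos t ht).ne').add (contDiffOn_const.mul (contDiffOn_baseOf hB hu))).div
    (contDiffOn_const.mul (hB.smooth_H₁.of_le (WithTop.coe_le_coe.2 le_top)))
    fun _ ht => mul_ne_zero two_ne_zero (hB.H₁_ne_zero ht)

theorem contDiffOn_fiberOf (m : ℝ) : ContDiffOn ℝ (2 : ℕ∞) (fiberOf B m u) I :=
  ((hu 6).add (contDiffOn_const.mul ((hB.smooth_q₁.of_le (WithTop.coe_le_coe.2 le_top)).mul
    (contDiffOn_baseOf hB hu)))).div (hB.smooth_q₂.of_le (WithTop.coe_le_coe.2 le_top))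
    fun t ht => (hB.q₂_pos t ht).ne'

include hI hlam

/-- A solution of the linearized field equations whose gauge-invariant variable vanishes is a gauge
perturbation. -/
theorem eq_gauge_of_ricciAmp_eq_zero
    (hinv : ∀ t ∈ I, invariantOf B lam m t (u t) = 0)
    (hric : ∀ t ∈ I, ricciAmp (B.H₁ t) (B.H₂ t) (B.q₁ t) (B.q₂ t) lam m (u t)
      (properDerivVec B u t) (properDerivVec B (properDerivVec B u) t) = 0) {t : ℝ} (ht : t ∈ I) :
    u t 0 = -2 * properDeriv B (timeOf B lam u) t ∧
    u t 1 = B.q₁ t * properDeriv B (baseOf B u) t - timeOf B lam u t ∧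
    u t 2 = B.q₂ t * properDeriv B (fiberOf B m u) t + m * timeOf B lam u t := by
  have hα := contDiffOn_timeOf hB hu lam
  have hβ := contDiffOn_baseOf hB hu
  have hζ := contDiffOn_fiberOf hB hu (m : ℝ)
  have hle : (1 : ℕ∞) + 1 ≤ 2 := by norm_num
  have hα' := contDiffOn_properDeriv hB hI (k := 1) hα hle
  have hβ' := contDiffOn_properDeriv hB hI (k := 1) hβ hle
  have hζ' := contDiffOn_properDeriv hB hI (k := 1) hζ hle
  have hd : ∀ {f : ℝ → ℝ}, ContDiffOn ℝ (1 : ℕ∞) f I → HasProperDeriv B I f (properDeriv B f) :=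
    fun hf => hasProperDeriv_properDeriv hB (differentiableAt_of_contDiffOn hI hf (by decide))
  have hle1 : ((1 : ℕ∞) : WithTop ℕ∞) ≤ (2 : ℕ∞) := by decide
  have hu1 : ∀ i, ContDiffOn ℝ (1 : ℕ∞) (fun t => u t i) I := fun i => (hu i).of_le hle1
  obtain ⟨hv, hv'⟩ := hasProperDeriv_properDerivVec hB hI hu
  have hA : ContDiffOn ℝ (1 : ℕ∞) (fun t => u t 0 + 2 * properDeriv B (timeOf B lam u) t) I :=
    (hu1 0).add (contDiffOn_const.mul hα')
  have hF : ContDiffOn ℝ (1 : ℕ∞) (fun t => u t 1 - B.q₁ t * properDeriv B (baseOf B u) t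
      + timeOf B lam u t) I :=
    ((hu1 1).sub ((hB.smooth_q₁.of_le (WithTop.coe_le_coe.2 le_top)).mul hβ')).add (hα.of_le hle1)
  have hS : ContDiffOn ℝ (1 : ℕ∞) (fun t => u t 2 - B.q₂ t * properDeriv B (fiberOf B m u) t
      - m * timeOf B lam u t) I :=
    ((hu1 2).sub ((hB.smooth_q₂.of_le (WithTop.coe_le_coe.2 le_top)).mul hζ')).sub
      (contDiffOn_const.mul (hα.of_le hle1))
  -- The decomposition with Z = 0. Lapse and shift remainders are defined as what the gauge vector
  -- leaves over, so only the fiber-fiber component needs the vanishing of the invariant.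
  have key := ricciAmp_eq_einsteinAmp hB hI lam m hv hv' (hd hA) (hd hF) (hd hS)
    (hasProperDeriv_const 0) (hasProperDeriv_const 0) (hd (hα.of_le hle1)) (hd hα')
    (hd (hβ.of_le hle1)) (hd hβ') (hd (hζ.of_le hle1)) (hd hζ')
    (fun t ht => by
      have h1 := (hB.q₁_pos t ht).ne'
      have h2 := (hB.q₂_pos t ht).ne'
      have h3 := hB.H₁_ne_zero ht
      have h5 : u t 5 = B.Delta₁ t * u t 3 + lam ^ 2 / 2 * (B.Delta₁ t + 2 * m ^ 2 / lam ^ 2) * u t 4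
          + 2 * m * u t 6 := by
        have h := hinv t ht
        have hS : B.Sig lam m t = B.Delta₁ t + 2 * (m : ℝ) ^ 2 / lam ^ 2 := rfl
        rw [invariantOf, hS] at h
        linear_combination h
      have hl := hlam.ne'
      rw [hB.Delta₁_eq ht] at h5
      ext i
      fin_cases i <;> simp [gaugeAmp]
      · ring
      · ring
      · simp [timeOf, baseOf]
        field_simp
        ring
      · simp [baseOf]
        field_simp
      · rw [h5, hB.H₂_eq ht]
        simp [timeOf, baseOf, fiberOf]
        field_simp
        ring
      · simp [fiberOf]
        field_simp
        ring) ht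
  rw [hric t ht] at key
  obtain ⟨e1, e2, e3⟩ := eq_zero_of_constraints (hB.q₁_pos t ht) (hB.q₂_pos t ht) hlam key.symm
  exact ⟨by linarith, by linarith, by linarith⟩

end

end BianchiIII

end

noncomputable section

namespace BianchiIII

open scoped ContDiff
open Filter

/-! ### Uniqueness of the standard gauge -/

theorem invariantOf_sub (B : Background) (lam : ℝ) (m : ℤ) (t : ℝ) (v w : Fin 7 → ℝ) :
    invariantOf B lam m t (v - w) = invariantOf B lam m t v - invariantOf B lam m t w := by
  simp only [invariantOf, Pi.sub_apply]
  ring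

section

variable {B : Background} {I : Set ℝ} (hB : B.IsVacuum I) (hI : IsOpen I) {lam : ℝ}
  (hlam : 0 < lam) {m : ℤ} {M : ModeFunctions} (hM : M.IsMode lam m)

/-- The functions `u` are the amplitudes of `Q (G - G^(even))`, and this tensor solves the linearized
field equations and has no gauge-invariant part. -/
structure IsGaugeDefect (B : Background) (M : ModeFunctions) (lam : ℝ) (m : ℤ) (I : Set ℝ)
    (G : Tensor2) (Q : ℝ → ℝ) (u : ℝ → Fin 7 → ℝ) : Prop where
  contDiffOn : ∀ i, ContDiffOn ℝ (2 : ℕ∞) (fun t => u t i) I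
  hasAmplitudes : HasAmplitudes B M lam I
    (fun a b p => Q (p 0) * (G a b p - Geven B M lam m a b p)) u
  invariant : ∀ t ∈ I, invariantOf B lam m t (u t) = 0
  ricci : ∀ t ∈ I, ricciAmp (B.H₁ t) (B.H₂ t) (B.q₁ t) (B.q₂ t) lam m (u t)
    (properDerivVec B u t) (properDerivVec B (properDerivVec B u) t) = 0

include hB hlam hM

/-- Both sides are amplitudes of QR(G - G^(even)). Cross-multiplying avoids dividing by Q, which may
vanish, and needs no regularity of G. -/
theorem IsGaugeDefect.smul_eq {G : Tensor2} {Q R : ℝ → ℝ} {u v : ℝ → Fin 7 → ℝ}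
    (hu : IsGaugeDefect B M lam m I G Q u) (hv : IsGaugeDefect B M lam m I G R v) {t : ℝ}
    (ht : t ∈ I) : R t • u t = Q t • v t :=
  hu.hasAmplitudes.unique hB hlam hM hv.hasAmplitudes ht fun p _ hp a b => by
    simp only [hp]
    ring

include hI

/-- Independence of the mode tensors turns the vanishing of a tensor field into the vanishing of its
amplitudes. -/
theorem ricciAmp_eq_zero_of_linRicci {v : EvenVariables} (hv : v.IsRegular I) {h : Tensor2}
    (hh : ∀ p ∈ domain I, ∀ a b, h a b p = v.perturbation B M lam a b p)
    (hric : ∀ p ∈ domain I, ∀ a b, linRicci B.metric h a b p = 0) {t : ℝ} (ht : t ∈ I) :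
    ricciAmp (B.H₁ t) (B.H₂ t) (B.q₁ t) (B.q₂ t) lam m (v.amp B lam t)
      (properDerivVec B (v.amp B lam) t) (properDerivVec B (properDerivVec B (v.amp B lam)) t)
      = 0 := by
  refine hM.amplitudes_eq_zero hlam fun p hp a b => ?_
  have hq : (![t, p 1, p 2, p 3] : Pt) ∈ domain I := ⟨ht, hp⟩
  have e := hric _ hq a b
  rw [linRicci_of_isRegular hB hI hlam hM hv hh hq] at e
  have hN : B.N t ^ (timeWeight a + timeWeight b) ≠ 0 := pow_ne_zero _ (hB.N_pos t ht).ne'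
  rw [mul_assoc, mul_eq_zero, mul_eq_zero] at e
  exact (e.resolve_left (by norm_num)).resolve_left hN

theorem exists_isGaugeDefect {G : Tensor2} {Q P : ℝ → ℝ}
    (hQP : B.GaugeInvariantEvolution lam m I Q P)
    (hG : IsEvenVacuumPerturbation B M lam m I Q (fun a b p => Q (p 0) * G a b p)) :
    ∃ u, IsGaugeDefect B M lam m I G Q u := by
  obtain ⟨⟨v, hv, hvG, hvQ⟩, hric⟩ := hG
  have hreg := hB.smooth_standardVariables hI lam m (hB.smooth_solution hI hQP).1
  set w := standardVariables B lam m Q with hw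
  have hS := hM.isHypEigen
  have hcv := hv.contDiffOn_amp hB lam
  have hcw := hreg.contDiffOn_amp hB lam
  have hu : ∀ i, ContDiffOn ℝ (2 : ℕ∞) (fun t => (v.amp B lam t - w.amp B lam t) i) I :=
    fun i => (hcv i).sub (hcw i)
  obtain ⟨dv, dv'⟩ := hasProperDeriv_properDerivVec hB hI hcv
  obtain ⟨dw, dw'⟩ := hasProperDeriv_properDerivVec hB hI hcw
  obtain ⟨du, du'⟩ := hasProperDeriv_properDerivVec hB hI hu
  have e1 : ∀ t ∈ I, properDerivVec B (fun t => v.amp B lam t - w.amp B lam t) t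
      = properDerivVec B (v.amp B lam) t - properDerivVec B (w.amp B lam) t := fun t ht =>
    funext fun i => HasProperDeriv.unique hB hI (du i) ((dv i).sub (dw i)) (fun _ _ => rfl) ht
  have e2 : ∀ t ∈ I, properDerivVec B (properDerivVec B
        (fun t => v.amp B lam t - w.amp B lam t)) t
      = properDerivVec B (properDerivVec B (v.amp B lam)) t
        - properDerivVec B (properDerivVec B (w.amp B lam)) t := fun t ht =>
    funext fun i => HasProperDeriv.unique hB hI (du' i) ((dv' i).sub (dw' i))
      (fun t ht => congrFun (e1 t ht) i) ht
  refine ⟨fun t => v.amp B lam t - w.amp B lam t, hu, fun p hp a b => ?_, fun t ht => ?_,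
    fun t ht => ?_⟩
  · beta_reduce
    rw [mul_sub, comp₂_sub, mul_sub, ← v.hasAmplitudes_perturbation hB hlam hS p hp a b,
      ← w.hasAmplitudes_perturbation hB hlam hS p hp a b, mul_Geven_eq_perturbation, ← hvG p hp a b]
  · rw [invariantOf_sub, ← v.gaugeInvariant_eq_invariantOf B hlam,
      ← w.gaugeInvariant_eq_invariantOf B hlam, ← hvQ t ht,
      hB.gaugeInvariant_standardVariables m hlam Q ht, sub_self]
  · rw [e1 t ht, e2 t ht, ricciAmp_sub,
      ricciAmp_eq_zero_of_linRicci hB hI hlam hM hv hvG hric ht,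
      ricciAmp_standardVariables hB hI hlam hQP dw dw' ht, sub_self]

/-- Gauge vectors of different solutions are proportional; this forces them to vanish. -/
theorem eq_zero_of_isGaugeDefect (hc : I.OrdConnected) {G : Tensor2}
    (hG : ∀ Q P, B.GaugeInvariantEvolution lam m I Q P → ∃ u, IsGaugeDefect B M lam m I G Q u)
    {Q P : ℝ → ℝ} (hQP : B.GaugeInvariantEvolution lam m I Q P) {u : ℝ → Fin 7 → ℝ}
    (hu : IsGaugeDefect B M lam m I G Q u) {t : ℝ} (ht : t ∈ I) : u t = 0 := by
  have hd : ∀ {f : ℝ → ℝ}, ContDiffOn ℝ (2 : ℕ∞) f I → HasProperDeriv B I f (properDeriv B f) :=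
    fun hf => hasProperDeriv_properDeriv hB (differentiableAt_of_contDiffOn hI hf (by decide))
  have hvec : ∀ t ∈ I, timeOf B lam u t = 0 ∧ baseOf B u t = 0 ∧ fiberOf B m u t = 0 := by
    intro t ht
    -- R equals 1 at t, while T vanishes at t with nonzero momentum, hence nonzero derivative.
    obtain ⟨R, P₁, hR, hR1, -⟩ := hB.exists_solution hI hc lam m ht 1 0
    obtain ⟨T, P₂, hT, hT0, hT1⟩ := hB.exists_solution hI hc lam m ht 0 1
    obtain ⟨r, hr⟩ := hG R P₁ hR
    obtain ⟨s, hs⟩ := hG T P₂ hT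
    -- R u_T = T u_R at t, where R = 1 and T = 0.
    have hs0 : s t = 0 := by
      simpa [hR1, hT0] using hs.smul_eq hB hlam hM hr ht
    have hαs : timeOf B lam s t = 0 := by simp [timeOf, baseOf, hs0]
    have hβs : baseOf B s t = 0 := by simp [baseOf, hs0]
    have hζs : fiberOf B m s t = 0 := by simp [fiberOf, baseOf, hs0]
    obtain ⟨g0, g1, g2⟩ := eq_gauge_of_ricciAmp_eq_zero hB hI hlam hs.contDiffOn hs.invariant
      hs.ricci ht
    have hq₁ := (hB.q₁_pos t ht).ne'
    have hq₂ := (hB.q₂_pos t ht).ne'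
    -- The lapse and shift amplitudes of the defect of T vanish at t and contain the derivative of
    -- its gauge vector, which therefore vanishes too.
    have dα : properDeriv B (timeOf B lam s) t = 0 := by
      simp only [hs0, Pi.zero_apply] at g0; linarith
    have dβ : properDeriv B (baseOf B s) t = 0 := by
      simpa [hs0, hαs, hq₁] using g1.symm
    have dζ : properDeriv B (fiberOf B m s) t = 0 := by
      simpa [hs0, hαs, hq₂] using g2.symm
    have hTd := hB.hasProperDeriv_Q hT
    have hQd := hB.hasProperDeriv_Q hQP
    have hT' : B.q₁ t * B.H₁ t * (B.scaledOmega lam m t * B.q₂ t / B.q₁ t)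
        * (P₂ t * √(B.q₂ t) / (B.q₁ t * B.H₁ t)) ≠ 0 := by
      have h1 := hB.H₁_ne_zero ht
      have h2 := (hB.scaledOmega_pos ht lam m).ne'
      have h3 := (Real.sqrt_pos.2 (hB.q₂_pos t ht)).ne'
      rw [hT1]
      positivity
    have hprop : ∀ r ∈ I, ∀ i, T r * u r i = Q r * s r i := fun r hr i => by
      simpa using congrFun (hu.smul_eq hB hlam hM hs hr) i
    have hbase : ∀ r ∈ I, T r * baseOf B u r = Q r * baseOf B s r := fun r hr => by
      simp only [baseOf]
      linear_combination hprop r hr 4 / (2 * B.q₁ r)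
    have htime : ∀ r ∈ I, T r * timeOf B lam u r = Q r * timeOf B lam s r := fun r hr => by
      simp only [timeOf]
      linear_combination hprop r hr 3 / B.q₁ r / (2 * B.H₁ r)
        + lam ^ 2 * hbase r hr / (2 * B.H₁ r)
    have hfiber : ∀ r ∈ I, T r * fiberOf B m u r = Q r * fiberOf B m s r := fun r hr => by
      simp only [fiberOf]
      linear_combination hprop r hr 6 / B.q₂ r + m * B.q₁ r * hbase r hr / B.q₂ r
    -- Differentiating T f = Q g at t leaves only T' f, because T, g and g' vanish there.
    have hzero : ∀ {f g : ℝ → ℝ}, ContDiffOn ℝ (2 : ℕ∞) f I → ContDiffOn ℝ (2 : ℕ∞) g I →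
        (∀ r ∈ I, T r * f r = Q r * g r) → g t = 0 → properDeriv B g t = 0 → f t = 0 := by
      intro f g hf hg hfg h0 h1
      have e := HasProperDeriv.unique hB hI (hTd.mul (hd hf)) (hQd.mul (hd hg)) hfg ht
      simp only [hT0, h0, h1, zero_mul, mul_zero, add_zero] at e
      exact (mul_eq_zero.1 e).resolve_left hT'
    exact ⟨hzero (contDiffOn_timeOf hB hu.contDiffOn lam) (contDiffOn_timeOf hB hs.contDiffOn lam)
        htime hαs dα,
      hzero (contDiffOn_baseOf hB hu.contDiffOn) (contDiffOn_baseOf hB hs.contDiffOn) hbase hβs dβ,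
      hzero (contDiffOn_fiberOf hB hu.contDiffOn m) (contDiffOn_fiberOf hB hs.contDiffOn m)
        hfiber hζs dζ⟩
  -- The gauge vector vanishes on all of I, hence so does its derivative, and then lapse and shift.
  have hzero : ∀ {f : ℝ → ℝ}, ContDiffOn ℝ (2 : ℕ∞) f I → (∀ r ∈ I, f r = 0) →
      properDeriv B f t = 0 := fun hf h0 =>
    HasProperDeriv.unique hB hI (hd hf) (hasProperDeriv_const 0) h0 ht
  obtain ⟨g0, g1, g2⟩ := eq_gauge_of_ricciAmp_eq_zero hB hI hlam hu.contDiffOn hu.invariant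
    hu.ricci ht
  obtain ⟨hα, hβ, hζ⟩ := hvec t ht
  rw [hzero (contDiffOn_timeOf hB hu.contDiffOn lam) fun r hr => (hvec r hr).1] at g0
  rw [hzero (contDiffOn_baseOf hB hu.contDiffOn) fun r hr => (hvec r hr).2.1, hα] at g1
  rw [hzero (contDiffOn_fiberOf hB hu.contDiffOn m) fun r hr => (hvec r hr).2.2, hα] at g2
  have hq₁ := (hB.q₁_pos t ht).ne'
  have hq₂ := (hB.q₂_pos t ht).ne'
  have hH := hB.H₁_ne_zero ht
  have g4 : u t 4 = 0 := by simpa [baseOf, hq₁] using hβ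
  have g3 : u t 3 = 0 := by simpa [timeOf, hβ, hq₁, hH] using hα
  have g6 : u t 6 = 0 := by simpa [fiberOf, hβ, hq₂] using hζ
  have g5 : u t 5 = 0 := by simpa [invariantOf, g3, g4, g6] using hu.invariant t ht
  ext i
  fin_cases i
  · simpa using g0
  · simpa using g1
  · simpa using g2
  all_goals assumption

theorem eq_Geven_of_isEvenVacuumPerturbation (hc : I.OrdConnected) {G : Tensor2}
    (hG : ∀ Q P : ℝ → ℝ, B.GaugeInvariantEvolution lam m I Q P →
      IsEvenVacuumPerturbation B M lam m I Q (fun a b p => Q (p 0) * G a b p)) {p : Pt}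
    (hp : p ∈ domain I) (a b : Fin 4) : G a b p = Geven B M lam m a b p := by
  have hdef : ∀ Q P, B.GaugeInvariantEvolution lam m I Q P →
      ∃ u, IsGaugeDefect B M lam m I G Q u :=
    fun Q P hQP => exists_isGaugeDefect hB hI hlam hM hQP (hG Q P hQP)
  -- With Q = 1 at the time of p, the vanishing of Q(G - G^(even)) is the desired equality.
  obtain ⟨Q, P, hQP, hQ1, -⟩ := hB.exists_solution hI hc lam m hp.1 1 0
  obtain ⟨u, hu⟩ := hdef Q P hQP
  have h := hu.hasAmplitudes p hp a b
  rw [eq_zero_of_isGaugeDefect hB hI hlam hM hc hdef hQP hu hp.1, comp₂_zero, mul_zero] at h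
  simp only [hQ1, one_mul] at h
  exact sub_eq_zero.1 h

end

end BianchiIII

end

theorem mainTheorem6 (I : Set ℝ) (hIopen : IsOpen I) (hIconn : I.OrdConnected)
    (B : BianchiIII.Background) (hB : B.IsVacuum I)
    (lam : ℝ) (hlam : 0 < lam) (m : ℤ)
    (M : BianchiIII.ModeFunctions) (hM : M.IsMode lam m)
    (G : BianchiIII.Tensor2) :
    (∀ Q P : ℝ → ℝ, B.GaugeInvariantEvolution lam m I Q P →
        BianchiIII.IsEvenVacuumPerturbation B M lam m I Q (fun a b p => Q (p 0) * G a b p))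
      ↔ ∀ p ∈ BianchiIII.domain I, ∀ a b, G a b p = BianchiIII.Geven B M lam m a b p := by
  -- Connectedness of I is needed only in this first direction, for the existence of solutions on
  -- all of I.
  exact ⟨fun hG _ hp a b =>
      BianchiIII.eq_Geven_of_isEvenVacuumPerturbation hB hIopen hlam hM hIconn hG hp a b,
    fun hG _ _ hQP =>
      BianchiIII.isEvenVacuumPerturbation_of_eq_Geven hB hIopen hlam hM hQP hG⟩
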